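/- Let $(M,g)$ be a closed (compact, without boundary) smooth Riemannian manifold of dimension $n$ with volume measure $d\mathrm{vol}$, and let $\alpha$ be a smooth real $1$-form on $M$. Write $\nabla$ for the Levi-Civita connection, $\mathrm{Ric}$ for the Ricci curvature, and $d\alpha$ for the exterior derivative of $\alpha$, so that $d\alpha(X,Y)=X(\alpha(Y))-Y(\alpha(X))-\alpha([X,Y])$. On the complexified tangent and cotangent bundles, $\langle\cdot,\cdot\rangle$ is the Hermitian extension of $g$ (complex linear in the first entry), $d\alpha$ and $(Y,X)\mapsto\nabla_Y X$ are extended complex bilinearly, and $\mathrm{Ric}$ is extended sesquilinearly (linear in the first, antilinear in the second entry). For a smooth function $f:M\to\mathbb{C}$ put $$d^\alpha f=df+if\alpha,\qquad \nabla^\alpha f=(d^\alpha f)^\sharp=\operatorname{grad} f+if\alpha^\sharp,\qquad \Delta^\alpha f=(d^\alpha)^*d^\alpha f,$$ where $(d^\alpha)^*$ is the formal $L^2$-adjoint of $d^\alpha$. Let $\nabla^\alpha_Y X=\nabla_Y X+i\alpha(Y)X$ be the magnetic covariant derivative and $\mathrm{Hess}^\alpha f(X,Y)=\langle\nabla^\alpha_X\nabla^\alpha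 f,Y\rangle$ the magnetic Hessian. For a real orthonormal basis $e_1,\dots,e_n$ of $T_pM$, put at $p$ $$|\mathrm{Hess}^\alpha f|^2=\sum_{j,k}|\mathrm{Hess}^\alpha f(e_j,e_k)|^2,\qquad |d\alpha|^2=\sum_{j<k}d\alpha(e_j,e_k)^2 .$$ Then, for all $f\in C^\infty(M,\mathbb{C})$, the five integrands below are integrable and $$\int_M|\mathrm{Hess}^\alpha f|^2\,d\mathrm{vol}+\int_M\mathrm{Ric}(\nabla^\alpha f,\nabla^\alpha f)\,d\mathrm{vol}-\int_M\mathrm{Re}\,\langle\nabla^\alpha(\Delta^\alpha f),\nabla^\alpha f\rangle\,d\mathrm{vol}-\int_M|f|^2|d\alpha|^2\,d\mathrm{vol}+\int_M\mathrm{Re}\bigl(i\,d\alpha(\nabla^\alpha f,\overline{\nabla^\alpha f})\bigr)\,d\mathrm{vol}=0 .$$ -/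

import Mathlib

open Bundle Manifold MeasureTheory
open scoped ContDiff

noncomputable section

namespace MagneticLaplacian

/-! ### Complexification of a real inner product space -/

/-- The complexification `V ⊗ ℂ = V ⊕ i V` of a real vector space; `⟨u, v⟩` stands for `u + i v`. -/
@[ext]
structure Cx (V : Type*) where
  /-- the real part -/
  re : V
  /-- the imaginary part -/
  im : V

namespace Cx

variable {V : Type*} [AddCommGroup V] [Module ℝ V]

/-- A real vector, seen in the complexification. -/
def ofReal (u : V) : Cx V := ⟨u, 0⟩

/-- Complex conjugation `u + i v ↦ u - i v`. -/
def conj (Z : Cx V) : Cx V := ⟨Z.re, -Z.im⟩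

instance : Add (Cx V) := ⟨fun Z W ↦ ⟨Z.re + W.re, Z.im + W.im⟩⟩

instance : SMul ℂ (Cx V) :=
  ⟨fun c Z ↦ ⟨c.re • Z.re - c.im • Z.im, c.re • Z.im + c.im • Z.re⟩⟩

/-- The complex linear extension of a real linear form. -/
def linExt (a : V → ℝ) (Z : Cx V) : ℂ := (a Z.re : ℂ) + Complex.I * (a Z.im : ℂ)

/-- The complex bilinear extension of a real bilinear form. -/
def bilinExt (B : V → V → ℝ) (Z W : Cx V) : ℂ :=
  ((B Z.re W.re - B Z.im W.im : ℝ) : ℂ) + Complex.I * ((B Z.re W.im + B Z.im W.re : ℝ) : ℂ)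

/-- The sesquilinear extension of a real bilinear form, complex linear in the first entry and
complex antilinear in the second one. -/
def sesqExt (B : V → V → ℝ) (Z W : Cx V) : ℂ := bilinExt B Z W.conj

end Cx

/-- The Hermitian extension to `V ⊗ ℂ` of the inner product of `V`, complex linear in the first
entry. -/
def herm {V : Type*} [NormedAddCommGroup V] [InnerProductSpace ℝ V] (Z W : Cx V) : ℂ :=
  Cx.sesqExt (fun u v ↦ inner ℝ u v) Z W

/-! ### Riemannian geometry -/

variable {n : ℕ} {M : Type*} [TopologicalSpace M] [ChartedSpace (EuclideanSpace ℝ (Fin n)) M]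
  [IsManifold (𝓡 n) ∞ M] [RiemannianBundle (fun x : M ↦ TangentSpace (𝓡 n) x)]

instance (x : M) : FiniteDimensional ℝ (TangentSpace (𝓡 n) x) :=
  inferInstanceAs (FiniteDimensional ℝ (EuclideanSpace ℝ (Fin n)))

/-- An orthonormal basis of `T_x M`. -/
def frame (x : M) :
    OrthonormalBasis (Fin (Module.finrank ℝ (TangentSpace (𝓡 n) x))) ℝ (TangentSpace (𝓡 n) x) :=
  stdOrthonormalBasis ℝ (TangentSpace (𝓡 n) x)

/-- A vector field that is smooth near `x` and whose value at `x` is `v`. -/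
def locExt {x : M} (v : TangentSpace (𝓡 n) x) (y : M) : TangentSpace (𝓡 n) y :=
  FiberBundle.extend (EuclideanSpace ℝ (Fin n)) v y

/-- The right-hand side of the Koszul formula for `⟨∇_X Y, Z⟩` at `x`. -/
def koszul (X Y Z : Π y : M, TangentSpace (𝓡 n) y) (x : M) : ℝ :=
  (1 / 2) * (mvfderiv (𝓡 n) (fun y ↦ inner ℝ (Y y) (Z y)) x (X x)
    + mvfderiv (𝓡 n) (fun y ↦ inner ℝ (X y) (Z y)) x (Y x)
    - mvfderiv (𝓡 n) (fun y ↦ inner ℝ (X y) (Y y)) x (Z x)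
    + inner ℝ (VectorField.mlieBracket (𝓡 n) X Y x) (Z x)
    - inner ℝ (VectorField.mlieBracket (𝓡 n) X Z x) (Y x)
    - inner ℝ (VectorField.mlieBracket (𝓡 n) Y Z x) (X x))

/-- The Levi-Civita connection: `nabla v Y` is `∇_v Y`, for `v ∈ T_x M` and a vector field `Y`. -/
def nabla {x : M} (v : TangentSpace (𝓡 n) x) (Y : Π y : M, TangentSpace (𝓡 n) y) :
    TangentSpace (𝓡 n) x :=
  ∑ i, koszul (locExt v) Y (locExt (frame x i)) x • frame x i

/-- The Riemannian curvature tensor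
`R(u, v) w = ∇_u ∇_v w - ∇_v ∇_u w - ∇_{[u, v]} w` at `x`. -/
def curvature {x : M} (u v w : TangentSpace (𝓡 n) x) : TangentSpace (𝓡 n) x :=
  nabla u (fun y ↦ nabla (locExt v y) (locExt w)) - nabla v (fun y ↦ nabla (locExt u y) (locExt w))
    - nabla (VectorField.mlieBracket (𝓡 n) (locExt u) (locExt v) x) (locExt w)

/-- The Ricci curvature `Ric(u, v) = ∑ ⟨R(e_i, u) v, e_i⟩`. -/
def ricci {x : M} (u v : TangentSpace (𝓡 n) x) : ℝ :=
  ∑ i, inner ℝ (curvature (frame x i) u v) (frame x i)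

/-- The vector metrically dual to a real covector. -/
def sharp {x : M} (a : TangentSpace (𝓡 n) x →L[ℝ] ℝ) : TangentSpace (𝓡 n) x :=
  ∑ i, a (frame x i) • frame x i

/-- The exterior derivative
`dα(u, v) = u(α(v)) - v(α(u)) - α([u, v])` of a real 1-form. -/
def extDer (α : Π y : M, TangentSpace (𝓡 n) y →L[ℝ] ℝ) {x : M} (u v : TangentSpace (𝓡 n) x) : ℝ :=
  mvfderiv (𝓡 n) (fun y ↦ α y (locExt v y)) x u - mvfderiv (𝓡 n) (fun y ↦ α y (locExt u y)) x v
    - α x (VectorField.mlieBracket (𝓡 n) (locExt u) (locExt v) x)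

/-- The squared norm `|dα|² = ∑_{i < j} dα(e_i, e_j)²` of the 2-form `dα` at `x`. -/
def extDerNormSq (α : Π y : M, TangentSpace (𝓡 n) y →L[ℝ] ℝ) (x : M) : ℝ :=
  ∑ i, ∑ j ∈ Finset.Ioi i, extDer α (frame x i) (frame x j) ^ 2

/-- The Riemannian volume measure of the domain of the chart at `x`, that is
`√(det (g_ij)) dx¹ ⋯ dxⁿ`, extended by zero to `M`. -/
def chartVolume [MeasurableSpace M] (x : M) : Measure M :=
  (((volume : Measure (EuclideanSpace ℝ (Fin n))).restrict
    (extChartAt (𝓡 n) x).target).withDensity fun y ↦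
      ENNReal.ofReal √(Matrix.gram ℝ fun i : Fin n ↦
        (mfderiv 𝓘(ℝ, EuclideanSpace ℝ (Fin n)) (𝓡 n) (extChartAt (𝓡 n) x).symm y
          (EuclideanSpace.single i (1 : ℝ)) :
            TangentSpace (𝓡 n) ((extChartAt (𝓡 n) x).symm y))).det).map
    (extChartAt (𝓡 n) x).symm

/-- The Riemannian volume measure. The measures `chartVolume x` agree on the intersections of the
chart domains, so their supremum is the measure that restricts to each of them. -/
def riemannianVolume (n : ℕ) (M : Type*) [TopologicalSpace M]
    [ChartedSpace (EuclideanSpace ℝ (Fin n)) M] [IsManifold (𝓡 n) ∞ M]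
    [RiemannianBundle (fun x : M ↦ TangentSpace (𝓡 n) x)] [MeasurableSpace M] : Measure M :=
  ⨆ x : M, chartVolume (n := n) x

/-! ### The magnetic operators of a real 1-form `α` -/

/-- The complexified musical isomorphism `T*M ⊗ ℂ → TM ⊗ ℂ`; a complex covector at `x` is a real
linear map `T_x M → ℂ`. -/
def sharpC {x : M} (w : TangentSpace (𝓡 n) x →L[ℝ] ℂ) : Cx (TangentSpace (𝓡 n) x) :=
  ⟨sharp (Complex.reCLM ∘L w), sharp (Complex.imCLM ∘L w)⟩

/-- The Hermitian inner product of complex covectors. -/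
def hermForm {x : M} (w v : TangentSpace (𝓡 n) x →L[ℝ] ℂ) : ℂ :=
  ∑ i, w (frame x i) * starRingEnd ℂ (v (frame x i))

/-- `d^α f = df + i f α`. -/
def magD (α : Π y : M, TangentSpace (𝓡 n) y →L[ℝ] ℝ) (f : M → ℂ) (x : M) :
    TangentSpace (𝓡 n) x →L[ℝ] ℂ :=
  mvfderiv (𝓡 n) f x + (Complex.I * f x) • (Complex.ofRealCLM ∘L α x)

/-- `h` is the image of the complex 1-form `η` under the formal adjoint of `d^α`. -/
def IsMagDAdjoint [MeasurableSpace M] (α : Π y : M, TangentSpace (𝓡 n) y →L[ℝ] ℝ)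
    (η : Π y : M, TangentSpace (𝓡 n) y →L[ℝ] ℂ) (h : M → ℂ) : Prop :=
  ContMDiff (𝓡 n) 𝓘(ℝ, ℂ) ∞ h ∧
    ∀ φ : M → ℂ, ContMDiff (𝓡 n) 𝓘(ℝ, ℂ) ∞ φ →
      ∫ x, hermForm (magD α φ x) (η x) ∂(riemannianVolume n M) =
        ∫ x, φ x * starRingEnd ℂ (h x) ∂(riemannianVolume n M)

/-- The formal adjoint `(d^α)^*` of `d^α`, from smooth complex 1-forms to smooth functions. -/
def magDStar [MeasurableSpace M] (α : Π y : M, TangentSpace (𝓡 n) y →L[ℝ] ℝ)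
    (η : Π y : M, TangentSpace (𝓡 n) y →L[ℝ] ℂ) : M → ℂ :=
  Classical.epsilon (IsMagDAdjoint α η)

/-- The magnetic Laplacian `Δ^α = (d^α)^* d^α`. -/
def magLaplacian [MeasurableSpace M] (α : Π y : M, TangentSpace (𝓡 n) y →L[ℝ] ℝ) (f : M → ℂ) :
    M → ℂ :=
  magDStar α (magD α f)

/-- The magnetic gradient `grad^α f = (d^α f)^♯`. -/
def magGrad (α : Π y : M, TangentSpace (𝓡 n) y →L[ℝ] ℝ) (f : M → ℂ) (x : M) :
    Cx (TangentSpace (𝓡 n) x) :=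
  sharpC (magD α f x)

/-- The complex bilinear extension of the Levi-Civita connection. -/
def nablaC {x : M} (Y : Cx (TangentSpace (𝓡 n) x)) (X : Π y : M, Cx (TangentSpace (𝓡 n) y)) :
    Cx (TangentSpace (𝓡 n) x) :=
  ⟨nabla Y.re (fun y ↦ (X y).re) - nabla Y.im (fun y ↦ (X y).im),
    nabla Y.re (fun y ↦ (X y).im) + nabla Y.im (fun y ↦ (X y).re)⟩

/-- The magnetic covariant derivative `∇^α_Y X = ∇_Y X + i α(Y) X`. -/
def magNabla (α : Π y : M, TangentSpace (𝓡 n) y →L[ℝ] ℝ) {x : M} (Y : Cx (TangentSpace (𝓡 n) x))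
    (X : Π y : M, Cx (TangentSpace (𝓡 n) y)) : Cx (TangentSpace (𝓡 n) x) :=
  nablaC Y X + (Complex.I * Cx.linExt (fun u ↦ α x u) Y) • X x

/-- The magnetic Hessian `Hess^α f(X, Y) = ⟨∇^α_X grad^α f, Y⟩`. -/
def magHess (α : Π y : M, TangentSpace (𝓡 n) y →L[ℝ] ℝ) (f : M → ℂ) {x : M}
    (X Y : Cx (TangentSpace (𝓡 n) x)) : ℂ :=
  herm (magNabla α X (magGrad α f)) Y

/-- The squared Hilbert-Schmidt norm `|Hess^α f|²` at `x`. -/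
def magHessNormSq (α : Π y : M, TangentSpace (𝓡 n) y →L[ℝ] ℝ) (f : M → ℂ) (x : M) : ℝ :=
  ∑ i, ∑ j, ‖magHess α f (Cx.ofReal (frame x i)) (Cx.ofReal (frame x j))‖ ^ 2

end MagneticLaplacian

end

open MagneticLaplacian

noncomputable section

namespace MagneticLaplacian

open scoped Topology

/-! ### Affine connections on an open subset of a vector space -/

section Flat

variable {E : Type*} [NormedAddCommGroup E] [NormedSpace ℝ E]

/-- The trace of a continuous endomorphism, as a continuous linear form. -/
def endTr (E : Type*) [NormedAddCommGroup E] [NormedSpace ℝ E] [FiniteDimensional ℝ E] :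
    (E →L[ℝ] E) →L[ℝ] ℝ :=
  LinearMap.toContinuousLinearMap ((LinearMap.trace ℝ E).comp (ContinuousLinearMap.coeLM ℝ))

theorem endTr_apply [FiniteDimensional ℝ E] (A : E →L[ℝ] E) : endTr E A = LinearMap.trace ℝ E (A :
    E →ₗ[ℝ] E) := rfl

theorem endTr_comp_comm [FiniteDimensional ℝ E] (A B : E →L[ℝ] E) : endTr E (A.comp B) = endTr E
    (B.comp A) :=
  LinearMap.trace_mul_comm ℝ (A : E →ₗ[ℝ] E) (B : E →ₗ[ℝ] E)

theorem endTr_smulRight [FiniteDimensional ℝ E] (c : E →L[ℝ] ℝ) (v : E) : endTr E (c.smulRight v) =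
    c v := by
  rw [endTr_apply]
  exact LinearMap.trace_smulRight (c : E →ₗ[ℝ] ℝ) v

/-- The endomorphism `a ↦ ∇_a Y` at `u`, where `∇` has Christoffel symbols `Γ`. -/
def covD (Γ : E → E →L[ℝ] E →L[ℝ] E) (Y : E → E) (u : E) : E →L[ℝ] E :=
  fderiv ℝ Y u + (Γ u).flip (Y u)

theorem covD_apply (Γ : E → E →L[ℝ] E →L[ℝ] E) (Y : E → E) (u a : E) :
    covD Γ Y u a = fderiv ℝ Y u a + Γ u a (Y u) := rfl

/-- The endomorphism `a ↦ R(a, b) c` at `u`, where `R` is the curvature of the connection with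
Christoffel symbols `Γ`. -/
def curvEnd (Γ : E → E →L[ℝ] E →L[ℝ] E) (u b c : E) : E →L[ℝ] E :=
  ((fderiv ℝ Γ u).flip b).flip c - (fderiv ℝ Γ u b).flip c + (Γ u).flip (Γ u b c)
    - (Γ u b).comp ((Γ u).flip c)

theorem curvEnd_apply (Γ : E → E →L[ℝ] E →L[ℝ] E) (u a b c : E) :
    curvEnd Γ u b c a = fderiv ℝ Γ u a b c - fderiv ℝ Γ u b a c + Γ u a (Γ u b c)
      - Γ u b (Γ u a c) := rfl

theorem contDiffOn_covD {U : Set E} (hU : IsOpen U) {Γ : E → E →L[ℝ] E →L[ℝ] E} {Y : E → E}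
    (hΓ : ContDiffOn ℝ ∞ Γ U) (hY : ContDiffOn ℝ ∞ Y U) : ContDiffOn ℝ ∞ (covD Γ Y) U := by
  have h1 : ContDiffOn ℝ ∞ (fderiv ℝ Y) U := hY.fderiv_of_isOpen hU (by simp)
  have h2 : ContDiffOn ℝ ∞ (fun u ↦ (Γ u).flip) U :=
    (ContinuousLinearMap.flipₗᵢ ℝ E E E).toContinuousLinearEquiv.contDiff.comp_contDiffOn hΓ
  exact h1.add (h2.clm_apply hY)

theorem hasFDerivAt_covD {Γ : E → E →L[ℝ] E →L[ℝ] E} {Y : E → E} {u : E}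
    (hΓ : DifferentiableAt ℝ Γ u) (hY : ContDiffAt ℝ 2 Y u) :
    DifferentiableAt ℝ (covD Γ Y) u ∧ ∀ a b, fderiv ℝ (covD Γ Y) u a b =
      fderiv ℝ (fderiv ℝ Y) u a b + fderiv ℝ Γ u a b (Y u) + Γ u b (fderiv ℝ Y u a) := by
  have h1 : DifferentiableAt ℝ (fderiv ℝ Y) u :=
    (hY.fderiv_right (m := 1) (by norm_num)).differentiableAt (by norm_num)
  have h2 : DifferentiableAt ℝ Y u := hY.differentiableAt (by norm_num)
  have h3 : HasFDerivAt (fun u ↦ (Γ u).flip)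
      (((ContinuousLinearMap.flipₗᵢ ℝ E E E).toContinuousLinearEquiv :
        _ →L[ℝ] _).comp (fderiv ℝ Γ u)) u :=
    (ContinuousLinearMap.flipₗᵢ ℝ E E E).toContinuousLinearEquiv.hasFDerivAt.comp u hΓ.hasFDerivAt
  have h4 := h1.hasFDerivAt.add (h3.clm_apply h2.hasFDerivAt)
  have h5 : HasFDerivAt (covD Γ Y) _ u := h4
  refine ⟨h5.differentiableAt, fun a b ↦ ?_⟩
  rw [h5.fderiv]
  simp
  abel

theorem hasFDerivAt_covD_apply {Γ : E → E →L[ℝ] E →L[ℝ] E} {Y V : E → E} {u : E}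
    (hΓ : DifferentiableAt ℝ Γ u) (hY : ContDiffAt ℝ 2 Y u) (hV : DifferentiableAt ℝ V u) (a : E) :
    fderiv ℝ (fun w ↦ covD Γ Y w (V w)) u a = fderiv ℝ (fderiv ℝ Y) u a (V u) +
      fderiv ℝ Γ u a (V u) (Y u) + Γ u (V u) (fderiv ℝ Y u a) + covD Γ Y u (fderiv ℝ V u a) := by
  obtain ⟨h1, h2⟩ := hasFDerivAt_covD hΓ hY
  rw [(h1.hasFDerivAt.clm_apply hV.hasFDerivAt).fderiv]
  simp [h2]
  abel

/-- The curvature tensor computed with arbitrary vector fields. -/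
theorem covD_comm_eq_curvEnd {Γ : E → E →L[ℝ] E →L[ℝ] E} {X Y V : E → E} {u : E}
    (hΓ : DifferentiableAt ℝ Γ u)
    (hX : DifferentiableAt ℝ X u) (hY : ContDiffAt ℝ 2 Y u) (hV : DifferentiableAt ℝ V u) :
    covD Γ (fun w ↦ covD Γ Y w (V w)) u (X u) - covD Γ (fun w ↦ covD Γ Y w (X w)) u (V u)
      - covD Γ Y u (fderiv ℝ V u (X u) - fderiv ℝ X u (V u)) = curvEnd Γ u (V u) (Y u) (X u) := by
  have hs : fderiv ℝ (fderiv ℝ Y) u (X u) (V u) = fderiv ℝ (fderiv ℝ Y) u (V u) (X u) :=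
    (hY.isSymmSndFDerivAt (by simp)) _ _
  rw [covD_apply Γ (fun w ↦ covD Γ Y w (V w)), covD_apply Γ (fun w ↦ covD Γ Y w (X w)),
    hasFDerivAt_covD_apply hΓ hY hV, hasFDerivAt_covD_apply hΓ hY hX, curvEnd_apply, hs]
  simp only [covD_apply, map_add, map_sub]
  abel

/-- The divergence of `∇_S P`. -/
theorem endTr_covD_covD [FiniteDimensional ℝ E] {Γ : E → E →L[ℝ] E →L[ℝ] E} {P V : E → E} {u : E}
    (hΓ : DifferentiableAt ℝ Γ u) (hsymm : ∀ a b, Γ u a b = Γ u b a)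
    (hP : ContDiffAt ℝ 2 P u) (hV : DifferentiableAt ℝ V u) :
    endTr E (covD Γ (fun w ↦ covD Γ P w (V w)) u) =
      endTr E ((covD Γ P u).comp (covD Γ V u)) + fderiv ℝ (fun w ↦ endTr E (covD Γ P w)) u (V u)
        + endTr E (curvEnd Γ u (V u) (P u)) := by
  obtain ⟨h1, h2⟩ := hasFDerivAt_covD hΓ hP
  have h3 : fderiv ℝ (fun w ↦ endTr E (covD Γ P w)) u (V u) =
      endTr E (fderiv ℝ (covD Γ P) u (V u)) := by
    have : HasFDerivAt (fun w ↦ endTr E (covD Γ P w)) _ u :=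
      (endTr E).hasFDerivAt.comp u h1.hasFDerivAt
    rw [this.fderiv]
    rfl
  have h4 : covD Γ (fun w ↦ covD Γ P w (V w)) u = (covD Γ P u).comp (covD Γ V u) +
      fderiv ℝ (covD Γ P) u (V u) + curvEnd Γ u (V u) (P u) +
        ((Γ u (V u)).comp (covD Γ P u) - (covD Γ P u).comp (Γ u (V u))) := by
    ext a
    have hs : fderiv ℝ (fderiv ℝ P) u a (V u) = fderiv ℝ (fderiv ℝ P) u (V u) a :=
      (hP.isSymmSndFDerivAt (by simp)) _ _
    rw [covD_apply, hasFDerivAt_covD_apply hΓ hP hV]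
    simp only [add_apply, sub_apply,
      ContinuousLinearMap.comp_apply, h2, curvEnd_apply, covD_apply, map_add, hs]
    rw [hsymm a (V u)]
    abel
  rw [h4, h3]
  simp [endTr_comp_comm (Γ u (V u))]

theorem covD_add {Γ : E → E →L[ℝ] E →L[ℝ] E} {X Y : E → E} {u : E}
    (hX : DifferentiableAt ℝ X u) (hY : DifferentiableAt ℝ Y u) :
    covD Γ (fun w ↦ X w + Y w) u = covD Γ X u + covD Γ Y u := by
  ext a
  simp [covD_apply, fderiv_fun_add hX hY]
  abel

theorem covD_sub {Γ : E → E →L[ℝ] E →L[ℝ] E} {X Y : E → E} {u : E}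
    (hX : DifferentiableAt ℝ X u) (hY : DifferentiableAt ℝ Y u) :
    covD Γ (fun w ↦ X w - Y w) u = covD Γ X u - covD Γ Y u := by
  ext a
  simp [covD_apply, fderiv_fun_sub hX hY]
  abel

theorem covD_smul {Γ : E → E →L[ℝ] E →L[ℝ] E} {φ : E → ℝ} {X : E → E} {u : E}
    (hφ : DifferentiableAt ℝ φ u) (hX : DifferentiableAt ℝ X u) :
    covD Γ (fun w ↦ φ w • X w) u = φ u • covD Γ X u + (fderiv ℝ φ u).smulRight (X u) := by
  ext a
  simp [covD_apply, fderiv_fun_smul hφ hX]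
  abel

theorem endTr_covD_smul [FiniteDimensional ℝ E] {Γ : E → E →L[ℝ] E →L[ℝ] E} {φ : E → ℝ} {X : E → E}
    {u : E}
    (hφ : DifferentiableAt ℝ φ u) (hX : DifferentiableAt ℝ X u) :
    endTr E (covD Γ (fun w ↦ φ w • X w) u) = φ u * endTr E (covD Γ X u) + fderiv ℝ φ u (X u) := by
  rw [covD_smul hφ hX, map_add, map_smul, endTr_smulRight, smul_eq_mul]

/-- The magnetic Bochner formula in divergence form. -/
theorem endTr_covD_magnetic [FiniteDimensional ℝ E] {Γ : E → E →L[ℝ] E →L[ℝ] E} {α : E → E →L[ℝ] ℝ}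
    {P Q : E → E} {u : E}
    (hΓ : ContDiffAt ℝ 2 Γ u) (hsymm : ∀ a b, Γ u a b = Γ u b a)
    (hα : ContDiffAt ℝ 2 α u) (hP : ContDiffAt ℝ 3 P u) (hQ : ContDiffAt ℝ 3 Q u)
    {A B : E → E →L[ℝ] E} (hA : A = fun w ↦ covD Γ P w - (α w).smulRight (Q w))
    (hB : B = fun w ↦ covD Γ Q w + (α w).smulRight (P w)) :
    endTr E (covD Γ (fun w ↦ A w (P w) + B w (Q w)
        - (endTr E (A w) • P w + endTr E (B w) • Q w)) u) =
      endTr E (curvEnd Γ u (P u) (P u)) + endTr E (curvEnd Γ u (Q u) (Q u))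
        + endTr E ((A u).comp (A u)) + endTr E ((B u).comp (B u))
        - (endTr E (A u) ^ 2 + endTr E (B u) ^ 2)
        + 2 * (fderiv ℝ α u (P u) (Q u) - fderiv ℝ α u (Q u) (P u)) := by
  have cP : ContDiffAt ℝ 2 (covD Γ P) u := by
    refine ((hP.fderiv_right (m := 2) (by norm_num)).add (ContDiffAt.clm_apply
      ((ContinuousLinearMap.flipₗᵢ ℝ E E E).toContinuousLinearEquiv.contDiff.contDiffAt.comp u hΓ)
      (hP.of_le (by norm_num))))
  have cQ : ContDiffAt ℝ 2 (covD Γ Q) u := by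
    refine ((hQ.fderiv_right (m := 2) (by norm_num)).add (ContDiffAt.clm_apply
      ((ContinuousLinearMap.flipₗᵢ ℝ E E E).toContinuousLinearEquiv.contDiff.contDiffAt.comp u hΓ)
      (hQ.of_le (by norm_num))))
  have dP : DifferentiableAt ℝ P u := hP.differentiableAt (by norm_num)
  have dQ : DifferentiableAt ℝ Q u := hQ.differentiableAt (by norm_num)
  have dα : DifferentiableAt ℝ α u := hα.differentiableAt (by norm_num)
  have dcP : DifferentiableAt ℝ (covD Γ P) u := cP.differentiableAt (by norm_num)
  have dcQ : DifferentiableAt ℝ (covD Γ Q) u := cQ.differentiableAt (by norm_num)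
  have dPP : DifferentiableAt ℝ (fun w ↦ covD Γ P w (P w)) u := dcP.clm_apply dP
  have dQQ : DifferentiableAt ℝ (fun w ↦ covD Γ Q w (Q w)) u := dcQ.clm_apply dQ
  have dαP : DifferentiableAt ℝ (fun w ↦ α w (P w)) u := dα.clm_apply dP
  have dαQ : DifferentiableAt ℝ (fun w ↦ α w (Q w)) u := dα.clm_apply dQ
  have dtP : DifferentiableAt ℝ (fun w ↦ endTr E (covD Γ P w)) u :=
    (endTr E).differentiableAt.comp u dcP
  have dtQ : DifferentiableAt ℝ (fun w ↦ endTr E (covD Γ Q w)) u :=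
    (endTr E).differentiableAt.comp u dcQ
  have tA : ∀ w, endTr E (A w) = endTr E (covD Γ P w) - α w (Q w) := by
    intro w; rw [hA]; simp [endTr_smulRight]
  have tB : ∀ w, endTr E (B w) = endTr E (covD Γ Q w) + α w (P w) := by
    intro w; rw [hB]; simp [endTr_smulRight]
  have key : (fun w ↦ A w (P w) + B w (Q w) - (endTr E (A w) • P w + endTr E (B w) • Q w)) =
      fun w ↦ (covD Γ P w (P w) + covD Γ Q w (Q w)) +
        ((2 * α w (Q w) - endTr E (covD Γ P w)) • P w
          - (2 * α w (P w) + endTr E (covD Γ Q w)) • Q w) := by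
    funext w
    rw [tA, tB, hA, hB]
    simp
    module
  have d1 : DifferentiableAt ℝ (fun w ↦ 2 * α w (Q w) - endTr E (covD Γ P w)) u :=
    (dαQ.const_mul 2).sub dtP
  have d2 : DifferentiableAt ℝ (fun w ↦ 2 * α w (P w) + endTr E (covD Γ Q w)) u :=
    (dαP.const_mul 2).add dtQ
  have e1 : fderiv ℝ (fun w ↦ 2 * α w (Q w) - endTr E (covD Γ P w)) u (P u) =
      2 * (fderiv ℝ α u (P u) (Q u) + α u (fderiv ℝ Q u (P u)))
        - fderiv ℝ (fun w ↦ endTr E (covD Γ P w)) u (P u) := by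
    rw [fderiv_fun_sub (dαQ.const_mul 2) dtP, fderiv_const_mul dαQ, fderiv_clm_apply dα dQ]
    simp; ring
  have e2 : fderiv ℝ (fun w ↦ 2 * α w (P w) + endTr E (covD Γ Q w)) u (Q u) =
      2 * (fderiv ℝ α u (Q u) (P u) + α u (fderiv ℝ P u (Q u)))
        + fderiv ℝ (fun w ↦ endTr E (covD Γ Q w)) u (Q u) := by
    rw [fderiv_fun_add (dαP.const_mul 2) dtQ, fderiv_const_mul dαP, fderiv_clm_apply dα dP]
    simp; ring
  have sqA : endTr E ((A u).comp (A u)) = endTr E ((covD Γ P u).comp (covD Γ P u))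
      - 2 * α u (covD Γ P u (Q u)) + α u (Q u) ^ 2 := by
    have : (A u).comp (A u) = (covD Γ P u).comp (covD Γ P u)
        - (covD Γ P u).comp ((α u).smulRight (Q u)) - ((α u).smulRight (Q u)).comp (covD Γ P u)
        + (α u (Q u)) • (α u).smulRight (Q u) := by
      rw [hA]; ext a; simp; module
    rw [this]
    simp only [map_add, map_sub, map_smul]
    rw [endTr_comp_comm (covD Γ P u) ((α u).smulRight (Q u)), endTr_smulRight]
    have : ((α u).smulRight (Q u)).comp (covD Γ P u) = ((α u).comp (covD Γ P u)).smulRight (Q u) :=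
      rfl
    rw [this, endTr_smulRight]
    simp; ring
  have sqB : endTr E ((B u).comp (B u)) = endTr E ((covD Γ Q u).comp (covD Γ Q u))
      + 2 * α u (covD Γ Q u (P u)) + α u (P u) ^ 2 := by
    have : (B u).comp (B u) = (covD Γ Q u).comp (covD Γ Q u)
        + (covD Γ Q u).comp ((α u).smulRight (P u)) + ((α u).smulRight (P u)).comp (covD Γ Q u)
        + (α u (P u)) • (α u).smulRight (P u) := by
      rw [hB]; ext a; simp; module
    rw [this]
    simp only [map_add, map_smul]
    rw [endTr_comp_comm (covD Γ Q u) ((α u).smulRight (P u)), endTr_smulRight]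
    have : ((α u).smulRight (P u)).comp (covD Γ Q u) = ((α u).comp (covD Γ Q u)).smulRight (P u) :=
      rfl
    rw [this, endTr_smulRight]
    simp; ring
  rw [key, covD_add (dPP.fun_add dQQ) ((d1.fun_smul dP).fun_sub (d2.fun_smul dQ)),
    covD_add dPP dQQ, covD_sub (d1.fun_smul dP) (d2.fun_smul dQ)]
  simp only [map_add, map_sub]
  rw [endTr_covD_covD (hΓ.differentiableAt (by norm_num)) hsymm (hP.of_le (by norm_num)) dP,
    endTr_covD_covD (hΓ.differentiableAt (by norm_num)) hsymm (hQ.of_le (by norm_num)) dQ,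
    endTr_covD_smul d1 dP, endTr_covD_smul d2 dQ, e1, e2, sqA, sqB, tA, tB]
  simp only [covD_apply, map_add, hsymm (Q u) (P u)]
  ring

end Flat

/-! ### The Levi-Civita connection of a metric on an open subset of a vector space -/

section FlatMetric

variable {E : Type*} [NormedAddCommGroup E] [NormedSpace ℝ E]

set_option maxSynthPendingDepth 3 in
/-- The Christoffel symbols of the first kind of the metric `g`. -/
def christoffelLower (g : E → E →L[ℝ] E →L[ℝ] ℝ) (u : E) : E →L[ℝ] E →L[ℝ] E →L[ℝ] ℝ :=
  (1 / 2 : ℝ) • (fderiv ℝ g u + (fderiv ℝ g u).flip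
    - (ContinuousLinearMap.flipₗᵢ ℝ E E ℝ).toContinuousLinearEquiv.toContinuousLinearMap.comp
        (fderiv ℝ g u).flip)

theorem christoffelLower_apply (g : E → E →L[ℝ] E →L[ℝ] ℝ) (u a b c : E) :
    christoffelLower g u a b c =
      (1 / 2) * (fderiv ℝ g u a b c + fderiv ℝ g u b a c - fderiv ℝ g u c a b) := rfl

/-- The Christoffel symbols of the second kind of the metric `g`. -/
def christoffel (g : E → E →L[ℝ] E →L[ℝ] ℝ) (u : E) : E →L[ℝ] E →L[ℝ] E :=
  (ContinuousLinearMap.compL ℝ E (E →L[ℝ] ℝ) E (g u).inverse).comp (christoffelLower g u)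

theorem christoffel_apply (g : E → E →L[ℝ] E →L[ℝ] ℝ) (u a b : E) :
    christoffel g u a b = (g u).inverse (christoffelLower g u a b) := rfl

theorem metric_inverse_apply {g : E →L[ℝ] E →L[ℝ] ℝ} (h : g.IsInvertible) (c : E →L[ℝ] ℝ) :
    g (g.inverse c) = c := by
  obtain ⟨e, rfl⟩ := h
  simp

theorem metric_christoffel {g : E → E →L[ℝ] E →L[ℝ] ℝ} {u : E} (h : (g u).IsInvertible)
    (a b c : E) : g u (christoffel g u a b) c =
      (1 / 2) * (fderiv ℝ g u a b c + fderiv ℝ g u b a c - fderiv ℝ g u c a b) := by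
  rw [christoffel_apply, metric_inverse_apply h, christoffelLower_apply]

theorem fderiv_metric_symm {g : E → E →L[ℝ] E →L[ℝ] ℝ} {u : E} (hg : DifferentiableAt ℝ g u)
    (hs : ∀ᶠ w in 𝓝 u, ∀ a b, g w a b = g w b a) (a b c : E) :
    fderiv ℝ g u a b c = fderiv ℝ g u a c b := by
  have h1 : ∀ b c, fderiv ℝ (fun w ↦ g w b c) u a = fderiv ℝ g u a b c := by
    intro b c
    rw [((hg.hasFDerivAt.clm_apply (hasFDerivAt_const b u)).clm_apply
      (hasFDerivAt_const c u)).fderiv]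
    simp
  rw [← h1, ← h1, Filter.EventuallyEq.fderiv_eq (hs.mono fun w hw ↦ hw b c)]

theorem christoffel_symm {g : E → E →L[ℝ] E →L[ℝ] ℝ} {u : E} (hg : DifferentiableAt ℝ g u)
    (hs : ∀ᶠ w in 𝓝 u, ∀ a b, g w a b = g w b a) (a b : E) :
    christoffel g u a b = christoffel g u b a := by
  rw [christoffel_apply, christoffel_apply]
  congr 1
  ext c
  rw [christoffelLower_apply, christoffelLower_apply, fderiv_metric_symm hg hs c a b]
  ring

theorem fderiv_metric_eq {g : E → E →L[ℝ] E →L[ℝ] ℝ} {u : E} (hg : DifferentiableAt ℝ g u)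
    (hs : ∀ᶠ w in 𝓝 u, ∀ a b, g w a b = g w b a) (h : (g u).IsInvertible) (a b c : E) :
    fderiv ℝ g u a b c = g u (christoffel g u a b) c + g u b (christoffel g u a c) := by
  rw [hs.self_of_nhds b, metric_christoffel h, metric_christoffel h, fderiv_metric_symm hg hs a c b,
    fderiv_metric_symm hg hs b a c, fderiv_metric_symm hg hs c a b]
  ring

theorem contDiffOn_metric_inverse [FiniteDimensional ℝ E] {g : E → E →L[ℝ] E →L[ℝ] ℝ} {U : Set E}
    (hg : ContDiffOn ℝ ∞ g U) (h : ∀ u ∈ U, (g u).IsInvertible) :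
    ContDiffOn ℝ ∞ (fun u ↦ (g u).inverse) U := by
  have : CompleteSpace E := FiniteDimensional.complete ℝ E
  intro u hu
  obtain ⟨e, he⟩ := h u hu
  have := contDiffAt_map_inverse (n := ∞) e
  rw [he] at this
  exact this.comp_contDiffWithinAt u (hg u hu)

set_option maxSynthPendingDepth 3 in
theorem contDiffOn_christoffel [FiniteDimensional ℝ E] {g : E → E →L[ℝ] E →L[ℝ] ℝ} {U : Set E}
    (hU : IsOpen U) (hg : ContDiffOn ℝ ∞ g U) (h : ∀ u ∈ U, (g u).IsInvertible) :
    ContDiffOn ℝ ∞ (christoffel g) U := by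
  have h1 : ContDiffOn ℝ ∞ (fderiv ℝ g) U := hg.fderiv_of_isOpen hU (by simp)
  have h2 : ContDiffOn ℝ ∞ (fun u ↦ (fderiv ℝ g u).flip) U :=
    (ContinuousLinearMap.flipₗᵢ ℝ E E (E →L[ℝ] ℝ)).toContinuousLinearEquiv.contDiff.comp_contDiffOn
      h1
  have h3 : ContDiffOn ℝ ∞ (christoffelLower g) U :=
    ((h1.add h2).sub (contDiffOn_const.clm_comp h2)).const_smul (1 / 2 : ℝ)
  exact ((ContinuousLinearMap.compL ℝ E (E →L[ℝ] ℝ) E).contDiff.comp_contDiffOn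
    (contDiffOn_metric_inverse hg h)).clm_comp h3

theorem fderiv_metric_apply {g : E → E →L[ℝ] E →L[ℝ] ℝ} {u : E} {X Y : E → E}
    (hg : DifferentiableAt ℝ g u) (hX : DifferentiableAt ℝ X u) (hY : DifferentiableAt ℝ Y u)
    (a : E) : fderiv ℝ (fun w ↦ g w (X w) (Y w)) u a =
      fderiv ℝ g u a (X u) (Y u) + g u (fderiv ℝ X u a) (Y u) + g u (X u) (fderiv ℝ Y u a) := by
  rw [((hg.hasFDerivAt.clm_apply hX.hasFDerivAt).clm_apply hY.hasFDerivAt).fderiv]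
  simp
  ring

/-- The Koszul formula. -/
theorem koszul_eq_covD {g : E → E →L[ℝ] E →L[ℝ] ℝ} {u : E} {X Y Z : E → E}
    (hg : DifferentiableAt ℝ g u) (hs : ∀ᶠ w in 𝓝 u, ∀ a b, g w a b = g w b a)
    (h : (g u).IsInvertible) (hX : DifferentiableAt ℝ X u) (hY : DifferentiableAt ℝ Y u)
    (hZ : DifferentiableAt ℝ Z u) :
    (1 / 2) * (fderiv ℝ (fun w ↦ g w (Y w) (Z w)) u (X u)
      + fderiv ℝ (fun w ↦ g w (X w) (Z w)) u (Y u)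
      - fderiv ℝ (fun w ↦ g w (X w) (Y w)) u (Z u)
      + g u (VectorField.lieBracket ℝ X Y u) (Z u)
      - g u (VectorField.lieBracket ℝ X Z u) (Y u)
      - g u (VectorField.lieBracket ℝ Y Z u) (X u)) =
      g u (covD (christoffel g) Y u (X u)) (Z u) := by
  have s := hs.self_of_nhds
  rw [fderiv_metric_apply hg hY hZ, fderiv_metric_apply hg hX hZ, fderiv_metric_apply hg hX hY,
    covD_apply, map_add, add_apply, metric_christoffel h]
  simp only [VectorField.lieBracket, map_sub, sub_apply]
  rw [s (fderiv ℝ Z u (X u)) (Y u), s (fderiv ℝ Z u (Y u)) (X u),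
    s (fderiv ℝ X u (Z u)) (Y u), s (fderiv ℝ Y u (Z u)) (X u)]
  ring

/-- The skew part of the covariant derivative of the vector field dual to `c` is `dc`. -/
theorem metric_covD_sub_swap {g : E → E →L[ℝ] E →L[ℝ] ℝ} {u : E} {P : E → E} {c : E → E →L[ℝ] ℝ}
    (hg : DifferentiableAt ℝ g u) (hs : ∀ᶠ w in 𝓝 u, ∀ a b, g w a b = g w b a)
    (h : (g u).IsInvertible) (hP : DifferentiableAt ℝ P u) (hc : ∀ᶠ w in 𝓝 u, g w (P w) = c w)
    (a b : E) :
    g u (covD (christoffel g) P u a) b - g u (covD (christoffel g) P u b) a =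
      fderiv ℝ c u a b - fderiv ℝ c u b a := by
  have key : ∀ a b, g u (covD (christoffel g) P u a) b =
      fderiv ℝ c u a b - g u (P u) (christoffel g u a b) := by
    intro a b
    rw [← Filter.EventuallyEq.fderiv_eq hc, (hg.hasFDerivAt.clm_apply hP.hasFDerivAt).fderiv]
    simp only [covD_apply, map_add, add_apply, ContinuousLinearMap.comp_apply,
      ContinuousLinearMap.flip_apply]
    rw [fderiv_metric_eq hg hs h]
    ring
  rw [key, key, christoffel_symm hg hs a b]
  ring

end FlatMetric

/-! ### Traces in an inner product space -/

theorem sum_inner_mul_swap {V ι : Type*} [NormedAddCommGroup V] [InnerProductSpace ℝ V]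
    [Fintype ι] (e : OrthonormalBasis ι ℝ V) (A B : V →ₗ[ℝ] V) :
    LinearMap.trace ℝ V (A ∘ₗ B) =
      ∑ i, ∑ j, inner ℝ (A (e i)) (e j) * inner ℝ (B (e j)) (e i) := by
  have : FiniteDimensional ℝ V := e.toBasis.finiteDimensional_of_finite
  rw [LinearMap.trace_comp_comm', LinearMap.trace_eq_sum_inner _ e]
  refine Finset.sum_congr rfl fun i _ ↦ ?_
  rw [LinearMap.comp_apply]
  conv_lhs => rw [← e.sum_repr' (A (e i))]
  simp only [map_sum, map_smul, inner_sum, inner_smul_right, real_inner_comm]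

theorem sum_sum_eq_two_mul_sum_Ioi {ι : Type*} [Fintype ι] [LinearOrder ι]
    [LocallyFiniteOrderTop ι] (F : ι → ι → ℝ) (hF : ∀ i j, F i j = F j i) (h0 : ∀ i, F i i = 0) :
    ∑ i, ∑ j, F i j = 2 * ∑ i, ∑ j ∈ Finset.Ioi i, F i j := by
  have h1 : ∀ i, ∑ j, F i j = ∑ j, (if i < j then F i j else 0) + ∑ j, (if j < i then F i j else 0)
      := by
    intro i
    rw [← Finset.sum_add_distrib]
    refine Finset.sum_congr rfl fun j _ ↦ ?_
    rcases lt_trichotomy i j with h | h | h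
    · simp [h, h.le.not_gt]
    · simp [h, h0]
    · simp [h, h.le.not_gt]
  have h2 : ∑ i, ∑ j, (if j < i then F i j else 0) = ∑ i, ∑ j, (if i < j then F i j else 0) := by
    rw [Finset.sum_comm]
    exact Finset.sum_congr rfl fun i _ ↦ Finset.sum_congr rfl fun j _ ↦ by rw [hF]
  have h3 : ∀ i, ∑ j ∈ Finset.Ioi i, F i j = ∑ j, (if i < j then F i j else 0) := by
    intro i
    rw [← Finset.sum_filter]
    exact Finset.sum_congr (by ext; simp) fun _ _ ↦ rfl
  simp only [h1, h3, Finset.sum_add_distrib, h2]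
  ring

/-- The trace of the square of an endomorphism with skew part `s θ / 2`. -/
theorem trace_sq_eq {V ι : Type*} [NormedAddCommGroup V] [InnerProductSpace ℝ V]
    [Fintype ι] [LinearOrder ι] [LocallyFiniteOrderTop ι] (e : OrthonormalBasis ι ℝ V)
    (A : V →ₗ[ℝ] V) (θ : V → V → ℝ) (s : ℝ)
    (h : ∀ i j, inner ℝ (A (e i)) (e j) - inner ℝ (A (e j)) (e i) = s * θ (e i) (e j))
    (hθ : ∀ i j, θ (e i) (e j) = -θ (e j) (e i)) :
    LinearMap.trace ℝ V (A ∘ₗ A) = ∑ i, ∑ j, inner ℝ (A (e i)) (e j) ^ 2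
      - s ^ 2 * ∑ i, ∑ j ∈ Finset.Ioi i, θ (e i) (e j) ^ 2 := by
  have h1 := sum_sum_eq_two_mul_sum_Ioi (fun i j ↦ θ (e i) (e j) ^ 2)
    (fun i j ↦ by rw [hθ i j]; ring) (fun i ↦ by have := hθ i i; nlinarith)
  have h2 : ∑ i, ∑ j, inner ℝ (A (e i)) (e j) ^ 2 = ∑ i, ∑ j, inner ℝ (A (e j)) (e i) ^ 2 :=
    Finset.sum_comm
  have h3 : ∑ i, ∑ j, (inner ℝ (A (e i)) (e j) - inner ℝ (A (e j)) (e i)) ^ 2 =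
      s ^ 2 * ∑ i, ∑ j, θ (e i) (e j) ^ 2 := by
    simp only [h, mul_pow, Finset.mul_sum]
  have h4 : ∑ i, ∑ j, (inner ℝ (A (e i)) (e j) - inner ℝ (A (e j)) (e i)) ^ 2 =
      ∑ i, ∑ j, inner ℝ (A (e i)) (e j) ^ 2 + ∑ i, ∑ j, inner ℝ (A (e j)) (e i) ^ 2
      - 2 * ∑ i, ∑ j, inner ℝ (A (e i)) (e j) * inner ℝ (A (e j)) (e i) := by
    simp only [Finset.mul_sum, ← Finset.sum_add_distrib, ← Finset.sum_sub_distrib]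
    exact Finset.sum_congr rfl fun i _ ↦ Finset.sum_congr rfl fun j _ ↦ by ring
  rw [sum_inner_mul_swap e]
  linear_combination (-1 / 2 : ℝ) * h3 + (1 / 2 : ℝ) * h4 - (1 / 2 : ℝ) * h2 - s ^ 2 / 2 * h1

/-! ### Tensors in a chart -/

theorem isManifold_minSmoothness {n : ℕ} {M : Type*} [TopologicalSpace M]
    [ChartedSpace (EuclideanSpace ℝ (Fin n)) M] [IsManifold (𝓡 n) ∞ M] :
    IsManifold (𝓡 n) (minSmoothness ℝ 2) M := by
  rw [minSmoothness_of_isRCLikeNormedField]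
  exact .of_le (n := ∞) (by norm_cast)

attribute [local instance] isManifold_minSmoothness

section Chart

variable {n : ℕ} {M : Type*} [TopologicalSpace M] [ChartedSpace (EuclideanSpace ℝ (Fin n)) M]

/-- The derivative at `u` of the inverse of the chart at `x₀`. -/
def chartD (x₀ : M) (u : EuclideanSpace ℝ (Fin n)) :
    EuclideanSpace ℝ (Fin n) →L[ℝ] TangentSpace (𝓡 n) ((extChartAt (𝓡 n) x₀).symm u) :=
  mfderiv 𝓘(ℝ, EuclideanSpace ℝ (Fin n)) (𝓡 n) (extChartAt (𝓡 n) x₀).symm u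

/-- A vector field in the chart at `x₀`. -/
def chartRep (x₀ : M) (X : Π y : M, TangentSpace (𝓡 n) y) (u : EuclideanSpace ℝ (Fin n)) :
    EuclideanSpace ℝ (Fin n) :=
  (chartD x₀ u).inverse (X ((extChartAt (𝓡 n) x₀).symm u))

/-- A 1-form in the chart at `x₀`. -/
def chartForm (x₀ : M) (α : Π y : M, TangentSpace (𝓡 n) y →L[ℝ] ℝ)
    (u : EuclideanSpace ℝ (Fin n)) : EuclideanSpace ℝ (Fin n) →L[ℝ] ℝ :=
  (α ((extChartAt (𝓡 n) x₀).symm u)).comp (chartD x₀ u)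

theorem chartRep_eq_mpullback (x₀ : M) (X : Π y : M, TangentSpace (𝓡 n) y) :
    chartRep x₀ X = VectorField.mpullback 𝓘(ℝ, EuclideanSpace ℝ (Fin n)) (𝓡 n)
      (extChartAt (𝓡 n) x₀).symm X := rfl

theorem chart_target_mem_nhds {x₀ : M} {u : EuclideanSpace ℝ (Fin n)}
    (hu : u ∈ (extChartAt (𝓡 n) x₀).target) : (extChartAt (𝓡 n) x₀).target ∈ 𝓝 u :=
  (isOpen_extChartAt_target x₀).mem_nhds hu

variable [IsManifold (𝓡 n) ∞ M]

theorem chartD_isInvertible {x₀ : M} {u : EuclideanSpace ℝ (Fin n)}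
    (hu : u ∈ (extChartAt (𝓡 n) x₀).target) : (chartD x₀ u).IsInvertible := by
  have := isInvertible_mfderivWithin_extChartAt_symm hu
  rw [modelWithCornersSelf_coe, Set.range_id, mfderivWithin_univ] at this
  exact this

theorem chartD_chartRep {x₀ : M} {u : EuclideanSpace ℝ (Fin n)}
    (hu : u ∈ (extChartAt (𝓡 n) x₀).target) (X : Π y : M, TangentSpace (𝓡 n) y) :
    chartD x₀ u (chartRep x₀ X u) = X ((extChartAt (𝓡 n) x₀).symm u) := by
  obtain ⟨e, he⟩ := chartD_isInvertible hu
  rw [chartRep, ← he, ContinuousLinearMap.inverse_equiv]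
  exact e.apply_symm_apply _

theorem contMDiffOn_chart_symm (x₀ : M) :
    ContMDiffOn 𝓘(ℝ, EuclideanSpace ℝ (Fin n)) (𝓡 n) ∞ (extChartAt (𝓡 n) x₀).symm
      (extChartAt (𝓡 n) x₀).target :=
  contMDiffOn_extChartAt_symm x₀

theorem contMDiffAt_chart_symm {x₀ : M} {u : EuclideanSpace ℝ (Fin n)}
    (hu : u ∈ (extChartAt (𝓡 n) x₀).target) :
    ContMDiffAt 𝓘(ℝ, EuclideanSpace ℝ (Fin n)) (𝓡 n) ∞ (extChartAt (𝓡 n) x₀).symm u :=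
  (contMDiffOn_chart_symm x₀).contMDiffAt (chart_target_mem_nhds hu)

theorem trivializationAt_symm_eq {x₀ : M} {u : EuclideanSpace ℝ (Fin n)}
    (hu : u ∈ (extChartAt (𝓡 n) x₀).target) (a : EuclideanSpace ℝ (Fin n)) :
    (trivializationAt (EuclideanSpace ℝ (Fin n)) (TangentSpace (𝓡 n)) x₀).toOpenPartialHomeomorph.symm
      ((extChartAt (𝓡 n) x₀).symm u, a) = ⟨(extChartAt (𝓡 n) x₀).symm u, chartD x₀ u a⟩ := by
  have hx : (extChartAt (𝓡 n) x₀).symm u ∈ (chartAt (EuclideanSpace ℝ (Fin n)) x₀).source := by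
    simpa using (extChartAt (𝓡 n) x₀).map_target hu
  have h1 := TangentBundle.symmL_trivializationAt (I := 𝓡 n) hx
  rw [(extChartAt (𝓡 n) x₀).right_inv hu, modelWithCornersSelf_coe, Set.range_id,
    mfderivWithin_univ] at h1
  have h2 : (trivializationAt (EuclideanSpace ℝ (Fin n)) (TangentSpace (𝓡 n)) x₀).symmL ℝ
    ((extChartAt (𝓡 n) x₀).symm u) a = chartD x₀ u a := DFunLike.congr_fun h1 a
  rw [← h2, Bundle.Trivialization.symmL_apply, Bundle.Trivialization.mk_symm]
  all_goals simpa using hx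

theorem contMDiffOn_chartD (x₀ : M) (a : EuclideanSpace ℝ (Fin n)) :
    ContMDiffOn 𝓘(ℝ, EuclideanSpace ℝ (Fin n)) ((𝓡 n).prod 𝓘(ℝ, EuclideanSpace ℝ (Fin n))) ∞
      (fun u ↦ (⟨(extChartAt (𝓡 n) x₀).symm u, chartD x₀ u a⟩ : TangentBundle (𝓡 n) M))
      (extChartAt (𝓡 n) x₀).target := by
  have h1 := Bundle.Trivialization.contMDiffOn_symm (n := ∞) (IB := 𝓡 n)
    (e := trivializationAt (EuclideanSpace ℝ (Fin n)) (TangentSpace (𝓡 n) (M := M)) x₀)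
  have h2 : ContMDiffOn 𝓘(ℝ, EuclideanSpace ℝ (Fin n)) ((𝓡 n).prod 𝓘(ℝ, EuclideanSpace ℝ (Fin n))) ∞
      (fun u ↦ ((extChartAt (𝓡 n) x₀).symm u, a)) (extChartAt (𝓡 n) x₀).target :=
    (contMDiffOn_chart_symm x₀).prodMk contMDiffOn_const
  refine (h1.comp h2 fun u hu ↦ ?_).congr fun u hu ↦ (trivializationAt_symm_eq hu a).symm
  rw [Set.mem_preimage, Bundle.Trivialization.mem_target]
  simpa using (extChartAt (𝓡 n) x₀).map_target hu

theorem contDiffAt_chartRep {x₀ : M} {u : EuclideanSpace ℝ (Fin n)}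
    (hu : u ∈ (extChartAt (𝓡 n) x₀).target) {X : Π y : M, TangentSpace (𝓡 n) y}
    (hX : ContMDiffAt (𝓡 n) ((𝓡 n).prod 𝓘(ℝ, EuclideanSpace ℝ (Fin n))) ∞
      (fun y ↦ (⟨y, X y⟩ : TangentBundle (𝓡 n) M)) ((extChartAt (𝓡 n) x₀).symm u)) :
    ContDiffAt ℝ ∞ (chartRep x₀ X) u := by
  rw [chartRep_eq_mpullback, ← contMDiffAt_vectorSpace_iff_contDiffAt]
  exact ContMDiffAt.mpullback_vectorField_preimage hX (contMDiffAt_chart_symm hu)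
    (chartD_isInvertible hu) (by simp)

theorem mdifferentiableAt_comp_chart {F : Type*} [NormedAddCommGroup F] [NormedSpace ℝ F]
    {G : EuclideanSpace ℝ (Fin n) → F} {x₀ : M} {u : EuclideanSpace ℝ (Fin n)}
    (hu : u ∈ (extChartAt (𝓡 n) x₀).target) (hG : DifferentiableAt ℝ G u) :
    MDifferentiableAt (𝓡 n) 𝓘(ℝ, F) (fun y ↦ G (extChartAt (𝓡 n) x₀ y))
      ((extChartAt (𝓡 n) x₀).symm u) := by
  have hy := (extChartAt (𝓡 n) x₀).map_target hu
  have h1 : MDifferentiableAt (𝓡 n) 𝓘(ℝ, EuclideanSpace ℝ (Fin n)) (extChartAt (𝓡 n) x₀)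
      ((extChartAt (𝓡 n) x₀).symm u) :=
    (contMDiffAt_extChartAt' (n := 1) (by simpa using hy)).mdifferentiableAt (by norm_num)
  refine MDifferentiableAt.comp (I' := 𝓘(ℝ, EuclideanSpace ℝ (Fin n))) (g := G) _ ?_ h1
  rw [(extChartAt (𝓡 n) x₀).right_inv hu]
  exact hG.mdifferentiableAt

theorem mdifferentiableAt_of_chartRep {x₀ : M} {u : EuclideanSpace ℝ (Fin n)}
    (hu : u ∈ (extChartAt (𝓡 n) x₀).target) {X : Π y : M, TangentSpace (𝓡 n) y}
    (hX : DifferentiableAt ℝ (chartRep x₀ X) u) :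
    MDifferentiableAt (𝓡 n) ((𝓡 n).prod 𝓘(ℝ, EuclideanSpace ℝ (Fin n)))
      (fun y ↦ (⟨y, X y⟩ : TangentBundle (𝓡 n) M)) ((extChartAt (𝓡 n) x₀).symm u) := by
  set e := trivializationAt (EuclideanSpace ℝ (Fin n)) (TangentSpace (𝓡 n) (M := M)) x₀
  have hy := (extChartAt (𝓡 n) x₀).map_target hu
  have h1 := (Bundle.Trivialization.contMDiffOn_symm (n := ∞) (IB := 𝓡 n) (e := e)).contMDiffAt
    (x := ((extChartAt (𝓡 n) x₀).symm u, chartRep x₀ X u)) (e.open_target.mem_nhds (by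
      rw [Bundle.Trivialization.mem_target]
      simpa [e] using hy))
  have h2 : MDifferentiableAt (𝓡 n) ((𝓡 n).prod 𝓘(ℝ, EuclideanSpace ℝ (Fin n)))
      (fun y ↦ (y, chartRep x₀ X (extChartAt (𝓡 n) x₀ y))) ((extChartAt (𝓡 n) x₀).symm u) :=
    mdifferentiableAt_id.prodMk (mdifferentiableAt_comp_chart hu hX)
  have h1' : MDifferentiableAt ((𝓡 n).prod 𝓘(ℝ, EuclideanSpace ℝ (Fin n)))
      ((𝓡 n).prod 𝓘(ℝ, EuclideanSpace ℝ (Fin n))) e.toOpenPartialHomeomorph.symm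
      ((fun y ↦ (y, chartRep x₀ X (extChartAt (𝓡 n) x₀ y))) ((extChartAt (𝓡 n) x₀).symm u)) := by
    simp only [(extChartAt (𝓡 n) x₀).right_inv hu]
    exact h1.mdifferentiableAt (by simp)
  have h3 := MDifferentiableAt.comp (g := e.toOpenPartialHomeomorph.symm)
    (f := fun y ↦ (y, chartRep x₀ X (extChartAt (𝓡 n) x₀ y))) _ h1' h2
  refine h3.congr_of_eventuallyEq ?_
  filter_upwards [(isOpen_extChartAt_source (I := 𝓡 n) x₀).mem_nhds hy] with y hy'
  have h4 := (extChartAt (𝓡 n) x₀).map_source hy'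
  have h5 := trivializationAt_symm_eq h4 (chartRep x₀ X (extChartAt (𝓡 n) x₀ y))
  rw [chartD_chartRep h4, (extChartAt (𝓡 n) x₀).left_inv hy'] at h5
  exact h5.symm

theorem contMDiffOn_locExt {x : M} (v : TangentSpace (𝓡 n) x) :
    ContMDiffOn (𝓡 n) ((𝓡 n).prod 𝓘(ℝ, EuclideanSpace ℝ (Fin n))) ∞
      (fun y ↦ (⟨y, locExt v y⟩ : TangentBundle (𝓡 n) M)) (extChartAt (𝓡 n) x).source := by
  set e := trivializationAt (EuclideanSpace ℝ (Fin n)) (TangentSpace (𝓡 n) (M := M)) x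
  have h1 := Bundle.Trivialization.contMDiffOn_symm (n := ∞) (IB := 𝓡 n) (e := e)
  have h2 : ContMDiffOn (𝓡 n) ((𝓡 n).prod 𝓘(ℝ, EuclideanSpace ℝ (Fin n))) ∞
      (fun y ↦ (y, (e ⟨x, v⟩).2)) (extChartAt (𝓡 n) x).source :=
    contMDiffOn_id.prodMk contMDiffOn_const
  refine (h1.comp h2 fun y hy ↦ ?_).congr fun y hy ↦ ?_
  · rw [Set.mem_preimage, Bundle.Trivialization.mem_target]
    simpa [e] using hy
  · simp only [locExt, FiberBundle.extend, Function.comp]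
    rw [Bundle.Trivialization.mk_symm]
    simpa [e] using hy

theorem locExt_self {x : M} (v : TangentSpace (𝓡 n) x) : locExt v x = v :=
  FiberBundle.extend_apply_self _ v

theorem eventually_contDiffAt_chartRep_locExt {x₀ : M} {u : EuclideanSpace ℝ (Fin n)}
    (hu : u ∈ (extChartAt (𝓡 n) x₀).target)
    (v : TangentSpace (𝓡 n) ((extChartAt (𝓡 n) x₀).symm u)) :
    ∀ᶠ w in 𝓝 u, ContDiffAt ℝ ∞ (chartRep x₀ (locExt v)) w := by
  have h1 : ∀ᶠ y in 𝓝 ((extChartAt (𝓡 n) x₀).symm u),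
      y ∈ (extChartAt (𝓡 n) ((extChartAt (𝓡 n) x₀).symm u)).source :=
    extChartAt_source_mem_nhds _
  filter_upwards [(contMDiffAt_chart_symm hu).continuousAt.eventually h1,
    chart_target_mem_nhds hu] with w hw hw'
  exact contDiffAt_chartRep hw' ((contMDiffOn_locExt v).contMDiffAt
    ((isOpen_extChartAt_source _).mem_nhds hw))

theorem chartRep_locExt {x₀ : M} {u : EuclideanSpace ℝ (Fin n)}
    (v : TangentSpace (𝓡 n) ((extChartAt (𝓡 n) x₀).symm u)) :
    chartRep x₀ (locExt v) u = (chartD x₀ u).inverse v := by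
  rw [chartRep, locExt_self]

theorem mvfderiv_chartD {F : Type*} [NormedAddCommGroup F] [NormedSpace ℝ F] {f : M → F}
    {x₀ : M} {u : EuclideanSpace ℝ (Fin n)} (hu : u ∈ (extChartAt (𝓡 n) x₀).target)
    (hf : DifferentiableAt ℝ (f ∘ (extChartAt (𝓡 n) x₀).symm) u) (a : EuclideanSpace ℝ (Fin n)) :
    mvfderiv (𝓡 n) f ((extChartAt (𝓡 n) x₀).symm u) (chartD x₀ u a) =
      fderiv ℝ (f ∘ (extChartAt (𝓡 n) x₀).symm) u a := by
  have hy := (extChartAt (𝓡 n) x₀).map_target hu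
  have h0 : MDifferentiableAt (𝓡 n) 𝓘(ℝ, F) f ((extChartAt (𝓡 n) x₀).symm u) := by
    have : MDifferentiableAt (𝓡 n) 𝓘(ℝ, F)
        (fun y ↦ (f ∘ (extChartAt (𝓡 n) x₀).symm) (extChartAt (𝓡 n) x₀ y))
        ((extChartAt (𝓡 n) x₀).symm u) := mdifferentiableAt_comp_chart hu hf
    refine this.congr_of_eventuallyEq ?_
    filter_upwards [(isOpen_extChartAt_source (I := 𝓡 n) x₀).mem_nhds hy] with y hy'
    exact congrArg f ((extChartAt (𝓡 n) x₀).left_inv hy').symm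
  rw [← mfderiv_eq_fderiv, mfderiv_comp u h0 ((contMDiffAt_chart_symm hu).mdifferentiableAt
    (by simp))]
  rfl

theorem mlieBracket_vectorSpace {E : Type*} [NormedAddCommGroup E] [NormedSpace ℝ E]
    (V W : Π x : E, TangentSpace 𝓘(ℝ, E) x) :
    VectorField.mlieBracket 𝓘(ℝ, E) V W = VectorField.lieBracket ℝ V W := by
  rw [← VectorField.mlieBracketWithin_univ, VectorField.mlieBracketWithin_eq_lieBracketWithin]
  exact VectorField.lieBracketWithin_univ

/-- The chart representation of the Lie bracket. -/
theorem chartRep_mlieBracket {x₀ : M} {u : EuclideanSpace ℝ (Fin n)}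
    (hu : u ∈ (extChartAt (𝓡 n) x₀).target) {X Y : Π y : M, TangentSpace (𝓡 n) y}
    (hX : DifferentiableAt ℝ (chartRep x₀ X) u) (hY : DifferentiableAt ℝ (chartRep x₀ Y) u) :
    chartRep x₀ (VectorField.mlieBracket (𝓡 n) X Y) u =
      VectorField.lieBracket ℝ (chartRep x₀ X) (chartRep x₀ Y) u := by
  refine Eq.trans ?_ (congrFun (mlieBracket_vectorSpace (chartRep x₀ X) (chartRep x₀ Y)) u)
  exact VectorField.mpullback_mlieBracket (n := ∞) (mdifferentiableAt_of_chartRep hu hX)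
    (mdifferentiableAt_of_chartRep hu hY) (contMDiffAt_chart_symm hu) (by simp; norm_cast)

theorem chartD_inverse_apply {x₀ : M} {u : EuclideanSpace ℝ (Fin n)}
    (hu : u ∈ (extChartAt (𝓡 n) x₀).target)
    (w : TangentSpace (𝓡 n) ((extChartAt (𝓡 n) x₀).symm u)) :
    chartD x₀ u ((chartD x₀ u).inverse w) = w := by
  obtain ⟨e, he⟩ := chartD_isInvertible hu
  rw [← he, ContinuousLinearMap.inverse_equiv]
  exact e.apply_symm_apply w

theorem inverse_chartD_apply {x₀ : M} {u : EuclideanSpace ℝ (Fin n)}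
    (hu : u ∈ (extChartAt (𝓡 n) x₀).target) (a : EuclideanSpace ℝ (Fin n)) :
    (chartD x₀ u).inverse (chartD x₀ u a) = a := by
  obtain ⟨e, he⟩ := chartD_isInvertible hu
  rw [← he, ContinuousLinearMap.inverse_equiv]
  exact e.symm_apply_apply a

theorem contDiffOn_chartForm {α : Π x : M, TangentSpace (𝓡 n) x →L[ℝ] ℝ}
    (hα : ContMDiff (𝓡 n) ((𝓡 n).prod 𝓘(ℝ, EuclideanSpace ℝ (Fin n) →L[ℝ] ℝ)) ∞
      (fun x ↦ TotalSpace.mk' (EuclideanSpace ℝ (Fin n) →L[ℝ] ℝ)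
        (E := fun x : M ↦ TangentSpace (𝓡 n) x →L[ℝ] ℝ) x (α x))) (x₀ : M) :
    ContDiffOn ℝ ∞ (chartForm x₀ α) (extChartAt (𝓡 n) x₀).target := by
  rw [contDiffOn_clm_apply]
  intro a
  rw [← contMDiffOn_iff_contDiffOn]
  have h : ContMDiffOn 𝓘(ℝ, EuclideanSpace ℝ (Fin n)) ((𝓡 n).prod 𝓘(ℝ)) ∞
      (fun u ↦ TotalSpace.mk' ℝ (E := Bundle.Trivial M ℝ) ((extChartAt (𝓡 n) x₀).symm u)
        (α ((extChartAt (𝓡 n) x₀).symm u) (chartD x₀ u a))) (extChartAt (𝓡 n) x₀).target := by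
    apply ContMDiffOn.clm_bundle_apply (F₁ := EuclideanSpace ℝ (Fin n)) (F₂ := ℝ)
    · exact hα.comp_contMDiffOn (contMDiffOn_chart_symm x₀)
    · exact contMDiffOn_chartD x₀ a
  intro u hu
  have := h u hu
  rw [contMDiffWithinAt_totalSpace] at this
  exact this.2

theorem differentiableAt_chartRep_locExt {x₀ : M} {u : EuclideanSpace ℝ (Fin n)}
    (hu : u ∈ (extChartAt (𝓡 n) x₀).target)
    (v : TangentSpace (𝓡 n) ((extChartAt (𝓡 n) x₀).symm u)) :
    DifferentiableAt ℝ (chartRep x₀ (locExt v)) u :=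
  (eventually_contDiffAt_chartRep_locExt hu v).self_of_nhds.differentiableAt (by simp)

theorem extDer_chart {x₀ : M} {u : EuclideanSpace ℝ (Fin n)}
    (hu : u ∈ (extChartAt (𝓡 n) x₀).target) {α : Π x : M, TangentSpace (𝓡 n) x →L[ℝ] ℝ}
    (hα : DifferentiableAt ℝ (chartForm x₀ α) u)
    (a b : TangentSpace (𝓡 n) ((extChartAt (𝓡 n) x₀).symm u)) :
    extDer α a b = fderiv ℝ (chartForm x₀ α) u ((chartD x₀ u).inverse a) ((chartD x₀ u).inverse b)
      - fderiv ℝ (chartForm x₀ α) u ((chartD x₀ u).inverse b) ((chartD x₀ u).inverse a) := by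
  have hd := differentiableAt_chartRep_locExt hu
  have key : ∀ v w : TangentSpace (𝓡 n) ((extChartAt (𝓡 n) x₀).symm u),
      mvfderiv (𝓡 n) (fun y ↦ α y (locExt v y)) ((extChartAt (𝓡 n) x₀).symm u) w =
      fderiv ℝ (chartForm x₀ α) u ((chartD x₀ u).inverse w) ((chartD x₀ u).inverse v)
        + chartForm x₀ α u (fderiv ℝ (chartRep x₀ (locExt v)) u ((chartD x₀ u).inverse w)) := by
    intro v w
    have h : (fun y ↦ α y (locExt v y)) ∘ (extChartAt (𝓡 n) x₀).symm =ᶠ[𝓝 u]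
        fun z ↦ chartForm x₀ α z (chartRep x₀ (locExt v) z) := by
      filter_upwards [chart_target_mem_nhds hu] with z hz
      simp only [Function.comp, chartForm, ContinuousLinearMap.comp_apply, chartD_chartRep hz]
    have h2 := (hα.hasFDerivAt.clm_apply (hd v).hasFDerivAt)
    have h3 := mvfderiv_chartD hu (h2.differentiableAt.congr_of_eventuallyEq h)
      ((chartD x₀ u).inverse w)
    rw [chartD_inverse_apply hu, h.fderiv_eq, h2.fderiv] at h3
    rw [h3, ← chartRep_locExt v]
    simp
    ring
  have hbr : (chartD x₀ u).inverse (VectorField.mlieBracket (𝓡 n) (locExt a) (locExt b)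
      ((extChartAt (𝓡 n) x₀).symm u)) = _ := chartRep_mlieBracket hu (hd a) (hd b)
  rw [extDer, key, key, ← chartD_inverse_apply hu (VectorField.mlieBracket (𝓡 n) _ _ _), hbr,
    VectorField.lieBracket, chartRep_locExt, chartRep_locExt]
  simp only [chartForm, ContinuousLinearMap.comp_apply, map_sub]
  ring

end Chart

/-! ### The Levi-Civita connection in a chart -/

section RiemannianChart

variable {n : ℕ} {M : Type*} [TopologicalSpace M] [ChartedSpace (EuclideanSpace ℝ (Fin n)) M]
  [RiemannianBundle (fun x : M ↦ TangentSpace (𝓡 n) x)]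

/-- The Riemannian metric in the chart at `x₀`. -/
def chartMetric (x₀ : M) (u : EuclideanSpace ℝ (Fin n)) :
    EuclideanSpace ℝ (Fin n) →L[ℝ] EuclideanSpace ℝ (Fin n) →L[ℝ] ℝ :=
  (innerSL ℝ (E := TangentSpace (𝓡 n) ((extChartAt (𝓡 n) x₀).symm u))).bilinearComp
    (chartD x₀ u) (chartD x₀ u)

theorem chartMetric_apply (x₀ : M) (u a b : EuclideanSpace ℝ (Fin n)) :
    chartMetric x₀ u a b = inner ℝ (chartD x₀ u a) (chartD x₀ u b) := rfl

theorem chartMetric_symm (x₀ : M) (u a b : EuclideanSpace ℝ (Fin n)) :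
    chartMetric x₀ u a b = chartMetric x₀ u b a := by
  rw [chartMetric_apply, chartMetric_apply, real_inner_comm]

/-- The Christoffel symbols in the chart at `x₀`. -/
abbrev chartΓ (x₀ : M) : EuclideanSpace ℝ (Fin n) →
    EuclideanSpace ℝ (Fin n) →L[ℝ] EuclideanSpace ℝ (Fin n) →L[ℝ] EuclideanSpace ℝ (Fin n) :=
  christoffel (chartMetric x₀)

variable [IsManifold (𝓡 n) ∞ M]

theorem chartMetric_isInvertible {x₀ : M} {u : EuclideanSpace ℝ (Fin n)}
    (hu : u ∈ (extChartAt (𝓡 n) x₀).target) : (chartMetric x₀ u).IsInvertible := by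
  have hinj : Function.Injective (chartMetric x₀ u).toLinearMap := by
    rw [injective_iff_map_eq_zero]
    intro a ha
    have h1 : chartMetric x₀ u a a = 0 := DFunLike.congr_fun ha a
    rw [chartMetric_apply, inner_self_eq_zero] at h1
    obtain ⟨e, he⟩ := chartD_isInvertible hu
    rw [← he] at h1
    exact (map_eq_zero_iff e e.injective).1 h1
  have hdim : Module.finrank ℝ (EuclideanSpace ℝ (Fin n)) =
      Module.finrank ℝ (EuclideanSpace ℝ (Fin n) →L[ℝ] ℝ) := by
    rw [← LinearEquiv.finrank_eq (LinearMap.toContinuousLinearMap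
      (𝕜 := ℝ) (E := EuclideanSpace ℝ (Fin n)) (F' := ℝ))]
    exact (Subspace.dual_finrank_eq (K := ℝ)).symm
  refine ⟨(LinearEquiv.ofInjectiveOfFinrankEq _ hinj hdim).toContinuousLinearEquiv, ?_⟩
  ext a b
  rfl

theorem chartMetric_inverse_apply {x₀ : M} {u : EuclideanSpace ℝ (Fin n)}
    (hu : u ∈ (extChartAt (𝓡 n) x₀).target) (a : EuclideanSpace ℝ (Fin n))
    (w : TangentSpace (𝓡 n) ((extChartAt (𝓡 n) x₀).symm u)) :
    chartMetric x₀ u a ((chartD x₀ u).inverse w) = inner ℝ (chartD x₀ u a) w := by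
  obtain ⟨e, he⟩ := chartD_isInvertible hu
  rw [chartMetric_apply, ← he, ContinuousLinearMap.inverse_equiv]
  exact congrArg _ (e.apply_symm_apply w)

theorem inner_eq_chartMetric {x₀ : M} {u : EuclideanSpace ℝ (Fin n)}
    (hu : u ∈ (extChartAt (𝓡 n) x₀).target) (X Y : Π y : M, TangentSpace (𝓡 n) y) :
    inner ℝ (X ((extChartAt (𝓡 n) x₀).symm u)) (Y ((extChartAt (𝓡 n) x₀).symm u)) =
      chartMetric x₀ u (chartRep x₀ X u) (chartRep x₀ Y u) := by
  rw [chartMetric_apply, chartD_chartRep hu, chartD_chartRep hu]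

theorem sum_inner_chart {x₀ : M} {u : EuclideanSpace ℝ (Fin n)}
    (hu : u ∈ (extChartAt (𝓡 n) x₀).target)
    (A : EuclideanSpace ℝ (Fin n) →L[ℝ] EuclideanSpace ℝ (Fin n)) {ι : Type*} [Fintype ι]
    (b : OrthonormalBasis ι ℝ (TangentSpace (𝓡 n) ((extChartAt (𝓡 n) x₀).symm u))) :
    ∑ i, inner ℝ (chartD x₀ u (A ((chartD x₀ u).inverse (b i)))) (b i) = endTr _ A := by
  obtain ⟨e, he⟩ := chartD_isInvertible hu
  rw [endTr_apply, ← LinearMap.trace_conj' (A : _ →ₗ[ℝ] _) e.toLinearEquiv,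
    LinearMap.trace_eq_sum_inner _ b]
  refine Finset.sum_congr rfl fun i _ ↦ ?_
  rw [← he, ContinuousLinearMap.inverse_equiv, real_inner_comm]
  rfl

variable [IsContMDiffRiemannianBundle (𝓡 n) ∞ (EuclideanSpace ℝ (Fin n))
      (fun x : M ↦ TangentSpace (𝓡 n) x)]

theorem contDiffOn_chartMetric (x₀ : M) :
    ContDiffOn ℝ ∞ (chartMetric x₀) (extChartAt (𝓡 n) x₀).target := by
  rw [contDiffOn_clm_apply]
  intro a
  rw [contDiffOn_clm_apply]
  intro b
  rw [← contMDiffOn_iff_contDiffOn]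
  exact ContMDiffOn.inner_bundle (contMDiffOn_chartD x₀ a) (contMDiffOn_chartD x₀ b)

theorem contDiffOn_chartΓ (x₀ : M) :
    ContDiffOn ℝ ∞ (chartΓ x₀) (extChartAt (𝓡 n) x₀).target :=
  contDiffOn_christoffel (isOpen_extChartAt_target x₀) (contDiffOn_chartMetric x₀)
    fun _ hu ↦ chartMetric_isInvertible hu

theorem differentiableAt_chartMetric {x₀ : M} {u : EuclideanSpace ℝ (Fin n)}
    (hu : u ∈ (extChartAt (𝓡 n) x₀).target) : DifferentiableAt ℝ (chartMetric x₀) u :=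
  ((contDiffOn_chartMetric x₀).contDiffAt (chart_target_mem_nhds hu)).differentiableAt (by simp)

theorem chartΓ_symm {x₀ : M} {u : EuclideanSpace ℝ (Fin n)}
    (hu : u ∈ (extChartAt (𝓡 n) x₀).target) (a b : EuclideanSpace ℝ (Fin n)) :
    chartΓ x₀ u a b = chartΓ x₀ u b a :=
  christoffel_symm (differentiableAt_chartMetric hu) (.of_forall fun w ↦ chartMetric_symm x₀ w) a b

theorem mvfderiv_inner_chart {x₀ : M} {u : EuclideanSpace ℝ (Fin n)}
    (hu : u ∈ (extChartAt (𝓡 n) x₀).target) {X Y : Π y : M, TangentSpace (𝓡 n) y}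
    (hX : DifferentiableAt ℝ (chartRep x₀ X) u) (hY : DifferentiableAt ℝ (chartRep x₀ Y) u)
    (Z : Π y : M, TangentSpace (𝓡 n) y) :
    mvfderiv (𝓡 n) (fun y ↦ inner ℝ (X y) (Y y)) ((extChartAt (𝓡 n) x₀).symm u)
      (Z ((extChartAt (𝓡 n) x₀).symm u)) =
    fderiv ℝ (fun w ↦ chartMetric x₀ w (chartRep x₀ X w) (chartRep x₀ Y w)) u
      (chartRep x₀ Z u) := by
  have h : (fun y ↦ inner ℝ (X y) (Y y)) ∘ (extChartAt (𝓡 n) x₀).symm =ᶠ[𝓝 u]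
      fun w ↦ chartMetric x₀ w (chartRep x₀ X w) (chartRep x₀ Y w) := by
    filter_upwards [chart_target_mem_nhds hu] with w hw
    exact inner_eq_chartMetric hw X Y
  have hd : DifferentiableAt ℝ (fun w ↦ chartMetric x₀ w (chartRep x₀ X w) (chartRep x₀ Y w)) u :=
    ((differentiableAt_chartMetric hu).clm_apply hX).clm_apply hY
  rw [← h.fderiv_eq, ← mvfderiv_chartD hu (hd.congr_of_eventuallyEq h), chartD_chartRep hu]

theorem koszul_chart {x₀ : M} {u : EuclideanSpace ℝ (Fin n)}
    (hu : u ∈ (extChartAt (𝓡 n) x₀).target) {X Y Z : Π y : M, TangentSpace (𝓡 n) y}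
    (hX : DifferentiableAt ℝ (chartRep x₀ X) u) (hY : DifferentiableAt ℝ (chartRep x₀ Y) u)
    (hZ : DifferentiableAt ℝ (chartRep x₀ Z) u) :
    koszul X Y Z ((extChartAt (𝓡 n) x₀).symm u) =
      chartMetric x₀ u (covD (chartΓ x₀) (chartRep x₀ Y) u (chartRep x₀ X u))
        (chartRep x₀ Z u) := by
  rw [koszul, ← koszul_eq_covD (differentiableAt_chartMetric hu)
    (.of_forall fun w ↦ chartMetric_symm x₀ w) (chartMetric_isInvertible hu) hX hY hZ,
    mvfderiv_inner_chart hu hY hZ, mvfderiv_inner_chart hu hX hZ, mvfderiv_inner_chart hu hX hY,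
    inner_eq_chartMetric hu _ Z, inner_eq_chartMetric hu _ Y, inner_eq_chartMetric hu _ X,
    chartRep_mlieBracket hu hX hY, chartRep_mlieBracket hu hX hZ, chartRep_mlieBracket hu hY hZ]

/-- The Levi-Civita connection in a chart. -/
theorem nabla_chart {x₀ : M} {u : EuclideanSpace ℝ (Fin n)}
    (hu : u ∈ (extChartAt (𝓡 n) x₀).target) {Y : Π y : M, TangentSpace (𝓡 n) y}
    (hY : DifferentiableAt ℝ (chartRep x₀ Y) u)
    (v : TangentSpace (𝓡 n) ((extChartAt (𝓡 n) x₀).symm u)) :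
    nabla v Y =
      chartD x₀ u (covD (chartΓ x₀) (chartRep x₀ Y) u ((chartD x₀ u).inverse v)) := by
  rw [nabla, ← (frame ((extChartAt (𝓡 n) x₀).symm u)).sum_repr' (chartD x₀ u _)]
  refine Finset.sum_congr rfl fun i _ ↦ ?_
  rw [koszul_chart hu (differentiableAt_chartRep_locExt hu v) hY
    (differentiableAt_chartRep_locExt hu _), chartRep_locExt, chartRep_locExt,
    chartMetric_inverse_apply hu, real_inner_comm]

theorem chartRep_nabla {x₀ : M} {u : EuclideanSpace ℝ (Fin n)}
    (hu : u ∈ (extChartAt (𝓡 n) x₀).target) {Y : Π y : M, TangentSpace (𝓡 n) y}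
    (hY : DifferentiableAt ℝ (chartRep x₀ Y) u) (V : Π y : M, TangentSpace (𝓡 n) y) :
    chartRep x₀ (fun y ↦ nabla (V y) Y) u =
      covD (chartΓ x₀) (chartRep x₀ Y) u (chartRep x₀ V u) := by
  rw [chartRep, nabla_chart hu hY, inverse_chartD_apply hu]
  rfl

theorem curvature_chart {x₀ : M} {u : EuclideanSpace ℝ (Fin n)}
    (hu : u ∈ (extChartAt (𝓡 n) x₀).target)
    (a b c : TangentSpace (𝓡 n) ((extChartAt (𝓡 n) x₀).symm u)) :
    curvature a b c = chartD x₀ u (curvEnd (chartΓ x₀) u ((chartD x₀ u).inverse b)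
      ((chartD x₀ u).inverse c) ((chartD x₀ u).inverse a)) := by
  have hΓ : DifferentiableAt ℝ (chartΓ x₀) u :=
    ((contDiffOn_chartΓ x₀).contDiffAt (chart_target_mem_nhds hu)).differentiableAt (by simp)
  have hc := eventually_contDiffAt_chartRep_locExt hu c
  have hc2 : ContDiffAt ℝ 2 (chartRep x₀ (locExt c)) u := hc.self_of_nhds.of_le (by norm_cast)
  have hda := differentiableAt_chartRep_locExt hu a
  have hdb := differentiableAt_chartRep_locExt hu b
  have hdc := differentiableAt_chartRep_locExt hu c
  have key : ∀ V : Π y : M, TangentSpace (𝓡 n) y,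
      chartRep x₀ (fun y ↦ nabla (V y) (locExt c)) =ᶠ[𝓝 u]
      fun w ↦ covD (chartΓ x₀) (chartRep x₀ (locExt c)) w (chartRep x₀ V w) := by
    intro V
    filter_upwards [hc, chart_target_mem_nhds hu] with w hw hw'
    exact chartRep_nabla hw' (hw.differentiableAt (by simp)) V
  have hd : ∀ V : Π y : M, TangentSpace (𝓡 n) y, DifferentiableAt ℝ (chartRep x₀ V) u →
      DifferentiableAt ℝ (fun w ↦ covD (chartΓ x₀) (chartRep x₀ (locExt c)) w (chartRep x₀ V w)) u
        :=
    fun V hV ↦ (hasFDerivAt_covD hΓ hc2).1.clm_apply hV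
  have hcongr : ∀ V : Π y : M, TangentSpace (𝓡 n) y,
      covD (chartΓ x₀) (chartRep x₀ (fun y ↦ nabla (V y) (locExt c))) u =
      covD (chartΓ x₀)
        (fun w ↦ covD (chartΓ x₀) (chartRep x₀ (locExt c)) w (chartRep x₀ V w)) u := by
    intro V
    rw [covD, covD, (key V).fderiv_eq, (key V).self_of_nhds]
  rw [curvature, nabla_chart hu ((hd _ hdb).congr_of_eventuallyEq (key _)),
    nabla_chart hu ((hd _ hda).congr_of_eventuallyEq (key _)), nabla_chart hu hdc, hcongr, hcongr,
    ← map_sub, ← map_sub]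
  congr 1
  have hbr : (chartD x₀ u).inverse (VectorField.mlieBracket (𝓡 n) (locExt a) (locExt b)
      ((extChartAt (𝓡 n) x₀).symm u)) = _ := chartRep_mlieBracket hu hda hdb
  rw [hbr, ← chartRep_locExt a, ← chartRep_locExt b, ← chartRep_locExt c]
  exact covD_comm_eq_curvEnd hΓ hda hc2 hdb

theorem ricci_chart {x₀ : M} {u : EuclideanSpace ℝ (Fin n)}
    (hu : u ∈ (extChartAt (𝓡 n) x₀).target)
    (b c : TangentSpace (𝓡 n) ((extChartAt (𝓡 n) x₀).symm u)) :
    ricci b c = endTr _ (curvEnd (chartΓ x₀) u ((chartD x₀ u).inverse b)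
      ((chartD x₀ u).inverse c)) := by
  rw [ricci, ← sum_inner_chart hu _ (frame _)]
  refine Finset.sum_congr rfl fun i _ ↦ ?_
  rw [curvature_chart hu]

end RiemannianChart

/-! ### The Riemannian density -/

section Det

variable {ι : Type*} [Fintype ι] [DecidableEq ι]

theorem contDiff_det : ContDiff ℝ ∞ fun A : ι → ι → ℝ ↦ (Matrix.of A).det := by
  simp only [Matrix.det_apply, Matrix.of_apply]
  refine ContDiff.sum fun σ _ ↦ ContDiff.const_smul _ (contDiff_prod fun i _ ↦ ?_)
  exact contDiff_apply_apply ℝ ℝ (σ i) i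

theorem fderiv_det_one (H : ι → ι → ℝ) :
    fderiv ℝ (fun A : ι → ι → ℝ ↦ (Matrix.of A).det) (fun i j ↦ (1 : Matrix ι ι ℝ) i j) H =
      (Matrix.of H).trace := by
  set J : ι → ι → ℝ := fun i j ↦ (1 : Matrix ι ι ℝ) i j
  have h1 : HasDerivAt (fun t : ℝ ↦ J + t • H) H 0 := by
    simpa using ((hasDerivAt_id (0 : ℝ)).smul_const H).const_add J
  have h2 : HasFDerivAt (fun A : ι → ι → ℝ ↦ (Matrix.of A).det)
      (fderiv ℝ (fun A : ι → ι → ℝ ↦ (Matrix.of A).det) J) (J + (0 : ℝ) • H) := by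
    rw [zero_smul, add_zero]
    exact (contDiff_det.differentiable (by simp) _).hasFDerivAt
  have h3 := h2.comp_hasDerivAt (0 : ℝ) h1
  set q := Polynomial.divX (Polynomial.divX
    (1 + (Polynomial.X : Polynomial ℝ) • (Matrix.of H).map ⇑(Polynomial.C (R := ℝ))).det)
  have h5 : HasDerivAt (fun t : ℝ ↦ 1 + (Matrix.of H).trace * t + q.eval t * t ^ 2)
      (Matrix.of H).trace 0 := by
    have := (((hasDerivAt_id (0 : ℝ)).const_mul (Matrix.of H).trace).const_add 1).fun_add
      ((q.hasDerivAt 0).fun_mul ((hasDerivAt_id (0 : ℝ)).fun_pow 2))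
    simpa using this
  have h6 : (fun A : ι → ι → ℝ ↦ (Matrix.of A).det) ∘ (fun t : ℝ ↦ J + t • H) =
      fun t : ℝ ↦ 1 + (Matrix.of H).trace * t + q.eval t * t ^ 2 := by
    funext t
    exact Matrix.det_one_add_smul t (Matrix.of H)
  rw [h6] at h3
  exact h3.unique h5

/-- The derivative of a determinant. -/
theorem fderiv_det {E : Type*} [NormedAddCommGroup E] [NormedSpace ℝ E] {m : E → Matrix ι ι ℝ}
    {u : E} (hm : ∀ i j, DifferentiableAt ℝ (fun w ↦ m w i j) u) (h0 : IsUnit (m u).det) (a : E) :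
    DifferentiableAt ℝ (fun w ↦ (m w).det) u ∧ fderiv ℝ (fun w ↦ (m w).det) u a =
      (m u).det * (Matrix.of (fun i j ↦ fderiv ℝ (fun w ↦ m w i j) u a) * (m u)⁻¹).trace := by
  set N : E → ι → ι → ℝ := fun w ↦ m w * (m u)⁻¹ with hN
  have h1 : ∀ w, (m w).det = (m u).det * (Matrix.of (N w)).det := by
    intro w
    have : Matrix.of (N w) = m w * (m u)⁻¹ := rfl
    rw [this, Matrix.det_mul, mul_left_comm, ← Matrix.det_mul, Matrix.mul_nonsing_inv _ h0,
      Matrix.det_one, mul_one]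
  have h2 : ∀ i j, HasFDerivAt (fun w ↦ N w i j)
      (∑ k, (m u)⁻¹ k j • fderiv ℝ (fun w ↦ m w i k) u) u := by
    intro i j
    simp only [hN, Matrix.mul_apply]
    refine HasFDerivAt.fun_sum fun k _ ↦ ?_
    exact (hm i k).hasFDerivAt.mul_const _
  have h3 : HasFDerivAt N (ContinuousLinearMap.pi fun i ↦ ContinuousLinearMap.pi fun j ↦
      (∑ k, (m u)⁻¹ k j • fderiv ℝ (fun w ↦ m w i k) u : E →L[ℝ] ℝ)) u :=
    hasFDerivAt_pi.2 fun i ↦ hasFDerivAt_pi.2 fun j ↦ h2 i j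
  have h4 : N u = fun i j ↦ (1 : Matrix ι ι ℝ) i j := Matrix.mul_nonsing_inv _ h0
  have h5 := ((contDiff_det.differentiable (by simp) (N u)).hasFDerivAt.comp u h3).const_mul (m
      u).det
  have h6 := h5.congr_of_eventuallyEq (f₁ := fun w ↦ (m w).det) (.of_forall h1)
  refine ⟨h6.differentiableAt, ?_⟩
  rw [h6.fderiv]
  change (m u).det * fderiv ℝ (fun A : ι → ι → ℝ ↦ (Matrix.of A).det) (N u)
    (fun i j ↦ (∑ k, (m u)⁻¹ k j • fderiv ℝ (fun w ↦ m w i k) u : E →L[ℝ] ℝ) a) = _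
  rw [h4, fderiv_det_one]
  congr 2
  ext i j
  simp [Matrix.mul_apply, mul_comm]

end Det

section Density

variable {n : ℕ} {M : Type*} [TopologicalSpace M] [ChartedSpace (EuclideanSpace ℝ (Fin n)) M]
  [RiemannianBundle (fun x : M ↦ TangentSpace (𝓡 n) x)]

/-- The Gram matrix of a bilinear form on `ℝⁿ` in the standard basis. -/
def gramMatrix (g : EuclideanSpace ℝ (Fin n) →L[ℝ] EuclideanSpace ℝ (Fin n) →L[ℝ] ℝ) :
    Matrix (Fin n) (Fin n) ℝ :=
  Matrix.of fun i j ↦ g (EuclideanSpace.single i 1) (EuclideanSpace.single j 1)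

theorem euclidean_sum_single (v : EuclideanSpace ℝ (Fin n)) :
    ∑ k, v k • EuclideanSpace.single k (1 : ℝ) = v := by
  ext i
  simp [Pi.single_apply]

theorem gramMatrix_comp (g : EuclideanSpace ℝ (Fin n) →L[ℝ] EuclideanSpace ℝ (Fin n) →L[ℝ] ℝ)
    (A B : EuclideanSpace ℝ (Fin n) →L[ℝ] EuclideanSpace ℝ (Fin n)) :
    gramMatrix (g.bilinearComp A B) =
      (LinearMap.toMatrix (EuclideanSpace.basisFun (Fin n) ℝ).toBasis
        (EuclideanSpace.basisFun (Fin n) ℝ).toBasis A).transpose * gramMatrix g *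
      LinearMap.toMatrix (EuclideanSpace.basisFun (Fin n) ℝ).toBasis
        (EuclideanSpace.basisFun (Fin n) ℝ).toBasis B := by
  ext i j
  have hA := euclidean_sum_single (A (EuclideanSpace.single i 1))
  have hB := euclidean_sum_single (B (EuclideanSpace.single j 1))
  simp only [gramMatrix, Matrix.of_apply, ContinuousLinearMap.bilinearComp_apply]
  rw [← hA, ← hB]
  simp only [map_sum, map_smul, sum_apply, smul_apply, smul_eq_mul, Matrix.mul_apply,
    Matrix.transpose_apply, LinearMap.toMatrix_apply, Matrix.of_apply, Finset.sum_mul,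
    Finset.mul_sum]
  refine Finset.sum_congr rfl fun k _ ↦ Finset.sum_congr rfl fun l _ ↦ ?_
  simp
  ring

theorem gramMatrix_det_comp
    (g : EuclideanSpace ℝ (Fin n) →L[ℝ] EuclideanSpace ℝ (Fin n) →L[ℝ] ℝ)
    (A : EuclideanSpace ℝ (Fin n) →L[ℝ] EuclideanSpace ℝ (Fin n)) :
    (gramMatrix (g.bilinearComp A A)).det = A.det ^ 2 * (gramMatrix g).det := by
  rw [gramMatrix_comp, Matrix.det_mul, Matrix.det_mul, Matrix.det_transpose,
    LinearMap.det_toMatrix]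
  change A.det * _ * A.det = _
  ring

/-- The density of the Riemannian volume in the chart at `x₀`. -/
def chartDensity (x₀ : M) (u : EuclideanSpace ℝ (Fin n)) : ℝ :=
  √(gramMatrix (chartMetric x₀ u)).det

theorem chartVolume_eq [MeasurableSpace M] (x₀ : M) : chartVolume (n := n) x₀ =
    (((volume : Measure (EuclideanSpace ℝ (Fin n))).restrict
      (extChartAt (𝓡 n) x₀).target).withDensity fun u ↦ ENNReal.ofReal (chartDensity x₀ u)).map
        (extChartAt (𝓡 n) x₀).symm := rfl

variable [IsManifold (𝓡 n) ∞ M]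

theorem gramMatrix_chartMetric_det_pos {x₀ : M} {u : EuclideanSpace ℝ (Fin n)}
    (hu : u ∈ (extChartAt (𝓡 n) x₀).target) : 0 < (gramMatrix (chartMetric x₀ u)).det := by
  apply Matrix.PosDef.det_pos
  refine Matrix.PosDef.of_dotProduct_mulVec_pos ?_ ?_
  · ext i j
    simp [gramMatrix, chartMetric_symm x₀ u (EuclideanSpace.single i 1)]
  · intro x hx
    have h1 : star x ⬝ᵥ (gramMatrix (chartMetric x₀ u)).mulVec x =
        chartMetric x₀ u (WithLp.toLp 2 x) (WithLp.toLp 2 x) := by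
      conv_rhs => rw [← euclidean_sum_single (WithLp.toLp 2 x)]
      simp only [map_sum, map_smul, sum_apply, smul_apply, smul_eq_mul, dotProduct, Matrix.mulVec,
        gramMatrix, Matrix.of_apply, Finset.mul_sum]
      rw [Finset.sum_comm]
      refine Finset.sum_congr rfl fun k _ ↦ Finset.sum_congr rfl fun l _ ↦ ?_
      simp
      rw [chartMetric_symm]
      ring
    rw [h1, chartMetric_apply]
    refine real_inner_self_pos.2 fun h ↦ hx ?_
    obtain ⟨e, he⟩ := chartD_isInvertible hu
    rw [← he] at h
    have := (map_eq_zero_iff e e.injective).1 h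
    simpa using congrArg WithLp.ofLp this

theorem chartDensity_pos {x₀ : M} {u : EuclideanSpace ℝ (Fin n)}
    (hu : u ∈ (extChartAt (𝓡 n) x₀).target) : 0 < chartDensity x₀ u :=
  Real.sqrt_pos.2 (gramMatrix_chartMetric_det_pos hu)

theorem endTr_inverse_chartMetric {x₀ : M} {u : EuclideanSpace ℝ (Fin n)}
    (hu : u ∈ (extChartAt (𝓡 n) x₀).target)
    (A : EuclideanSpace ℝ (Fin n) →L[ℝ] EuclideanSpace ℝ (Fin n)) {ι : Type*} [Fintype ι]
    (b : OrthonormalBasis ι ℝ (TangentSpace (𝓡 n) ((extChartAt (𝓡 n) x₀).symm u))) :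
    endTr _ A = ∑ i, chartMetric x₀ u (A ((chartD x₀ u).inverse (b i)))
      ((chartD x₀ u).inverse (b i)) := by
  rw [← sum_inner_chart hu A b]
  exact Finset.sum_congr rfl fun i _ ↦ (chartMetric_inverse_apply hu _ _).symm

theorem endTr_eq_trace_gramMatrix {x₀ : M} {u : EuclideanSpace ℝ (Fin n)}
    (hu : u ∈ (extChartAt (𝓡 n) x₀).target)
    (h : EuclideanSpace ℝ (Fin n) →L[ℝ] EuclideanSpace ℝ (Fin n) →L[ℝ] ℝ) :
    endTr _ ((chartMetric x₀ u).inverse.comp h) =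
      (gramMatrix h * (gramMatrix (chartMetric x₀ u))⁻¹).trace := by
  have h1 : h = (chartMetric x₀ u).bilinearComp ((chartMetric x₀ u).inverse.comp h)
      (ContinuousLinearMap.id ℝ _) := by
    ext a b
    simp only [ContinuousLinearMap.bilinearComp_apply, ContinuousLinearMap.comp_apply]
    rw [metric_inverse_apply (chartMetric_isInvertible hu)]
    rfl
  have h2 : gramMatrix h = _ := (congrArg gramMatrix h1).trans (gramMatrix_comp _ _ _)
  have h3 : LinearMap.toMatrix (EuclideanSpace.basisFun (Fin n) ℝ).toBasis
        (EuclideanSpace.basisFun (Fin n) ℝ).toBasis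
        ((ContinuousLinearMap.id ℝ (EuclideanSpace ℝ (Fin n))) :
          EuclideanSpace ℝ (Fin n) →ₗ[ℝ] EuclideanSpace ℝ (Fin n)) = 1 := LinearMap.toMatrix_id _
  rw [h2, h3, Matrix.mul_one, Matrix.mul_assoc, Matrix.mul_nonsing_inv _
    (gramMatrix_chartMetric_det_pos hu).ne'.isUnit, Matrix.mul_one, Matrix.trace_transpose,
    ← LinearMap.trace_eq_matrix_trace]
  rfl

variable [IsContMDiffRiemannianBundle (𝓡 n) ∞ (EuclideanSpace ℝ (Fin n))
      (fun x : M ↦ TangentSpace (𝓡 n) x)]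

theorem endTr_chartΓ {x₀ : M} {u : EuclideanSpace ℝ (Fin n)}
    (hu : u ∈ (extChartAt (𝓡 n) x₀).target) (a : EuclideanSpace ℝ (Fin n)) :
    endTr _ ((chartΓ x₀ u).flip a) =
      (1 / 2) * endTr _ ((chartMetric x₀ u).inverse.comp (fderiv ℝ (chartMetric x₀) u a)) := by
  rw [endTr_inverse_chartMetric hu _ (frame _), endTr_inverse_chartMetric hu _ (frame _),
    Finset.mul_sum]
  refine Finset.sum_congr rfl fun i _ ↦ ?_
  rw [ContinuousLinearMap.flip_apply, ContinuousLinearMap.comp_apply,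
    metric_christoffel (chartMetric_isInvertible hu),
    metric_inverse_apply (chartMetric_isInvertible hu),
    fderiv_metric_symm (differentiableAt_chartMetric hu)
      (.of_forall fun w ↦ chartMetric_symm x₀ w) _ a]
  ring

theorem fderiv_chartDensity {x₀ : M} {u : EuclideanSpace ℝ (Fin n)}
    (hu : u ∈ (extChartAt (𝓡 n) x₀).target) (a : EuclideanSpace ℝ (Fin n)) :
    fderiv ℝ (chartDensity x₀) u a = chartDensity x₀ u * endTr _ ((chartΓ x₀ u).flip a) := by
  have h1 : ∀ i j, HasFDerivAt (fun w ↦ gramMatrix (chartMetric x₀ w) i j) _ u := fun i j ↦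
    ((differentiableAt_chartMetric hu).hasFDerivAt.clm_apply (hasFDerivAt_const _ u)).clm_apply
      (hasFDerivAt_const _ u)
  have hpos := gramMatrix_chartMetric_det_pos hu
  obtain ⟨h2, h3⟩ := fderiv_det (fun i j ↦ (h1 i j).differentiableAt) hpos.ne'.isUnit a
  have h4 : Matrix.of (fun i j ↦ fderiv ℝ (fun w ↦ gramMatrix (chartMetric x₀ w) i j) u a) =
      gramMatrix (fderiv ℝ (chartMetric x₀) u a) := by
    ext i j
    rw [Matrix.of_apply, (h1 i j).fderiv]
    simp [gramMatrix]
  have h5 : HasFDerivAt (chartDensity x₀) _ u := h2.hasFDerivAt.sqrt hpos.ne'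
  rw [h5.fderiv, smul_apply, h3, h4, ← endTr_eq_trace_gramMatrix hu, endTr_chartΓ hu]
  change _ = √(gramMatrix (chartMetric x₀ u)).det * _
  have h6 := Real.mul_self_sqrt hpos.le
  have h7 := (Real.sqrt_pos.2 hpos).ne'
  rw [smul_eq_mul]
  conv_lhs => rw [← h6, Real.sqrt_mul_self (Real.sqrt_nonneg _)]
  field_simp

theorem contDiffOn_chartDensity (x₀ : M) :
    ContDiffOn ℝ ∞ (chartDensity x₀) (extChartAt (𝓡 n) x₀).target := by
  refine ContDiffOn.sqrt ?_ fun u hu ↦ (gramMatrix_chartMetric_det_pos hu).ne'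
  have h : ContDiffOn ℝ ∞ (fun u (i j : Fin n) ↦ chartMetric x₀ u (EuclideanSpace.single i 1)
      (EuclideanSpace.single j 1)) (extChartAt (𝓡 n) x₀).target :=
    contDiffOn_pi.2 fun i ↦ contDiffOn_pi.2 fun j ↦
      ((contDiffOn_chartMetric x₀).clm_apply contDiffOn_const).clm_apply contDiffOn_const
  exact (contDiff_det (ι := Fin n)).comp_contDiffOn h

/-- The divergence in coordinates. -/
theorem chartDensity_mul_endTr_covD {x₀ : M} {u : EuclideanSpace ℝ (Fin n)}
    (hu : u ∈ (extChartAt (𝓡 n) x₀).target)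
    {X : EuclideanSpace ℝ (Fin n) → EuclideanSpace ℝ (Fin n)} (hX : DifferentiableAt ℝ X u) :
    chartDensity x₀ u * endTr _ (covD (chartΓ x₀) X u) =
      ∑ i, fderiv ℝ (fun w ↦ chartDensity x₀ w * X w i) u (EuclideanSpace.single i 1) := by
  have hd : DifferentiableAt ℝ (chartDensity x₀) u :=
    ((contDiffOn_chartDensity x₀).contDiffAt (chart_target_mem_nhds hu)).differentiableAt (by simp)
  have h1 : ∀ i, HasFDerivAt (fun w ↦ X w i)
      ((EuclideanSpace.proj i : _ →L[ℝ] ℝ).comp (fderiv ℝ X u)) u := fun i ↦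
    (EuclideanSpace.proj i : EuclideanSpace ℝ (Fin n) →L[ℝ] ℝ).hasFDerivAt.comp u hX.hasFDerivAt
  have h2 : ∑ i, fderiv ℝ X u (EuclideanSpace.single i 1) i = endTr _ (fderiv ℝ X u) := by
    rw [endTr_apply, LinearMap.trace_eq_sum_inner _ (EuclideanSpace.basisFun (Fin n) ℝ)]
    refine Finset.sum_congr rfl fun i _ ↦ ?_
    rw [EuclideanSpace.basisFun_apply, EuclideanSpace.inner_single_left]
    simp
  have h3 : ∑ i, X u i * fderiv ℝ (chartDensity x₀) u (EuclideanSpace.single i 1) =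
      fderiv ℝ (chartDensity x₀) u (X u) := by
    conv_rhs => rw [← euclidean_sum_single (X u)]
    simp
  have h4 : ∀ i, fderiv ℝ (fun w ↦ chartDensity x₀ w * X w i) u (EuclideanSpace.single i 1) =
      chartDensity x₀ u * fderiv ℝ X u (EuclideanSpace.single i 1) i
        + X u i * fderiv ℝ (chartDensity x₀) u (EuclideanSpace.single i 1) := by
    intro i
    rw [(hd.hasFDerivAt.fun_mul (h1 i)).fderiv]
    simp
  simp only [h4, Finset.sum_add_distrib, ← Finset.mul_sum]
  rw [h2, h3, fderiv_chartDensity hu, covD, map_add]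
  ring

end Density

/-! ### The Riemannian volume -/

section Volume

variable {n : ℕ} {M : Type*} [TopologicalSpace M] [ChartedSpace (EuclideanSpace ℝ (Fin n)) M]

theorem measurableSet_target_inter_preimage [MeasurableSpace M] [BorelSpace M] (x : M) {B : Set M}
    (hB : MeasurableSet B) :
    MeasurableSet ((extChartAt (𝓡 n) x).target ∩ (extChartAt (𝓡 n) x).symm ⁻¹' B) := by
  have ht := (isOpen_extChartAt_target (I := 𝓡 n) x).measurableSet
  have h1 : Continuous ((extChartAt (𝓡 n) x).target.domRestrict (extChartAt (𝓡 n) x).symm) :=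
    (continuousOn_extChartAt_symm x).domRestrict
  have h2 := MeasurableSet.subtype_image ht (h1.measurable hB)
  convert h2 using 1
  ext u
  simp only [Set.mem_inter_iff, Set.mem_preimage, Set.mem_image, Subtype.exists,
    exists_and_right, exists_eq_right]
  exact ⟨fun h ↦ ⟨h.1, h.2⟩, fun ⟨h, h'⟩ ↦ ⟨h, h'⟩⟩

theorem differentiableAt_chart_change [IsManifold (𝓡 n) ∞ M] {x y : M} {u : EuclideanSpace ℝ (Fin
    n)}
    (hu : u ∈ (extChartAt (𝓡 n) y).target)
    (hx : (extChartAt (𝓡 n) y).symm u ∈ (extChartAt (𝓡 n) x).source) :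
    DifferentiableAt ℝ (extChartAt (𝓡 n) x ∘ (extChartAt (𝓡 n) y).symm) u := by
  have h1 : MDifferentiableAt 𝓘(ℝ, EuclideanSpace ℝ (Fin n)) 𝓘(ℝ, EuclideanSpace ℝ (Fin n))
      (extChartAt (𝓡 n) x ∘ (extChartAt (𝓡 n) y).symm) u :=
    MDifferentiableAt.comp (I' := 𝓡 n) u
      ((contMDiffAt_extChartAt' (I := 𝓡 n) (n := 1) (by simpa using hx)).mdifferentiableAt
        (by norm_num)) ((contMDiffAt_chart_symm hu).mdifferentiableAt (by simp))
  exact h1.differentiableAt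

variable [RiemannianBundle (fun x : M ↦ TangentSpace (𝓡 n) x)]

theorem aemeasurable_chart_symm [MeasurableSpace M] [BorelSpace M] (x : M) : AEMeasurable
    (extChartAt (𝓡 n) x).symm
    (((volume : Measure (EuclideanSpace ℝ (Fin n))).restrict
      (extChartAt (𝓡 n) x).target).withDensity fun u ↦ ENNReal.ofReal (chartDensity x u)) :=
  ((continuousOn_extChartAt_symm x).aemeasurable
    (isOpen_extChartAt_target x).measurableSet).mono_ac (withDensity_absolutelyContinuous _ _)

theorem chartVolume_apply [MeasurableSpace M] [BorelSpace M] (x : M) {B : Set M} (hB :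
    MeasurableSet B) :
    chartVolume (n := n) x B =
      ∫⁻ u in (extChartAt (𝓡 n) x).target ∩ (extChartAt (𝓡 n) x).symm ⁻¹' B,
        ENNReal.ofReal (chartDensity x u) := by
  rw [chartVolume_eq, Measure.map_apply_of_aemeasurable (aemeasurable_chart_symm x) hB,
    withDensity_apply', Measure.restrict_restrict' (isOpen_extChartAt_target x).measurableSet,
    Set.inter_comm]

theorem chartVolume_source_compl [MeasurableSpace M] [BorelSpace M] (x : M) :
    chartVolume (n := n) x (extChartAt (𝓡 n) x).sourceᶜ = 0 := by
  rw [chartVolume_apply x (isOpen_extChartAt_source x).measurableSet.compl]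
  have : (extChartAt (𝓡 n) x).target ∩ (extChartAt (𝓡 n) x).symm ⁻¹' (extChartAt (𝓡 n) x).sourceᶜ
      = ∅ := by
    ext u
    simp only [Set.mem_inter_iff, Set.mem_preimage, Set.mem_compl_iff, Set.mem_empty_iff_false,
      iff_false, not_and, not_not]
    exact fun hu ↦ (extChartAt (𝓡 n) x).map_target hu
  rw [this]
  simp

theorem chartVolume_restrict_source [MeasurableSpace M] [BorelSpace M] (x : M) :
    (chartVolume (n := n) x).restrict (extChartAt (𝓡 n) x).source = chartVolume (n := n) x :=
  Measure.restrict_eq_self_of_ae_mem (by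
    rw [ae_iff]
    exact chartVolume_source_compl x)

theorem inner_congr_point {z z' : M} (h : z = z') (a b : EuclideanSpace ℝ (Fin n)) :
    @inner ℝ (TangentSpace (𝓡 n) z) _ a b = @inner ℝ (TangentSpace (𝓡 n) z') _ a b := by
  subst h
  rfl

variable [IsManifold (𝓡 n) ∞ M]

theorem chartMetric_change {x y : M} {u : EuclideanSpace ℝ (Fin n)}
    (hu : u ∈ (extChartAt (𝓡 n) y).target)
    (hx : (extChartAt (𝓡 n) y).symm u ∈ (extChartAt (𝓡 n) x).source) :
    chartMetric y u = (chartMetric x (extChartAt (𝓡 n) x ((extChartAt (𝓡 n) y).symm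
      u))).bilinearComp
      (fderiv ℝ (extChartAt (𝓡 n) x ∘ (extChartAt (𝓡 n) y).symm) u)
      (fderiv ℝ (extChartAt (𝓡 n) x ∘ (extChartAt (𝓡 n) y).symm) u) := by
  set τ := extChartAt (𝓡 n) x ∘ (extChartAt (𝓡 n) y).symm with hτ
  have hτu : τ u ∈ (extChartAt (𝓡 n) x).target := (extChartAt (𝓡 n) x).map_source hx
  have h1 : (extChartAt (𝓡 n) y).symm =ᶠ[𝓝 u] (extChartAt (𝓡 n) x).symm ∘ τ := by
    filter_upwards [(contMDiffAt_chart_symm hu).continuousAt.eventually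
      ((isOpen_extChartAt_source (I := 𝓡 n) x).mem_nhds hx)] with w hw
    exact ((extChartAt (𝓡 n) x).left_inv hw).symm
  have h2 : ∀ a, chartD y u a = chartD x (τ u) (fderiv ℝ τ u a) := by
    intro a
    have h3 := mfderiv_comp (I := 𝓘(ℝ, EuclideanSpace ℝ (Fin n)))
      (I' := 𝓘(ℝ, EuclideanSpace ℝ (Fin n))) (I'' := 𝓡 n) u
      (g := (extChartAt (𝓡 n) x).symm) (f := τ)
      ((contMDiffAt_chart_symm hτu).mdifferentiableAt (by simp))
      (differentiableAt_chart_change hu hx).mdifferentiableAt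
    have h4 : mfderiv 𝓘(ℝ, EuclideanSpace ℝ (Fin n)) (𝓡 n) (extChartAt (𝓡 n) y).symm u =
      mfderiv 𝓘(ℝ, EuclideanSpace ℝ (Fin n)) (𝓡 n) ((extChartAt (𝓡 n) x).symm ∘ τ) u :=
        h1.mfderiv_eq
    have h5 : chartD y u = mfderiv 𝓘(ℝ, EuclideanSpace ℝ (Fin n)) (𝓡 n)
      ((extChartAt (𝓡 n) x).symm ∘ τ) u := h4
    rw [mfderiv_eq_fderiv] at h3
    exact (DFunLike.congr_fun h5 a).trans (DFunLike.congr_fun h3 a)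
  ext a b
  rw [ContinuousLinearMap.bilinearComp_apply, chartMetric_apply, chartMetric_apply]
  refine (inner_congr_point ((extChartAt (𝓡 n) x).left_inv hx).symm _ _).trans ?_
  exact congrArg₂ (fun a b : EuclideanSpace ℝ (Fin n) ↦
    @inner ℝ (TangentSpace (𝓡 n) ((extChartAt (𝓡 n) x).symm (τ u))) _ a b) (h2 a) (h2 b)

theorem chartDensity_change {x y : M} {u : EuclideanSpace ℝ (Fin n)}
    (hu : u ∈ (extChartAt (𝓡 n) y).target)
    (hx : (extChartAt (𝓡 n) y).symm u ∈ (extChartAt (𝓡 n) x).source) :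
    chartDensity y u = |(fderiv ℝ (extChartAt (𝓡 n) x ∘ (extChartAt (𝓡 n) y).symm) u).det| *
      chartDensity x (extChartAt (𝓡 n) x ((extChartAt (𝓡 n) y).symm u)) := by
  rw [chartDensity, chartMetric_change hu hx, gramMatrix_det_comp, Real.sqrt_mul (sq_nonneg _),
    Real.sqrt_sq_eq_abs]
  rfl

variable [MeasurableSpace M] [BorelSpace M]

/-- The chart volumes agree on overlaps. -/
theorem chartVolume_inter_eq (x y : M) {A : Set M} (hA : MeasurableSet A)
    (hx : A ⊆ (extChartAt (𝓡 n) x).source) (hy : A ⊆ (extChartAt (𝓡 n) y).source) :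
    chartVolume (n := n) x A = chartVolume (n := n) y A := by
  rw [chartVolume_apply x hA, chartVolume_apply y hA]
  set S := (extChartAt (𝓡 n) y).target ∩ (extChartAt (𝓡 n) y).symm ⁻¹' A
  have hS : MeasurableSet S := measurableSet_target_inter_preimage y hA
  have himg : (extChartAt (𝓡 n) x).target ∩ (extChartAt (𝓡 n) x).symm ⁻¹' A =
      (extChartAt (𝓡 n) x ∘ (extChartAt (𝓡 n) y).symm) '' S := by
    ext w
    constructor
    · rintro ⟨hw, hwA⟩
      have hwA' : (extChartAt (𝓡 n) x).symm w ∈ A := hwA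
      refine ⟨extChartAt (𝓡 n) y ((extChartAt (𝓡 n) x).symm w),
        ⟨(extChartAt (𝓡 n) y).map_source (hy hwA'), ?_⟩, ?_⟩
      · rw [Set.mem_preimage, (extChartAt (𝓡 n) y).left_inv (hy hwA')]
        exact hwA'
      · rw [Function.comp_apply, (extChartAt (𝓡 n) y).left_inv (hy hwA'),
          (extChartAt (𝓡 n) x).right_inv hw]
    · rintro ⟨u, ⟨hu, huA⟩, rfl⟩
      have huA' : (extChartAt (𝓡 n) y).symm u ∈ A := huA
      refine ⟨(extChartAt (𝓡 n) x).map_source (hx huA'), ?_⟩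
      rw [Set.mem_preimage, Function.comp_apply, (extChartAt (𝓡 n) x).left_inv (hx huA')]
      exact huA'
  have hinj : Set.InjOn (extChartAt (𝓡 n) x ∘ (extChartAt (𝓡 n) y).symm) S := by
    rintro u ⟨hu, huA⟩ w ⟨hw, hwA⟩ h
    exact (extChartAt (𝓡 n) y).symm.injOn hu hw ((extChartAt (𝓡 n) x).injOn (hx huA) (hx hwA) h)
  rw [himg, lintegral_image_eq_lintegral_abs_det_fderiv_mul volume hS
    (fun u hu ↦ (differentiableAt_chart_change hu.1 (hx hu.2)).hasFDerivAt.hasFDerivWithinAt) hinj]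
  refine setLIntegral_congr_fun hS fun u hu ↦ ?_
  rw [chartDensity_change hu.1 (hx hu.2), ENNReal.ofReal_mul (abs_nonneg _)]
  rfl

theorem riemannianVolume_restrict_source (x : M) :
    (riemannianVolume n M).restrict (extChartAt (𝓡 n) x).source = chartVolume (n := n) x := by
  have hs := (isOpen_extChartAt_source (I := 𝓡 n) x).measurableSet
  refine le_antisymm ?_ ?_
  · have h1 : riemannianVolume n M ≤ chartVolume (n := n) x
        + (riemannianVolume n M).restrict (extChartAt (𝓡 n) x).sourceᶜ := by
      refine iSup_le fun y ↦ ?_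
      rw [Measure.le_iff]
      intro A hA
      rw [← measure_inter_add_sdiff A hs, Measure.add_apply]
      refine add_le_add ?_ ?_
      · have h2 : chartVolume (n := n) y (A ∩ (extChartAt (𝓡 n) x).source) =
            chartVolume (n := n) y (A ∩ (extChartAt (𝓡 n) x).source ∩
              (extChartAt (𝓡 n) y).source) := by
          conv_lhs => rw [← chartVolume_restrict_source y]
          rw [Measure.restrict_apply (hA.inter hs)]
        rw [h2, ← chartVolume_inter_eq x y ((hA.inter hs).inter
          (isOpen_extChartAt_source y).measurableSet)
          (fun z hz ↦ hz.1.2) (fun z hz ↦ hz.2)]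
        exact measure_mono fun z hz ↦ hz.1.1
      · rw [Measure.restrict_apply hA]
        exact (le_iSup (fun y : M ↦ chartVolume (n := n) y) y) _
    calc (riemannianVolume n M).restrict (extChartAt (𝓡 n) x).source
        ≤ (chartVolume (n := n) x + (riemannianVolume n M).restrict
          (extChartAt (𝓡 n) x).sourceᶜ).restrict (extChartAt (𝓡 n) x).source :=
          Measure.restrict_mono le_rfl h1
      _ = chartVolume (n := n) x := by
          rw [Measure.restrict_add, Measure.restrict_restrict hs, Set.inter_compl_self,
            Measure.restrict_empty, add_zero, chartVolume_restrict_source]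
  · rw [← chartVolume_restrict_source x]
    exact Measure.restrict_mono le_rfl (le_iSup (fun y : M ↦ chartVolume (n := n) y) x)

theorem riemannianVolume_apply (x : M) {A : Set M} (hA : A ⊆ (extChartAt (𝓡 n) x).source) :
    riemannianVolume n M A = chartVolume (n := n) x A := by
  rw [← riemannianVolume_restrict_source x, Measure.restrict_apply']
  · rw [Set.inter_eq_left.2 hA]
  · exact (isOpen_extChartAt_source x).measurableSet

variable [IsContMDiffRiemannianBundle (𝓡 n) ∞ (EuclideanSpace ℝ (Fin n))
      (fun x : M ↦ TangentSpace (𝓡 n) x)]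

instance : IsLocallyFiniteMeasure (riemannianVolume n M) := by
  refine ⟨fun x ↦ ?_⟩
  set u₀ := extChartAt (𝓡 n) x x
  have hu₀ : u₀ ∈ (extChartAt (𝓡 n) x).target := mem_extChartAt_target x
  have hc : ContinuousAt (chartDensity x) u₀ :=
    ((contDiffOn_chartDensity x).contDiffAt (chart_target_mem_nhds hu₀)).continuousAt
  have h1 : ∀ᶠ u in 𝓝 u₀, chartDensity x u < chartDensity x u₀ + 1 :=
    hc.eventually (gt_mem_nhds (by linarith))
  obtain ⟨V, hV, hVo, hVm⟩ := mem_nhds_iff.1 (Filter.inter_mem h1 (Metric.ball_mem_nhds u₀ one_pos))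
  set N := (extChartAt (𝓡 n) x).source ∩ extChartAt (𝓡 n) x ⁻¹' V
  have hN : IsOpen N := (continuousOn_extChartAt x).isOpen_inter_preimage
    (isOpen_extChartAt_source x) hVo
  refine ⟨N, hN.mem_nhds ⟨mem_extChartAt_source x, hVm⟩, ?_⟩
  rw [riemannianVolume_apply x Set.inter_subset_left, chartVolume_apply x hN.measurableSet]
  have hsub : (extChartAt (𝓡 n) x).target ∩ (extChartAt (𝓡 n) x).symm ⁻¹' N ⊆ V := by
    rintro u ⟨hu, hu'⟩
    have : extChartAt (𝓡 n) x ((extChartAt (𝓡 n) x).symm u) ∈ V := hu'.2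
    rwa [(extChartAt (𝓡 n) x).right_inv hu] at this
  refine (lintegral_mono_set hsub).trans_lt ?_
  refine (setLIntegral_mono' hVo.measurableSet (g := fun _ ↦
    ENNReal.ofReal (chartDensity x u₀ + 1)) fun u hu ↦
      ENNReal.ofReal_le_ofReal (le_of_lt (hV hu).1)).trans_lt ?_
  rw [setLIntegral_const]
  refine ENNReal.mul_lt_top ENNReal.ofReal_lt_top ?_
  exact (measure_mono fun u hu ↦ (hV hu).2).trans_lt measure_ball_lt_top

/-- The integral of a continuous function supported in a chart. -/
theorem integral_riemannianVolume_of_support_subset {x : M} {F : M → ℝ}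
    (hF : Continuous F) (hs : ∀ y ∉ (extChartAt (𝓡 n) x).source, F y = 0) :
    ∫ y, F y ∂(riemannianVolume n M) = ∫ u in (extChartAt (𝓡 n) x).target,
      chartDensity x u * F ((extChartAt (𝓡 n) x).symm u) := by
  rw [← setIntegral_eq_integral_of_forall_compl_eq_zero hs, riemannianVolume_restrict_source,
    chartVolume_eq, integral_map (aemeasurable_chart_symm x) hF.aestronglyMeasurable,
    integral_withDensity_eq_integral_toReal_smul₀]
  · refine setIntegral_congr_fun (isOpen_extChartAt_target x).measurableSet fun u hu ↦ ?_
    simp [ENNReal.toReal_ofReal (chartDensity_pos hu).le]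
  · exact ((contDiffOn_chartDensity x).continuousOn.aemeasurable
      (isOpen_extChartAt_target x).measurableSet).ennreal_ofReal
  · exact Filter.Eventually.of_forall fun u ↦ ENNReal.ofReal_lt_top

end Volume

/-! ### The divergence theorem -/

theorem integral_sum_fderiv_eq_zero {n : ℕ}
    {Z : EuclideanSpace ℝ (Fin n) → EuclideanSpace ℝ (Fin n)} (hZ : ContDiff ℝ 1 Z)
    (hc : HasCompactSupport Z) :
    ∫ u, ∑ i, fderiv ℝ (fun w ↦ Z w i) u (EuclideanSpace.single i 1) = 0 := by
  have h1 : ∀ i, ContDiff ℝ 1 fun w ↦ Z w i := fun i ↦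
    (EuclideanSpace.proj i : EuclideanSpace ℝ (Fin n) →L[ℝ] ℝ).contDiff.comp hZ
  have h2 : ∀ i, HasCompactSupport fun w ↦ Z w i := fun i ↦
    hc.comp_left (g := fun v : EuclideanSpace ℝ (Fin n) ↦ v i) rfl
  have h3 : ∀ i, Integrable fun u ↦ fderiv ℝ (fun w ↦ Z w i) u (EuclideanSpace.single i 1) := by
    intro i
    refine Continuous.integrable_of_hasCompactSupport ?_ ?_
    · exact ((h1 i).continuous_fderiv (by simp)).clm_apply continuous_const
    · exact ((h2 i).fderiv ℝ).comp_left
        (g := fun L : EuclideanSpace ℝ (Fin n) →L[ℝ] ℝ ↦ L (EuclideanSpace.single i 1)) rfl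
  rw [integral_finsetSum _ fun i _ ↦ h3 i]
  refine Finset.sum_eq_zero fun i _ ↦ ?_
  have := integral_mul_fderiv_eq_neg_fderiv_mul_of_integrable (μ := volume)
    (f := fun _ : EuclideanSpace ℝ (Fin n) ↦ (1 : ℝ)) (g := fun w ↦ Z w i)
    (v := EuclideanSpace.single i 1) (by simp) (by simpa using h3 i)
    (by simpa using (h1 i).continuous.integrable_of_hasCompactSupport (h2 i))
    (fun _ _ ↦ by fun_prop) (fun _ _ ↦ (h1 i).differentiable (by simp) _)
  simpa using this

section Divergence

variable {n : ℕ} {M : Type*} [TopologicalSpace M] [ChartedSpace (EuclideanSpace ℝ (Fin n)) M]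

/-- A vector field that is smooth in all charts. -/
def IsSmoothField (X : Π y : M, TangentSpace (𝓡 n) y) : Prop :=
  ∀ x₀ : M, ContDiffOn ℝ ∞ (chartRep x₀ X) (extChartAt (𝓡 n) x₀).target

/-- A function that is smooth in all charts. -/
def IsSmoothFun (n : ℕ) {M : Type*} [TopologicalSpace M]
    [ChartedSpace (EuclideanSpace ℝ (Fin n)) M] (φ : M → ℝ) : Prop :=
  ∀ x₀ : M, ContDiffOn ℝ ∞ (φ ∘ (extChartAt (𝓡 n) x₀).symm) (extChartAt (𝓡 n) x₀).target

theorem continuous_of_chart {F : M → ℝ}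
    (h : ∀ x₀ : M, ContinuousOn (F ∘ (extChartAt (𝓡 n) x₀).symm) (extChartAt (𝓡 n) x₀).target) :
    Continuous F := by
  refine continuous_iff_continuousAt.2 fun x ↦ ?_
  have h1 : ContinuousAt (F ∘ (extChartAt (𝓡 n) x).symm) (extChartAt (𝓡 n) x x) :=
    (h x).continuousAt (chart_target_mem_nhds (mem_extChartAt_target x))
  refine (h1.comp (continuousAt_extChartAt (I := 𝓡 n) x)).congr ?_
  filter_upwards [extChartAt_source_mem_nhds (I := 𝓡 n) x] with y hy
  exact congrArg F ((extChartAt (𝓡 n) x).left_inv hy)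

namespace IsSmoothFun

variable {φ χ : M → ℝ}

protected theorem continuous (h : IsSmoothFun n φ) : Continuous φ :=
  continuous_of_chart fun x₀ ↦ (h x₀).continuousOn

theorem add (h : IsSmoothFun n φ) (h' : IsSmoothFun n χ) : IsSmoothFun n fun y ↦ φ y + χ y :=
  fun x₀ ↦ (h x₀).add (h' x₀)

theorem sub (h : IsSmoothFun n φ) (h' : IsSmoothFun n χ) : IsSmoothFun n fun y ↦ φ y - χ y :=
  fun x₀ ↦ (h x₀).sub (h' x₀)

end IsSmoothFun

theorem IsSmoothField.differentiableAt {X : Π y : M, TangentSpace (𝓡 n) y} (hX : IsSmoothField X)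
    {x₀ : M} {u : EuclideanSpace ℝ (Fin n)} (hu : u ∈ (extChartAt (𝓡 n) x₀).target) :
    DifferentiableAt ℝ (chartRep x₀ X) u :=
  ((hX x₀).contDiffAt (chart_target_mem_nhds hu)).differentiableAt (by simp)

theorem IsSmoothFun.differentiableAt {φ : M → ℝ} (hφ : IsSmoothFun n φ)
    {x₀ : M} {u : EuclideanSpace ℝ (Fin n)} (hu : u ∈ (extChartAt (𝓡 n) x₀).target) :
    DifferentiableAt ℝ (φ ∘ (extChartAt (𝓡 n) x₀).symm) u :=
  ((hφ x₀).contDiffAt (chart_target_mem_nhds hu)).differentiableAt (by simp)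

theorem chartRep_add (x₀ : M) (X Y : Π y : M, TangentSpace (𝓡 n) y) :
    chartRep x₀ (fun y ↦ X y + Y y) = fun u ↦ chartRep x₀ X u + chartRep x₀ Y u :=
  funext fun u ↦ map_add (chartD x₀ u).inverse _ _

theorem chartRep_sub (x₀ : M) (X Y : Π y : M, TangentSpace (𝓡 n) y) :
    chartRep x₀ (fun y ↦ X y - Y y) = fun u ↦ chartRep x₀ X u - chartRep x₀ Y u :=
  funext fun u ↦ map_sub (chartD x₀ u).inverse _ _

theorem chartRep_smul (x₀ : M) (φ : M → ℝ) (X : Π y : M, TangentSpace (𝓡 n) y) :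
    chartRep x₀ (fun y ↦ φ y • X y) =
      fun u ↦ (φ ∘ (extChartAt (𝓡 n) x₀).symm) u • chartRep x₀ X u :=
  funext fun u ↦ map_smul (chartD x₀ u).inverse _ _

theorem IsSmoothField.add {X Y : Π y : M, TangentSpace (𝓡 n) y} (hX : IsSmoothField X)
    (hY : IsSmoothField Y) : IsSmoothField fun y ↦ X y + Y y := fun x₀ ↦ by
  rw [chartRep_add]
  exact (hX x₀).add (hY x₀)

theorem IsSmoothField.sub {X Y : Π y : M, TangentSpace (𝓡 n) y} (hX : IsSmoothField X)
    (hY : IsSmoothField Y) : IsSmoothField fun y ↦ X y - Y y := fun x₀ ↦ by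
  rw [chartRep_sub]
  exact (hX x₀).sub (hY x₀)

theorem IsSmoothField.smul {φ : M → ℝ} {X : Π y : M, TangentSpace (𝓡 n) y}
    (hX : IsSmoothField X) (hφ : IsSmoothFun n φ) : IsSmoothField fun y ↦ φ y • X y := fun x₀ ↦ by
  rw [chartRep_smul]
  exact (hφ x₀).smul (hX x₀)

theorem isSmoothFun_sum {ι : Type*} {φ : ι → M → ℝ} (s : Finset ι)
    (hφ : ∀ i, IsSmoothFun n (φ i)) : IsSmoothFun n fun y ↦ ∑ i ∈ s, φ i y := fun x₀ ↦
  ContDiffOn.sum fun i _ ↦ hφ i x₀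

theorem exists_chart_point (x : M) :
    ∃ x₀ : M, ∃ u ∈ (extChartAt (𝓡 n) x₀).target, (extChartAt (𝓡 n) x₀).symm u = x :=
  ⟨x, _, mem_extChartAt_target x, extChartAt_to_inv x⟩

theorem IsSmoothFun.contMDiff [IsManifold (𝓡 n) ∞ M] {φ : M → ℝ} (h : IsSmoothFun n φ) :
    ContMDiff (𝓡 n) 𝓘(ℝ, ℝ) ∞ φ := by
  intro x
  have h1 : ContMDiffAt 𝓘(ℝ, EuclideanSpace ℝ (Fin n)) 𝓘(ℝ, ℝ) ∞
      (φ ∘ (extChartAt (𝓡 n) x).symm) (extChartAt (𝓡 n) x x) :=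
    ((h x).contDiffAt (chart_target_mem_nhds (mem_extChartAt_target x))).contMDiffAt
  refine (h1.comp x (contMDiffAt_extChartAt (I := 𝓡 n) (x := x))).congr_of_eventuallyEq ?_
  filter_upwards [extChartAt_source_mem_nhds (I := 𝓡 n) x] with y hy
  exact congrArg φ ((extChartAt (𝓡 n) x).left_inv hy).symm

theorem isSmoothFun_of_contMDiff [IsManifold (𝓡 n) ∞ M] {φ : M → ℝ}
    (h : ContMDiff (𝓡 n) 𝓘(ℝ, ℝ) ∞ φ) : IsSmoothFun n φ := fun x₀ ↦
  contMDiffOn_iff_contDiffOn.1 (h.comp_contMDiffOn (contMDiffOn_chart_symm x₀))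

variable [IsManifold (𝓡 n) ∞ M]

variable [RiemannianBundle (fun x : M ↦ TangentSpace (𝓡 n) x)]

/-- The divergence of a vector field. -/
def divergence (X : Π y : M, TangentSpace (𝓡 n) y) (x : M) : ℝ :=
  ∑ i, inner ℝ (nabla (frame x i) X) (frame x i)

variable [IsContMDiffRiemannianBundle (𝓡 n) ∞ (EuclideanSpace ℝ (Fin n))
      (fun x : M ↦ TangentSpace (𝓡 n) x)]

theorem divergence_chart {X : Π y : M, TangentSpace (𝓡 n) y} (hX : IsSmoothField X)
    {x₀ : M} {u : EuclideanSpace ℝ (Fin n)} (hu : u ∈ (extChartAt (𝓡 n) x₀).target) :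
    divergence X ((extChartAt (𝓡 n) x₀).symm u) =
      endTr _ (covD (chartΓ x₀) (chartRep x₀ X) u) := by
  rw [divergence, ← sum_inner_chart hu _ (frame _)]
  exact Finset.sum_congr rfl fun i _ ↦ by rw [nabla_chart hu (hX.differentiableAt hu)]

theorem isSmoothFun_divergence {X : Π y : M, TangentSpace (𝓡 n) y} (hX : IsSmoothField X) :
    IsSmoothFun n (divergence X) := fun x₀ ↦
  ((endTr (EuclideanSpace ℝ (Fin n))).contDiff.comp_contDiffOn (contDiffOn_covD
      (isOpen_extChartAt_target x₀)
    (contDiffOn_chartΓ x₀) (hX x₀))).congr fun _ hu ↦ divergence_chart hX hu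

theorem IsSmoothField.nabla {X Y : Π y : M, TangentSpace (𝓡 n) y} (hX : IsSmoothField X)
    (hY : IsSmoothField Y) : IsSmoothField fun y ↦ nabla (X y) Y := fun x₀ ↦
  ((contDiffOn_covD (isOpen_extChartAt_target x₀) (contDiffOn_chartΓ x₀) (hY x₀)).clm_apply
    (hX x₀)).congr fun _ hu ↦ chartRep_nabla hu (hY.differentiableAt hu) X

theorem divergence_smul {φ : M → ℝ} {X : Π y : M, TangentSpace (𝓡 n) y} (hφ : IsSmoothFun n φ)
    (hX : IsSmoothField X) (x : M) :
    divergence (fun y ↦ φ y • X y) x = φ x * divergence X x + mvfderiv (𝓡 n) φ x (X x) := by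
  obtain ⟨x₀, u, hu, rfl⟩ := exists_chart_point (n := n) x
  rw [divergence_chart (hX.smul hφ) hu, divergence_chart hX hu, chartRep_smul,
    endTr_covD_smul (hφ.differentiableAt hu) (hX.differentiableAt hu),
    ← mvfderiv_chartD hu (hφ.differentiableAt hu), chartD_chartRep hu]
  rfl

theorem divergence_add {X Y : Π y : M, TangentSpace (𝓡 n) y} (hX : IsSmoothField X)
    (hY : IsSmoothField Y) (x : M) :
    divergence (fun y ↦ X y + Y y) x = divergence X x + divergence Y x := by
  obtain ⟨x₀, u, hu, rfl⟩ := exists_chart_point (n := n) x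
  rw [divergence_chart (hX.add hY) hu, divergence_chart hX hu, divergence_chart hY hu, chartRep_add,
    covD_add (hX.differentiableAt hu) (hY.differentiableAt hu), map_add]

theorem divergence_sub {X Y : Π y : M, TangentSpace (𝓡 n) y} (hX : IsSmoothField X)
    (hY : IsSmoothField Y) (x : M) :
    divergence (fun y ↦ X y - Y y) x = divergence X x - divergence Y x := by
  obtain ⟨x₀, u, hu, rfl⟩ := exists_chart_point (n := n) x
  rw [divergence_chart (hX.sub hY) hu, divergence_chart hX hu, divergence_chart hY hu, chartRep_sub,
    covD_sub (hX.differentiableAt hu) (hY.differentiableAt hu), map_sub]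

theorem sum_divergence_smul {ι : Type*} {φ : ι → M → ℝ} {X : Π y : M, TangentSpace (𝓡 n) y}
    (hφ : ∀ i, IsSmoothFun n (φ i)) (hX : IsSmoothField X) (s : Finset ι) (x : M) :
    ∑ i ∈ s, divergence (fun y ↦ φ i y • X y) x =
      divergence (fun y ↦ (∑ i ∈ s, φ i y) • X y) x := by
  classical
  induction s using Finset.induction_on with
  | empty =>
    simp only [Finset.sum_empty]
    rw [divergence_smul (fun x₀ ↦ contDiffOn_const) hX]
    simp [mvfderiv_const]
  | insert i s hi ih =>
    simp only [Finset.sum_insert hi, add_smul]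
    rw [ih, divergence_add (hX.smul (hφ i)) (hX.smul (isSmoothFun_sum s hφ))]

theorem integral_divergence_of_tsupport_subset [MeasurableSpace M] [BorelSpace M] [T2Space M]
    [CompactSpace M] {X : Π y : M, TangentSpace (𝓡 n) y} (hX : IsSmoothField X) {x₀ : M} {K : Set M}
    (hK : IsClosed K) (hKs : K ⊆ (extChartAt (𝓡 n) x₀).source) (hXK : ∀ y ∉ K, X y = 0) :
    ∫ y, divergence X y ∂(riemannianVolume n M) = 0 := by
  set U := (extChartAt (𝓡 n) x₀).target with hU
  have hUo : IsOpen U := isOpen_extChartAt_target x₀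
  set C := extChartAt (𝓡 n) x₀ '' K with hC
  have hCc : IsCompact C := hK.isCompact.image_of_continuousOn ((continuousOn_extChartAt x₀).mono
      hKs)
  have hCU : C ⊆ U := by
    rintro _ ⟨y, hy, rfl⟩
    exact (extChartAt (𝓡 n) x₀).map_source (hKs hy)
  have hX0 : ∀ u ∈ U, u ∉ C → chartRep x₀ X u = 0 := by
    intro u hu huC
    have : (extChartAt (𝓡 n) x₀).symm u ∉ K := fun h ↦
      huC ⟨_, h, (extChartAt (𝓡 n) x₀).right_inv hu⟩
    rw [chartRep, hXK _ this, map_zero]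
  set Z : EuclideanSpace ℝ (Fin n) → EuclideanSpace ℝ (Fin n) :=
    U.indicator fun u ↦ chartDensity x₀ u • chartRep x₀ X u with hZ
  have hZ0 : ∀ u ∉ C, Z u = 0 := by
    intro u huC
    by_cases hu : u ∈ U
    · simp [hZ, hu, hX0 u hu huC]
    · simp [hZ, hu]
  have hZU : ∀ u ∈ U, Z =ᶠ[𝓝 u] fun u ↦ chartDensity x₀ u • chartRep x₀ X u := fun u hu ↦ by
    filter_upwards [hUo.mem_nhds hu] with w hw
    simp [hZ, hw]
  have hZs : ContDiff ℝ 1 Z := by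
    rw [contDiff_iff_contDiffAt]
    intro u
    by_cases hu : u ∈ U
    · have := ((contDiffOn_chartDensity x₀).smul (hX x₀)).contDiffAt (hUo.mem_nhds hu)
      exact (this.of_le (by norm_cast)).congr_of_eventuallyEq (hZU u hu)
    · have : Z =ᶠ[𝓝 u] fun _ ↦ 0 := by
        filter_upwards [hCc.isClosed.isOpen_compl.mem_nhds fun h ↦ hu (hCU h)] with w hw
        exact hZ0 w hw
      exact contDiffAt_const.congr_of_eventuallyEq this
  have hZc : HasCompactSupport Z := HasCompactSupport.intro hCc hZ0
  have hfd : ∀ u ∉ C, fderiv ℝ Z u = 0 := by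
    intro u hu
    have : Z =ᶠ[𝓝 u] fun _ ↦ 0 := by
      filter_upwards [hCc.isClosed.isOpen_compl.mem_nhds hu] with w hw
      exact hZ0 w hw
    rw [this.fderiv_eq, fderiv_const_apply]
  have hcoord : ∀ i u, fderiv ℝ (fun w ↦ Z w i) u (EuclideanSpace.single i 1) =
      fderiv ℝ Z u (EuclideanSpace.single i 1) i := by
    intro i u
    have : HasFDerivAt (fun w ↦ Z w i) _ u :=
      (EuclideanSpace.proj i : EuclideanSpace ℝ (Fin n) →L[ℝ] ℝ).hasFDerivAt.comp u
        (hZs.differentiable (by simp) u).hasFDerivAt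
    rw [this.fderiv]
    rfl
  have hdiv : ∀ u ∈ U, chartDensity x₀ u * divergence X ((extChartAt (𝓡 n) x₀).symm u) =
      ∑ i, fderiv ℝ (fun w ↦ Z w i) u (EuclideanSpace.single i 1) := by
    intro u hu
    rw [divergence_chart hX hu, chartDensity_mul_endTr_covD hu (hX.differentiableAt hu)]
    refine Finset.sum_congr rfl fun i _ ↦ ?_
    have : (fun w ↦ Z w i) =ᶠ[𝓝 u] fun w ↦ chartDensity x₀ w * chartRep x₀ X w i := by
      filter_upwards [hZU u hu] with w hw
      rw [hw]
      rfl
    rw [this.fderiv_eq]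
  have hoff : ∀ y ∉ (extChartAt (𝓡 n) x₀).source, divergence X y = 0 := by
    intro y hy
    have hyK : y ∉ K := fun h ↦ hy (hKs h)
    have hu := mem_extChartAt_target (I := 𝓡 n) y
    have h0 : chartRep y X =ᶠ[𝓝 (extChartAt (𝓡 n) y y)] fun _ ↦ 0 := by
      have h1 : ∀ᶠ z in 𝓝 ((extChartAt (𝓡 n) y).symm (extChartAt (𝓡 n) y y)), z ∉ K := by
        rw [extChartAt_to_inv]
        exact hK.isOpen_compl.mem_nhds hyK
      filter_upwards [(contMDiffAt_chart_symm hu).continuousAt.eventually h1] with w hw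
      rw [chartRep, hXK _ hw, map_zero]
    have h2 := divergence_chart hX hu
    rw [extChartAt_to_inv] at h2
    rw [h2, covD, h0.fderiv_eq, h0.self_of_nhds]
    simp
  rw [integral_riemannianVolume_of_support_subset (isSmoothFun_divergence hX).continuous hoff,
    setIntegral_congr_fun hUo.measurableSet hdiv, setIntegral_eq_integral_of_forall_compl_eq_zero,
    integral_sum_fderiv_eq_zero hZs hZc]
  intro u hu
  refine Finset.sum_eq_zero fun i _ ↦ ?_
  rw [hcoord, hfd u fun h ↦ hu (hCU h)]
  rfl

/-- The divergence theorem. -/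
theorem integral_divergence_eq_zero [MeasurableSpace M] [BorelSpace M] [T2Space M]
    [CompactSpace M] {X : Π y : M, TangentSpace (𝓡 n) y} (hX : IsSmoothField X) :
    ∫ y, divergence X y ∂(riemannianVolume n M) = 0 := by
  obtain ⟨t, -, ht⟩ := (isCompact_univ (X := M)).elim_nhds_subcover
    (fun x ↦ (extChartAt (𝓡 n) x).source) fun x _ ↦ extChartAt_source_mem_nhds x
  obtain ⟨ρ, hρ⟩ := SmoothPartitionOfUnity.exists_isSubordinate (𝓡 n) (isClosed_univ (X := M))
    (fun i : t ↦ (extChartAt (𝓡 n) (i : M)).source) (fun i ↦ isOpen_extChartAt_source _)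
    (fun x hx ↦ by
      obtain ⟨i, hi, hxi⟩ := Set.mem_iUnion₂.1 (ht hx)
      exact Set.mem_iUnion.2 ⟨⟨i, hi⟩, hxi⟩)
  have hρs : ∀ i, IsSmoothFun n (ρ i) := fun i ↦ isSmoothFun_of_contMDiff (ρ i).contMDiff
  have h1 : ∀ y, ∑ i, ρ i y = 1 := fun y ↦ by
    rw [← finsum_eq_sum_of_fintype]
    exact ρ.sum_eq_one (Set.mem_univ y)
  have h2 : ∀ y, divergence X y = ∑ i, divergence (fun z ↦ ρ i z • X z) y := by
    intro y
    rw [sum_divergence_smul hρs hX]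
    simp only [h1, one_smul]
  have h3 : ∀ i, IsSmoothField fun z ↦ ρ i z • X z := fun i ↦ hX.smul (hρs i)
  simp only [h2]
  rw [integral_finsetSum _ fun i _ ↦
    (isSmoothFun_divergence (h3 i)).continuous.integrable_of_hasCompactSupport
      (HasCompactSupport.of_compactSpace _)]
  refine Finset.sum_eq_zero fun i _ ↦ integral_divergence_of_tsupport_subset (h3 i)
    (isClosed_tsupport (ρ i)) (hρ i) fun y hy ↦ ?_
  rw [image_eq_zero_of_notMem_tsupport hy, zero_smul]

end Divergence

/-! ### The magnetic gradient -/

theorem metric_magnetic_sub_swap {E : Type*} [NormedAddCommGroup E] [NormedSpace ℝ E]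
    {g : E → E →L[ℝ] E →L[ℝ] ℝ} {α : E → E →L[ℝ] ℝ} {p q : E → ℝ} {P Q : E → E} {u : E}
    (hg : DifferentiableAt ℝ g u) (hs : ∀ᶠ w in 𝓝 u, ∀ a b, g w a b = g w b a)
    (h : (g u).IsInvertible) (hP : DifferentiableAt ℝ P u) (hα : DifferentiableAt ℝ α u)
    (hp : ContDiffAt ℝ 2 p u) (hq : DifferentiableAt ℝ q u)
    (hPp : ∀ᶠ w in 𝓝 u, g w (P w) = fderiv ℝ p w - q w • α w)
    (hQq : g u (Q u) = fderiv ℝ q u + p u • α u) (a b : E) :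
    g u ((covD (christoffel g) P u - (α u).smulRight (Q u)) a) b
      - g u ((covD (christoffel g) P u - (α u).smulRight (Q u)) b) a =
      -q u * (fderiv ℝ α u a b - fderiv ℝ α u b a) := by
  have h1 := metric_covD_sub_swap hg hs h hP hPp a b
  have hd : DifferentiableAt ℝ (fderiv ℝ p) u :=
    (hp.fderiv_right (m := 1) (by norm_num)).differentiableAt (by norm_num)
  have h2 : ∀ a b, fderiv ℝ (fun w ↦ fderiv ℝ p w - q w • α w) u a b =
      fderiv ℝ (fderiv ℝ p) u a b - (fderiv ℝ q u a * α u b + q u * fderiv ℝ α u a b) := by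
    intro a b
    rw [(hd.hasFDerivAt.fun_sub (hq.hasFDerivAt.fun_smul hα.hasFDerivAt)).fderiv]
    simp
    ring
  have h3 : fderiv ℝ (fderiv ℝ p) u a b = fderiv ℝ (fderiv ℝ p) u b a :=
    (hp.isSymmSndFDerivAt (by simp)) _ _
  rw [h2, h2, h3] at h1
  simp only [sub_apply, ContinuousLinearMap.smulRight_apply, map_sub, map_smul, smul_apply, hQq,
    add_apply, smul_eq_mul]
  linear_combination h1

section Forms

variable {n : ℕ} {M : Type*} [TopologicalSpace M] [ChartedSpace (EuclideanSpace ℝ (Fin n)) M]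

/-- An endomorphism of `ℝⁿ` transported to a tangent space by the chart at `x₀`. -/
def chartEnd (x₀ : M) (u : EuclideanSpace ℝ (Fin n))
    (A : EuclideanSpace ℝ (Fin n) →L[ℝ] EuclideanSpace ℝ (Fin n)) :
    TangentSpace (𝓡 n) ((extChartAt (𝓡 n) x₀).symm u) →ₗ[ℝ]
      TangentSpace (𝓡 n) ((extChartAt (𝓡 n) x₀).symm u) :=
  (chartD x₀ u).toLinearMap ∘ₗ A.toLinearMap ∘ₗ (chartD x₀ u).inverse.toLinearMap

theorem chartEnd_apply (x₀ : M) (u : EuclideanSpace ℝ (Fin n))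
    (A : EuclideanSpace ℝ (Fin n) →L[ℝ] EuclideanSpace ℝ (Fin n))
    (v : TangentSpace (𝓡 n) ((extChartAt (𝓡 n) x₀).symm u)) :
    chartEnd x₀ u A v = chartD x₀ u (A ((chartD x₀ u).inverse v)) := rfl

variable [IsManifold (𝓡 n) ∞ M]

theorem contDiffOn_comp_chart_symm {F : Type*} [NormedAddCommGroup F] [NormedSpace ℝ F] {f : M → F}
    (hf : ContMDiff (𝓡 n) 𝓘(ℝ, F) ∞ f) (x₀ : M) :
    ContDiffOn ℝ ∞ (f ∘ (extChartAt (𝓡 n) x₀).symm) (extChartAt (𝓡 n) x₀).target :=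
  contMDiffOn_iff_contDiffOn.1 (hf.comp_contMDiffOn (contMDiffOn_chart_symm x₀))

/-- A smooth real 1-form. -/
abbrev SmoothForm (α : Π x : M, TangentSpace (𝓡 n) x →L[ℝ] ℝ) : Prop :=
  ContMDiff (𝓡 n) ((𝓡 n).prod 𝓘(ℝ, EuclideanSpace ℝ (Fin n) →L[ℝ] ℝ)) ∞
      (fun x ↦ TotalSpace.mk' (EuclideanSpace ℝ (Fin n) →L[ℝ] ℝ)
        (E := fun x : M ↦ TangentSpace (𝓡 n) x →L[ℝ] ℝ) x (α x))

variable {α : Π y : M, TangentSpace (𝓡 n) y →L[ℝ] ℝ} {f : M → ℂ}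

theorem isSmoothFun_re (hf : ContMDiff (𝓡 n) 𝓘(ℝ, ℂ) ∞ f) : IsSmoothFun n fun y ↦ (f y).re :=
  fun x₀ ↦ Complex.reCLM.contDiff.comp_contDiffOn (contDiffOn_comp_chart_symm hf x₀)

theorem isSmoothFun_im (hf : ContMDiff (𝓡 n) 𝓘(ℝ, ℂ) ∞ f) : IsSmoothFun n fun y ↦ (f y).im :=
  fun x₀ ↦ Complex.imCLM.contDiff.comp_contDiffOn (contDiffOn_comp_chart_symm hf x₀)

theorem mvfderiv_re_im (hf : ContMDiff (𝓡 n) 𝓘(ℝ, ℂ) ∞ f) {x : M} (v : TangentSpace (𝓡 n) x) :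
    mvfderiv (𝓡 n) (fun y ↦ (f y).re) x v = (mvfderiv (𝓡 n) f x v).re ∧
    mvfderiv (𝓡 n) (fun y ↦ (f y).im) x v = (mvfderiv (𝓡 n) f x v).im := by
  obtain ⟨x₀, u, hu, rfl⟩ := exists_chart_point (n := n) x
  have hd : DifferentiableAt ℝ (f ∘ (extChartAt (𝓡 n) x₀).symm) u :=
    ((contDiffOn_comp_chart_symm hf x₀).contDiffAt (chart_target_mem_nhds hu)).differentiableAt
      (by simp)
  have h1 : HasFDerivAt ((fun y ↦ (f y).re) ∘ (extChartAt (𝓡 n) x₀).symm) _ u :=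
    Complex.reCLM.hasFDerivAt.comp u hd.hasFDerivAt
  have h2 : HasFDerivAt ((fun y ↦ (f y).im) ∘ (extChartAt (𝓡 n) x₀).symm) _ u :=
    Complex.imCLM.hasFDerivAt.comp u hd.hasFDerivAt
  rw [← chartD_inverse_apply hu v, mvfderiv_chartD hu hd, mvfderiv_chartD hu h1.differentiableAt,
    mvfderiv_chartD hu h2.differentiableAt, h1.fderiv, h2.fderiv]
  exact ⟨rfl, rfl⟩

theorem form_apply_chart {X : Π y : M, TangentSpace (𝓡 n) y} {x₀ : M}
    {u : EuclideanSpace ℝ (Fin n)} (hu : u ∈ (extChartAt (𝓡 n) x₀).target) :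
    α ((extChartAt (𝓡 n) x₀).symm u) (X ((extChartAt (𝓡 n) x₀).symm u)) =
      chartForm x₀ α u (chartRep x₀ X u) := by
  rw [chartForm, ContinuousLinearMap.comp_apply, chartD_chartRep hu]

theorem extDer_apply_chart (hα : SmoothForm α) (X Y : Π y : M, TangentSpace (𝓡 n) y) {x₀ : M}
    {u : EuclideanSpace ℝ (Fin n)} (hu : u ∈ (extChartAt (𝓡 n) x₀).target) :
    extDer α (X ((extChartAt (𝓡 n) x₀).symm u)) (Y ((extChartAt (𝓡 n) x₀).symm u)) =
      fderiv ℝ (chartForm x₀ α) u (chartRep x₀ X u) (chartRep x₀ Y u)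
        - fderiv ℝ (chartForm x₀ α) u (chartRep x₀ Y u) (chartRep x₀ X u) :=
  extDer_chart hu (((contDiffOn_chartForm hα x₀).contDiffAt
    (chart_target_mem_nhds hu)).differentiableAt (by simp)) _ _

theorem extDer_swap (hα : SmoothForm α) {x : M} (v w : TangentSpace (𝓡 n) x) :
    extDer α v w = -extDer α w v := by
  obtain ⟨x₀, u, hu, rfl⟩ := exists_chart_point (n := n) x
  have hd : DifferentiableAt ℝ (chartForm x₀ α) u := ((contDiffOn_chartForm hα x₀).contDiffAt
    (chart_target_mem_nhds hu)).differentiableAt (by simp)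
  rw [extDer_chart hu hd, extDer_chart hu hd]
  ring

set_option maxSynthPendingDepth 3 in
theorem extDer_neg_right (hα : SmoothForm α) {x : M} (v w : TangentSpace (𝓡 n) x) :
    extDer α v (-w) = -extDer α v w := by
  obtain ⟨x₀, u, hu, rfl⟩ := exists_chart_point (n := n) x
  have hd : DifferentiableAt ℝ (chartForm x₀ α) u := ((contDiffOn_chartForm hα x₀).contDiffAt
    (chart_target_mem_nhds hu)).differentiableAt (by simp)
  have h : (chartD x₀ u).inverse (-w) = -(chartD x₀ u).inverse w := map_neg _ _
  rw [extDer_chart hu hd, extDer_chart hu hd, h, map_neg, map_neg, neg_apply]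
  ring

theorem isSmoothFun_form_apply (hα : SmoothForm α) {X : Π y : M, TangentSpace (𝓡 n) y}
    (hX : IsSmoothField X) : IsSmoothFun n fun y ↦ α y (X y) := fun x₀ ↦
  ((contDiffOn_chartForm hα x₀).clm_apply (hX x₀)).congr fun _ hu ↦ form_apply_chart hu

theorem continuous_extDer_apply (hα : SmoothForm α) {X Y : Π y : M, TangentSpace (𝓡 n) y}
    (hX : IsSmoothField X) (hY : IsSmoothField Y) : Continuous fun y ↦ extDer α (X y) (Y y) := by
  refine continuous_of_chart (n := n) fun x₀ ↦ ?_
  have h1 : ContDiffOn ℝ ∞ (fderiv ℝ (chartForm x₀ α)) (extChartAt (𝓡 n) x₀).target :=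
    (contDiffOn_chartForm hα x₀).fderiv_of_isOpen (isOpen_extChartAt_target x₀) (by simp)
  exact ((((h1.clm_apply (hX x₀)).clm_apply (hY x₀)).sub
    ((h1.clm_apply (hY x₀)).clm_apply (hX x₀))).continuousOn).congr
      fun u hu ↦ extDer_apply_chart hα X Y hu

end Forms

section Magnetic

variable {n : ℕ} {M : Type*} [TopologicalSpace M] [ChartedSpace (EuclideanSpace ℝ (Fin n)) M]
  [RiemannianBundle (fun x : M ↦ TangentSpace (𝓡 n) x)]

theorem inner_sharp {x : M} (a : TangentSpace (𝓡 n) x →L[ℝ] ℝ) (v : TangentSpace (𝓡 n) x) :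
    inner ℝ (sharp a) v = a v := by
  rw [sharp, sum_inner]
  conv_rhs => rw [← (frame x).sum_repr' v]
  simp only [real_inner_smul_left, map_sum, map_smul, smul_eq_mul]
  exact Finset.sum_congr rfl fun i _ ↦ mul_comm _ _

theorem magD_eq (α : Π y : M, TangentSpace (𝓡 n) y →L[ℝ] ℝ) (f : M → ℂ) {x : M}
    (v : TangentSpace (𝓡 n) x) : magD α f x v =
      (inner ℝ (magGrad α f x).re v : ℂ) + Complex.I * (inner ℝ (magGrad α f x).im v : ℂ) := by
  simp only [magGrad, sharpC, inner_sharp]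
  apply Complex.ext <;> simp

theorem hermForm_magD (w : Π y : M, TangentSpace (𝓡 n) y →L[ℝ] ℂ)
    (α : Π y : M, TangentSpace (𝓡 n) y →L[ℝ] ℝ) (f : M → ℂ) (x : M) :
    hermForm (w x) (magD α f x) =
      w x (magGrad α f x).re - Complex.I * w x (magGrad α f x).im := by
  have h1 : ∀ v : TangentSpace (𝓡 n) x,
      w x v = ∑ i, (inner ℝ (frame x i) v : ℂ) * w x (frame x i) := by
    intro v
    conv_lhs => rw [← (frame x).sum_repr' v]
    simp
  rw [h1 (magGrad α f x).re, h1 (magGrad α f x).im, hermForm, Finset.mul_sum,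
    ← Finset.sum_sub_distrib]
  refine Finset.sum_congr rfl fun i _ ↦ ?_
  rw [magD_eq, real_inner_comm, real_inner_comm (frame x i)]
  simp
  ring

theorem herm_re {V : Type*} [NormedAddCommGroup V] [InnerProductSpace ℝ V] (Z W : Cx V) :
    (herm Z W).re = inner ℝ Z.re W.re + inner ℝ Z.im W.im := by
  simp [herm, Cx.sesqExt, Cx.bilinExt, Cx.conj]

theorem norm_herm_ofReal_sq {V : Type*} [NormedAddCommGroup V] [InnerProductSpace ℝ V] (Z : Cx V)
    (v : V) : ‖herm Z (Cx.ofReal v)‖ ^ 2 = inner ℝ Z.re v ^ 2 + inner ℝ Z.im v ^ 2 := by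
  rw [← Complex.normSq_eq_norm_sq]
  simp [herm, Cx.sesqExt, Cx.bilinExt, Cx.conj, Cx.ofReal, Complex.normSq_apply]
  ring

theorem herm_magGrad_re (α : Π y : M, TangentSpace (𝓡 n) y →L[ℝ] ℝ) (h f : M → ℂ) (x : M) :
    (herm (magGrad α h x) (magGrad α f x)).re = (hermForm (magD α h x) (magD α f x)).re := by
  rw [herm_re, hermForm_magD, magD_eq, magD_eq]
  simp

variable [IsManifold (𝓡 n) ∞ M]

variable {α : Π y : M, TangentSpace (𝓡 n) y →L[ℝ] ℝ} {f : M → ℂ}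

theorem inner_magGrad_re (hf : ContMDiff (𝓡 n) 𝓘(ℝ, ℂ) ∞ f) {x : M} (v : TangentSpace (𝓡 n) x) :
    inner ℝ (magGrad α f x).re v =
      mvfderiv (𝓡 n) (fun y ↦ (f y).re) x v - (f x).im * α x v := by
  rw [(mvfderiv_re_im hf v).1]
  simp [magGrad, sharpC, inner_sharp, magD]
  ring

theorem inner_magGrad_im (hf : ContMDiff (𝓡 n) 𝓘(ℝ, ℂ) ∞ f) {x : M} (v : TangentSpace (𝓡 n) x) :
    inner ℝ (magGrad α f x).im v =
      mvfderiv (𝓡 n) (fun y ↦ (f y).im) x v + (f x).re * α x v := by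
  rw [(mvfderiv_re_im hf v).2]
  simp [magGrad, sharpC, inner_sharp, magD]

theorem chartMetric_chartRep_magGrad (hf : ContMDiff (𝓡 n) 𝓘(ℝ, ℂ) ∞ f) {x₀ : M}
    {u : EuclideanSpace ℝ (Fin n)} (hu : u ∈ (extChartAt (𝓡 n) x₀).target) :
    chartMetric x₀ u (chartRep x₀ (fun y ↦ (magGrad α f y).re) u) =
      fderiv ℝ ((fun y ↦ (f y).re) ∘ (extChartAt (𝓡 n) x₀).symm) u
        - ((fun y ↦ (f y).im) ∘ (extChartAt (𝓡 n) x₀).symm) u • chartForm x₀ α u ∧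
    chartMetric x₀ u (chartRep x₀ (fun y ↦ (magGrad α f y).im) u) =
      fderiv ℝ ((fun y ↦ (f y).im) ∘ (extChartAt (𝓡 n) x₀).symm) u
        + ((fun y ↦ (f y).re) ∘ (extChartAt (𝓡 n) x₀).symm) u • chartForm x₀ α u := by
  constructor <;> ext a <;> rw [chartMetric_apply, chartD_chartRep hu]
  · rw [inner_magGrad_re hf, mvfderiv_chartD hu ((isSmoothFun_re hf).differentiableAt hu)]
    rfl
  · rw [inner_magGrad_im hf, mvfderiv_chartD hu ((isSmoothFun_im hf).differentiableAt hu)]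
    rfl

theorem metric_inverse_apply_self {E : Type*} [NormedAddCommGroup E] [NormedSpace ℝ E]
    {g : E →L[ℝ] E →L[ℝ] ℝ} (h : g.IsInvertible) (v : E) : g.inverse (g v) = v := by
  obtain ⟨e, rfl⟩ := h
  simp

theorem inner_chartEnd {x₀ : M} {u : EuclideanSpace ℝ (Fin n)}
    (hu : u ∈ (extChartAt (𝓡 n) x₀).target)
    (A : EuclideanSpace ℝ (Fin n) →L[ℝ] EuclideanSpace ℝ (Fin n))
    (v w : TangentSpace (𝓡 n) ((extChartAt (𝓡 n) x₀).symm u)) :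
    inner ℝ (chartEnd x₀ u A v) w =
      chartMetric x₀ u (A ((chartD x₀ u).inverse v)) ((chartD x₀ u).inverse w) :=
  (chartMetric_inverse_apply hu _ _).symm

theorem trace_chartEnd_comp_self {x₀ : M} {u : EuclideanSpace ℝ (Fin n)}
    (hu : u ∈ (extChartAt (𝓡 n) x₀).target)
    (A : EuclideanSpace ℝ (Fin n) →L[ℝ] EuclideanSpace ℝ (Fin n)) :
    LinearMap.trace ℝ _ (chartEnd x₀ u A ∘ₗ chartEnd x₀ u A) = endTr _ (A.comp A) := by
  rw [LinearMap.trace_eq_sum_inner _ (frame _), ← sum_inner_chart hu _ (frame _)]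
  refine Finset.sum_congr rfl fun i _ ↦ ?_
  rw [real_inner_comm, LinearMap.comp_apply, chartEnd_apply, chartEnd_apply,
    inverse_chartD_apply hu]
  rfl

variable [IsContMDiffRiemannianBundle (𝓡 n) ∞ (EuclideanSpace ℝ (Fin n))
      (fun x : M ↦ TangentSpace (𝓡 n) x)]

theorem isSmoothField_magGrad_re (hα : SmoothForm α) (hf : ContMDiff (𝓡 n) 𝓘(ℝ, ℂ) ∞ f) :
    IsSmoothField fun y ↦ (magGrad α f y).re := fun x₀ ↦ by
  have h1 : ContDiffOn ℝ ∞ (fderiv ℝ ((fun y ↦ (f y).re) ∘ (extChartAt (𝓡 n) x₀).symm))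
      (extChartAt (𝓡 n) x₀).target :=
    (isSmoothFun_re hf x₀).fderiv_of_isOpen (isOpen_extChartAt_target x₀) (by simp)
  refine ((contDiffOn_metric_inverse (contDiffOn_chartMetric x₀)
    fun _ hu ↦ chartMetric_isInvertible hu).clm_apply
      (h1.sub ((isSmoothFun_im hf x₀).smul (contDiffOn_chartForm hα x₀)))).congr fun u hu ↦ ?_
  rw [← metric_inverse_apply_self (chartMetric_isInvertible hu) (chartRep x₀ _ u),
    (chartMetric_chartRep_magGrad hf hu).1]
  rfl

theorem isSmoothField_magGrad_im (hα : SmoothForm α) (hf : ContMDiff (𝓡 n) 𝓘(ℝ, ℂ) ∞ f) :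
    IsSmoothField fun y ↦ (magGrad α f y).im := fun x₀ ↦ by
  have h1 : ContDiffOn ℝ ∞ (fderiv ℝ ((fun y ↦ (f y).im) ∘ (extChartAt (𝓡 n) x₀).symm))
      (extChartAt (𝓡 n) x₀).target :=
    (isSmoothFun_im hf x₀).fderiv_of_isOpen (isOpen_extChartAt_target x₀) (by simp)
  refine ((contDiffOn_metric_inverse (contDiffOn_chartMetric x₀)
    fun _ hu ↦ chartMetric_isInvertible hu).clm_apply
      (h1.add ((isSmoothFun_re hf x₀).smul (contDiffOn_chartForm hα x₀)))).congr fun u hu ↦ ?_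
  rw [← metric_inverse_apply_self (chartMetric_isInvertible hu) (chartRep x₀ _ u),
    (chartMetric_chartRep_magGrad hf hu).2]
  rfl

theorem continuous_inner_of_isSmoothField {X Y : Π y : M, TangentSpace (𝓡 n) y}
    (hX : IsSmoothField X) (hY : IsSmoothField Y) : Continuous fun y ↦ inner ℝ (X y) (Y y) :=
  continuous_of_chart (n := n) fun x₀ ↦
    ((((contDiffOn_chartMetric x₀).clm_apply (hX x₀)).clm_apply (hY x₀)).continuousOn).congr
      fun _ hu ↦ inner_eq_chartMetric hu X Y

set_option maxSynthPendingDepth 3 in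
theorem ricci_neg_right {x : M} (v w : TangentSpace (𝓡 n) x) : ricci v (-w) = -ricci v w := by
  obtain ⟨x₀, u, hu, rfl⟩ := exists_chart_point (n := n) x
  have h : ∀ b c, curvEnd (chartΓ x₀) u b (-c) = -curvEnd (chartΓ x₀) u b c := by
    intro b c
    ext1 a
    simp only [curvEnd_apply, map_neg, neg_apply]
    abel
  rw [ricci_chart hu, ricci_chart hu, map_neg, h, map_neg]

set_option maxSynthPendingDepth 3 in
theorem continuous_extDerNormSq (hα : SmoothForm α) : Continuous (extDerNormSq α) := by
  refine continuous_of_chart (n := n) fun x₀ ↦ ?_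
  have h1 : ContDiffOn ℝ ∞ (fderiv ℝ (chartForm x₀ α)) (extChartAt (𝓡 n) x₀).target :=
    (contDiffOn_chartForm hα x₀).fderiv_of_isOpen (isOpen_extChartAt_target x₀) (by simp)
  have h2 : ContDiffOn ℝ ∞ (fun u ↦ (fderiv ℝ (chartForm x₀ α) u).flip)
      (extChartAt (𝓡 n) x₀).target :=
    (ContinuousLinearMap.flipₗᵢ ℝ (EuclideanSpace ℝ (Fin n))
      (EuclideanSpace ℝ (Fin n)) ℝ).toContinuousLinearEquiv.contDiff.comp_contDiffOn h1
  set F : EuclideanSpace ℝ (Fin n) → EuclideanSpace ℝ (Fin n) →L[ℝ] EuclideanSpace ℝ (Fin n) :=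
    fun u ↦ (chartMetric x₀ u).inverse.comp
      (fderiv ℝ (chartForm x₀ α) u - (fderiv ℝ (chartForm x₀ α) u).flip) with hF
  have h3 : ContDiffOn ℝ ∞ F (extChartAt (𝓡 n) x₀).target :=
    (contDiffOn_metric_inverse (contDiffOn_chartMetric x₀)
      fun _ hu ↦ chartMetric_isInvertible hu).clm_comp (h1.sub h2)
  have h4 : ContDiffOn ℝ ∞ (fun u ↦ (-1 / 2 : ℝ) • endTr _ ((F u).comp (F u)))
      (extChartAt (𝓡 n) x₀).target :=
    ((endTr _).contDiff.comp_contDiffOn (h3.clm_comp h3)).const_smul _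
  refine h4.continuousOn.congr fun u hu ↦ ?_
  have h5 : ∀ v w, inner ℝ (chartEnd x₀ u (F u) v) w = extDer α v w := by
    intro v w
    rw [inner_chartEnd hu, hF, ContinuousLinearMap.comp_apply,
      metric_inverse_apply (chartMetric_isInvertible hu), extDer_chart hu (((contDiffOn_chartForm hα
        x₀).contDiffAt (chart_target_mem_nhds hu)).differentiableAt (by simp))]
    rfl
  have h6 := trace_sq_eq (frame _) (chartEnd x₀ u (F u)) (fun v w ↦ extDer α v w) 2
    (fun i j ↦ by rw [h5, h5, extDer_swap hα (frame _ j)]; ring)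
    (fun i j ↦ extDer_swap hα _ _)
  rw [trace_chartEnd_comp_self hu] at h6
  simp only [h5] at h6
  rw [sum_sum_eq_two_mul_sum_Ioi _ (fun i j ↦ by rw [extDer_swap hα, neg_sq])
    (fun i ↦ by have := extDer_swap hα (frame _ i) (frame _ i); nlinarith)] at h6
  beta_reduce
  rw [h6, Function.comp_apply, extDerNormSq, smul_eq_mul]
  ring

end Magnetic

/-! ### The magnetic Bochner formula -/

section Bochner

variable {n : ℕ} {M : Type*} [TopologicalSpace M] [ChartedSpace (EuclideanSpace ℝ (Fin n)) M]
  [IsManifold (𝓡 n) ∞ M] [RiemannianBundle (fun x : M ↦ TangentSpace (𝓡 n) x)]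

variable (α : Π y : M, TangentSpace (𝓡 n) y →L[ℝ] ℝ) (f : M → ℂ)

/-- The real part of the magnetic Hessian in the chart at `x₀`, as an endomorphism. -/
def chartHessRe (x₀ : M) (u : EuclideanSpace ℝ (Fin n)) :
    EuclideanSpace ℝ (Fin n) →L[ℝ] EuclideanSpace ℝ (Fin n) :=
  covD (chartΓ x₀) (chartRep x₀ fun y ↦ (magGrad α f y).re) u
    - (chartForm x₀ α u).smulRight (chartRep x₀ (fun y ↦ (magGrad α f y).im) u)

/-- The imaginary part of the magnetic Hessian in the chart at `x₀`, as an endomorphism. -/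
def chartHessIm (x₀ : M) (u : EuclideanSpace ℝ (Fin n)) :
    EuclideanSpace ℝ (Fin n) →L[ℝ] EuclideanSpace ℝ (Fin n) :=
  covD (chartΓ x₀) (chartRep x₀ fun y ↦ (magGrad α f y).im) u
    + (chartForm x₀ α u).smulRight (chartRep x₀ (fun y ↦ (magGrad α f y).re) u)

/-- The real part of `-Δ^α f`. -/
def magDivRe (y : M) : ℝ :=
  divergence (fun z ↦ (magGrad α f z).re) y - α y (magGrad α f y).im

/-- The imaginary part of `-Δ^α f`. -/
def magDivIm (y : M) : ℝ :=
  divergence (fun z ↦ (magGrad α f z).im) y + α y (magGrad α f y).re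

/-- The real part of `∇^α_Z (grad^α f) - (div^α grad^α f) Z` for `Z` the complex conjugate of
`grad^α f`. -/
def bochnerField (y : M) : TangentSpace (𝓡 n) y :=
  (nabla (magGrad α f y).re (fun z ↦ (magGrad α f z).re)
      - α y (magGrad α f y).re • (magGrad α f y).im
    + (nabla (magGrad α f y).im (fun z ↦ (magGrad α f z).im)
      + α y (magGrad α f y).im • (magGrad α f y).re))
  - (magDivRe α f y • (magGrad α f y).re + magDivIm α f y • (magGrad α f y).im)

variable [IsContMDiffRiemannianBundle (𝓡 n) ∞ (EuclideanSpace ℝ (Fin n))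
      (fun x : M ↦ TangentSpace (𝓡 n) x)]

variable {α f}

theorem magNabla_ofReal_chart (hα : SmoothForm α) (hf : ContMDiff (𝓡 n) 𝓘(ℝ, ℂ) ∞ f) {x₀ : M}
    {u : EuclideanSpace ℝ (Fin n)} (hu : u ∈ (extChartAt (𝓡 n) x₀).target)
    (v : TangentSpace (𝓡 n) ((extChartAt (𝓡 n) x₀).symm u)) :
    (magNabla α (Cx.ofReal v) (magGrad α f)).re = chartEnd x₀ u (chartHessRe α f x₀ u) v ∧
    (magNabla α (Cx.ofReal v) (magGrad α f)).im = chartEnd x₀ u (chartHessIm α f x₀ u) v := by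
  have hP := (isSmoothField_magGrad_re hα hf).differentiableAt hu
  have hQ := (isSmoothField_magGrad_im hα hf).differentiableAt hu
  have h0 : ∀ {Y : Π y : M, TangentSpace (𝓡 n) y}, DifferentiableAt ℝ (chartRep x₀ Y) u →
      nabla (0 : TangentSpace (𝓡 n) ((extChartAt (𝓡 n) x₀).symm u)) Y = 0 := by
    intro Y hY
    rw [nabla_chart hu hY, map_zero, map_zero, map_zero]
  have hf1 : chartForm x₀ α u ((chartD x₀ u).inverse v) = α _ v := by
    rw [chartForm, ContinuousLinearMap.comp_apply, chartD_inverse_apply hu]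
  have hI : (Complex.I * Cx.linExt (fun w ↦ α ((extChartAt (𝓡 n) x₀).symm u) w)
      (Cx.ofReal v)).re = 0 ∧ (Complex.I * Cx.linExt (fun w ↦ α ((extChartAt (𝓡 n) x₀).symm u) w)
      (Cx.ofReal v)).im = α _ v := by
    rw [Cx.linExt, Cx.ofReal, map_zero]
    simp only [Complex.ofReal_zero, mul_zero, add_zero, Complex.mul_re, Complex.mul_im,
      Complex.I_re, Complex.I_im, Complex.ofReal_re, Complex.ofReal_im, zero_mul, one_mul,
      sub_zero, zero_add, and_self]
  constructor
  · change (nabla v _ - nabla 0 _) + ((Complex.I * Cx.linExt _ (Cx.ofReal v)).re • _ -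
      (Complex.I * Cx.linExt _ (Cx.ofReal v)).im • _) = _
    rw [h0 hQ, nabla_chart hu hP, chartEnd_apply, chartHessRe, sub_apply, map_sub,
      ContinuousLinearMap.smulRight_apply, map_smul, chartD_chartRep hu, hf1,
      hI.1, hI.2, zero_smul, zero_sub, sub_zero, sub_eq_add_neg]
  · change (nabla v _ + nabla 0 _) + ((Complex.I * Cx.linExt _ (Cx.ofReal v)).re • _ +
      (Complex.I * Cx.linExt _ (Cx.ofReal v)).im • _) = _
    rw [h0 hP, nabla_chart hu hQ, chartEnd_apply, chartHessIm, add_apply, map_add,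
      ContinuousLinearMap.smulRight_apply, map_smul, chartD_chartRep hu, hf1,
      hI.1, hI.2, zero_smul, zero_add, add_zero]

theorem chartHess_sub_swap (hα : SmoothForm α) (hf : ContMDiff (𝓡 n) 𝓘(ℝ, ℂ) ∞ f) {x₀ : M}
    {u : EuclideanSpace ℝ (Fin n)} (hu : u ∈ (extChartAt (𝓡 n) x₀).target)
    (v w : TangentSpace (𝓡 n) ((extChartAt (𝓡 n) x₀).symm u)) :
    inner ℝ (chartEnd x₀ u (chartHessRe α f x₀ u) v) w
      - inner ℝ (chartEnd x₀ u (chartHessRe α f x₀ u) w) v =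
      -(f ((extChartAt (𝓡 n) x₀).symm u)).im * extDer α v w ∧
    inner ℝ (chartEnd x₀ u (chartHessIm α f x₀ u) v) w
      - inner ℝ (chartEnd x₀ u (chartHessIm α f x₀ u) w) v =
      (f ((extChartAt (𝓡 n) x₀).symm u)).re * extDer α v w := by
  have hU := chart_target_mem_nhds hu
  have hP := isSmoothField_magGrad_re hα hf
  have hQ := isSmoothField_magGrad_im hα hf
  have hp := isSmoothFun_re (n := n) hf
  have hq := isSmoothFun_im (n := n) hf
  have ha := ((contDiffOn_chartForm hα x₀).contDiffAt hU).differentiableAt (by simp)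
  have hs : ∀ᶠ w in 𝓝 u, ∀ a b, chartMetric x₀ w a b = chartMetric x₀ w b a :=
    .of_forall fun w ↦ chartMetric_symm x₀ w
  simp only [inner_chartEnd hu, extDer_chart hu ha]
  refine ⟨metric_magnetic_sub_swap (differentiableAt_chartMetric hu) hs
    (chartMetric_isInvertible hu) (hP.differentiableAt hu) ha
    (((hp x₀).contDiffAt hU).of_le (by norm_cast)) (hq.differentiableAt hu) ?_
    (chartMetric_chartRep_magGrad hf hu).2 _ _, ?_⟩
  · filter_upwards [hU] with w hw using (chartMetric_chartRep_magGrad hf hw).1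
  · have h := metric_magnetic_sub_swap (α := chartForm x₀ α)
      (Q := fun w ↦ -chartRep x₀ (fun y ↦ (magGrad α f y).re) w)
      (q := fun w ↦ -((fun y ↦ (f y).re) ∘ (extChartAt (𝓡 n) x₀).symm) w)
      (differentiableAt_chartMetric hu) hs
      (chartMetric_isInvertible hu) (hQ.differentiableAt hu) ha
      (((hq x₀).contDiffAt hU).of_le (by norm_cast)) (hp.differentiableAt hu).fun_neg ?_ ?_
      ((chartD x₀ u).inverse v) ((chartD x₀ u).inverse w)
    · rw [neg_neg] at h
      rw [← Function.comp_apply (f := fun y ↦ (f y).re), ← h]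
      have : ∀ L : EuclideanSpace ℝ (Fin n) →L[ℝ] ℝ, ∀ z : EuclideanSpace ℝ (Fin n),
          L.smulRight (-z) = -L.smulRight z := by
        intro L z
        ext1 a
        simp
      simp only [this, sub_neg_eq_add, chartHessIm]
    · filter_upwards [hU] with w hw
      rw [(chartMetric_chartRep_magGrad hf hw).2]
      module
    · rw [map_neg, (chartMetric_chartRep_magGrad hf hu).1, fderiv_fun_neg]
      abel

theorem magHessNormSq_chart (hα : SmoothForm α) (hf : ContMDiff (𝓡 n) 𝓘(ℝ, ℂ) ∞ f) {x₀ : M}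
    {u : EuclideanSpace ℝ (Fin n)} (hu : u ∈ (extChartAt (𝓡 n) x₀).target) :
    magHessNormSq α f ((extChartAt (𝓡 n) x₀).symm u) =
      endTr _ ((chartHessRe α f x₀ u).comp (chartHessRe α f x₀ u))
        + endTr _ ((chartHessIm α f x₀ u).comp (chartHessIm α f x₀ u))
        + ‖f ((extChartAt (𝓡 n) x₀).symm u)‖ ^ 2
          * extDerNormSq α ((extChartAt (𝓡 n) x₀).symm u) := by
  have h1 := trace_sq_eq (frame ((extChartAt (𝓡 n) x₀).symm u))
    (chartEnd x₀ u (chartHessRe α f x₀ u)) (fun v w ↦ extDer α v w) _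
    (fun i j ↦ (chartHess_sub_swap hα hf hu _ _).1) (fun i j ↦ extDer_swap hα _ _)
  have h2 := trace_sq_eq (frame ((extChartAt (𝓡 n) x₀).symm u))
    (chartEnd x₀ u (chartHessIm α f x₀ u)) (fun v w ↦ extDer α v w) _
    (fun i j ↦ (chartHess_sub_swap hα hf hu _ _).2) (fun i j ↦ extDer_swap hα _ _)
  rw [trace_chartEnd_comp_self hu] at h1 h2
  rw [h1, h2, magHessNormSq, extDerNormSq, ← Complex.normSq_eq_norm_sq, Complex.normSq_apply]
  simp only [magHess, norm_herm_ofReal_sq, (magNabla_ofReal_chart hα hf hu _).1,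
    (magNabla_ofReal_chart hα hf hu _).2, Finset.sum_add_distrib]
  ring

theorem magDiv_chart (hα : SmoothForm α) (hf : ContMDiff (𝓡 n) 𝓘(ℝ, ℂ) ∞ f) {x₀ : M}
    {u : EuclideanSpace ℝ (Fin n)} (hu : u ∈ (extChartAt (𝓡 n) x₀).target) :
    magDivRe α f ((extChartAt (𝓡 n) x₀).symm u) = endTr _ (chartHessRe α f x₀ u) ∧
    magDivIm α f ((extChartAt (𝓡 n) x₀).symm u) = endTr _ (chartHessIm α f x₀ u) := by
  constructor
  · rw [magDivRe, divergence_chart (isSmoothField_magGrad_re hα hf) hu, chartHessRe, map_sub,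
      endTr_smulRight, ← form_apply_chart hu]
  · rw [magDivIm, divergence_chart (isSmoothField_magGrad_im hα hf) hu, chartHessIm, map_add,
      endTr_smulRight, ← form_apply_chart hu]

theorem isSmoothFun_magDivRe (hα : SmoothForm α) (hf : ContMDiff (𝓡 n) 𝓘(ℝ, ℂ) ∞ f) :
    IsSmoothFun n (magDivRe α f) :=
  (isSmoothFun_divergence (isSmoothField_magGrad_re hα hf)).sub
    (isSmoothFun_form_apply hα (isSmoothField_magGrad_im hα hf))

theorem isSmoothFun_magDivIm (hα : SmoothForm α) (hf : ContMDiff (𝓡 n) 𝓘(ℝ, ℂ) ∞ f) :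
    IsSmoothFun n (magDivIm α f) :=
  (isSmoothFun_divergence (isSmoothField_magGrad_im hα hf)).add
    (isSmoothFun_form_apply hα (isSmoothField_magGrad_re hα hf))

theorem isSmoothField_bochnerField (hα : SmoothForm α) (hf : ContMDiff (𝓡 n) 𝓘(ℝ, ℂ) ∞ f) :
    IsSmoothField (bochnerField α f) := by
  have hP := isSmoothField_magGrad_re hα hf
  have hQ := isSmoothField_magGrad_im hα hf
  exact (((hP.nabla hP).sub (hQ.smul (isSmoothFun_form_apply hα hP))).add
    ((hQ.nabla hQ).add (hP.smul (isSmoothFun_form_apply hα hQ)))).sub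
    ((hP.smul (isSmoothFun_magDivRe hα hf)).add (hQ.smul (isSmoothFun_magDivIm hα hf)))

theorem chartRep_bochnerField (hα : SmoothForm α) (hf : ContMDiff (𝓡 n) 𝓘(ℝ, ℂ) ∞ f) {x₀ : M}
    {u : EuclideanSpace ℝ (Fin n)} (hu : u ∈ (extChartAt (𝓡 n) x₀).target) :
    chartRep x₀ (bochnerField α f) u =
      chartHessRe α f x₀ u (chartRep x₀ (fun y ↦ (magGrad α f y).re) u)
        + chartHessIm α f x₀ u (chartRep x₀ (fun y ↦ (magGrad α f y).im) u)
        - (endTr _ (chartHessRe α f x₀ u) • chartRep x₀ (fun y ↦ (magGrad α f y).re) u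
          + endTr _ (chartHessIm α f x₀ u) • chartRep x₀ (fun y ↦ (magGrad α f y).im) u) := by
  have hP := (isSmoothField_magGrad_re hα hf).differentiableAt hu
  have hQ := (isSmoothField_magGrad_im hα hf).differentiableAt hu
  rw [← (magDiv_chart hα hf hu).1, ← (magDiv_chart hα hf hu).2]
  simp only [chartHessRe, chartHessIm, sub_apply, add_apply, ContinuousLinearMap.smulRight_apply, ←
      chartRep_nabla hu hP,
    ← chartRep_nabla hu hQ, ← form_apply_chart hu]
  simp only [chartRep, ← map_smul, ← map_add, ← map_sub]
  rfl

/-- The magnetic Bochner formula in divergence form. -/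
theorem divergence_bochnerField (hα : SmoothForm α) (hf : ContMDiff (𝓡 n) 𝓘(ℝ, ℂ) ∞ f) (x : M) :
    divergence (bochnerField α f) x =
      ricci (magGrad α f x).re (magGrad α f x).re + ricci (magGrad α f x).im (magGrad α f x).im
        + magHessNormSq α f x - ‖f x‖ ^ 2 * extDerNormSq α x
        - (magDivRe α f x ^ 2 + magDivIm α f x ^ 2)
        + 2 * extDer α (magGrad α f x).re (magGrad α f x).im := by
  obtain ⟨x₀, u, hu, rfl⟩ := exists_chart_point (n := n) x
  have hU := chart_target_mem_nhds hu
  have h1 := Filter.eventually_of_mem hU fun w hw ↦ chartRep_bochnerField hα hf (x₀ := x₀) hw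
  have h2 := endTr_covD_magnetic (((contDiffOn_chartΓ x₀).contDiffAt hU).of_le (by norm_cast))
    (chartΓ_symm hu) (((contDiffOn_chartForm hα x₀).contDiffAt hU).of_le (by norm_cast))
    ((((isSmoothField_magGrad_re hα hf) x₀).contDiffAt hU).of_le (by norm_cast))
    ((((isSmoothField_magGrad_im hα hf) x₀).contDiffAt hU).of_le (by norm_cast))
    (A := chartHessRe α f x₀) (B := chartHessIm α f x₀) rfl rfl
  rw [divergence_chart (isSmoothField_bochnerField hα hf) hu, covD, Filter.EventuallyEq.fderiv_eq
      h1,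
    h1.self_of_nhds]
  refine h2.trans ?_
  rw [ricci_chart hu, ricci_chart hu, magHessNormSq_chart hα hf hu, (magDiv_chart hα hf hu).1,
    (magDiv_chart hα hf hu).2, extDer_apply_chart hα (fun y ↦ (magGrad α f y).re)
      (fun y ↦ (magGrad α f y).im) hu]
  simp only [chartRep]
  ring

end Bochner

/-! ### Integration of the magnetic Bochner formula -/

section Integration

variable {n : ℕ} {M : Type*} [TopologicalSpace M] [ChartedSpace (EuclideanSpace ℝ (Fin n)) M]
  [IsManifold (𝓡 n) ∞ M] [RiemannianBundle (fun x : M ↦ TangentSpace (𝓡 n) x)]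

variable {α : Π y : M, TangentSpace (𝓡 n) y →L[ℝ] ℝ} {f : M → ℂ}

theorem bilinExt_extDer_magGrad (hα : SmoothForm α) (f : M → ℂ) (x : M) :
    (Complex.I * Cx.bilinExt (extDer α) (magGrad α f x) (magGrad α f x).conj).re =
      2 * extDer α (magGrad α f x).re (magGrad α f x).im := by
  simp [Cx.bilinExt, Cx.conj, extDer_neg_right hα]
  rw [extDer_swap hα (magGrad α f x).im]
  ring

variable [IsContMDiffRiemannianBundle (𝓡 n) ∞ (EuclideanSpace ℝ (Fin n))
      (fun x : M ↦ TangentSpace (𝓡 n) x)]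

theorem continuous_magHessNormSq (hα : SmoothForm α) (hf : ContMDiff (𝓡 n) 𝓘(ℝ, ℂ) ∞ f) :
    Continuous (magHessNormSq α f) := by
  have h1 : Continuous fun x ↦ ‖f x‖ ^ 2 * extDerNormSq α x :=
    (hf.continuous.norm.pow 2).mul (continuous_extDerNormSq hα)
  refine continuous_of_chart (n := n) fun x₀ ↦ ?_
  have hP := isSmoothField_magGrad_re hα hf
  have hQ := isSmoothField_magGrad_im hα hf
  have hU := isOpen_extChartAt_target (I := 𝓡 n) x₀
  have hA : ContinuousOn (chartHessRe α f x₀) (extChartAt (𝓡 n) x₀).target :=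
    ((contDiffOn_covD hU (contDiffOn_chartΓ x₀) (hP x₀)).sub
      ((contDiffOn_chartForm hα x₀).smulRight (hQ x₀))).continuousOn
  have hB : ContinuousOn (chartHessIm α f x₀) (extChartAt (𝓡 n) x₀).target :=
    ((contDiffOn_covD hU (contDiffOn_chartΓ x₀) (hQ x₀)).add
      ((contDiffOn_chartForm hα x₀).smulRight (hP x₀))).continuousOn
  have hc : ContinuousOn (extChartAt (𝓡 n) x₀).symm (extChartAt (𝓡 n) x₀).target :=
    continuousOn_extChartAt_symm x₀
  exact ((((endTr _).continuous.comp_continuousOn (hA.clm_comp hA)).add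
    ((endTr _).continuous.comp_continuousOn (hB.clm_comp hB))).add
      (h1.comp_continuousOn hc)).congr fun u hu ↦ magHessNormSq_chart hα hf hu

theorem sesqExt_ricci_magGrad (α : Π y : M, TangentSpace (𝓡 n) y →L[ℝ] ℝ) (f : M → ℂ) (x : M) :
    (Cx.sesqExt ricci (magGrad α f x) (magGrad α f x)).re =
      ricci (magGrad α f x).re (magGrad α f x).re
        + ricci (magGrad α f x).im (magGrad α f x).im := by
  simp [Cx.sesqExt, Cx.bilinExt, Cx.conj, ricci_neg_right]

/-- The magnetic Laplacian of `f`, computed as minus the divergence of the magnetic gradient. -/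
def negMagDiv (α : Π y : M, TangentSpace (𝓡 n) y →L[ℝ] ℝ) (f : M → ℂ) (x : M) : ℂ :=
  -((magDivRe α f x : ℂ) + Complex.I * (magDivIm α f x : ℂ))

theorem contMDiff_negMagDiv (hα : SmoothForm α) (hf : ContMDiff (𝓡 n) 𝓘(ℝ, ℂ) ∞ f) :
    ContMDiff (𝓡 n) 𝓘(ℝ, ℂ) ∞ (negMagDiv α f) := by
  have h1 := Complex.ofRealCLM.contDiff.contMDiff.comp (isSmoothFun_magDivRe hα hf).contMDiff
  have h2 := (Complex.I • Complex.ofRealCLM).contDiff.contMDiff.comp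
    (isSmoothFun_magDivIm hα hf).contMDiff
  exact (h1.add h2).neg

theorem hermForm_magD_eq_add_divergence (hα : SmoothForm α) (hf : ContMDiff (𝓡 n) 𝓘(ℝ, ℂ) ∞ f)
    {φ : M → ℂ} (hφ : ContMDiff (𝓡 n) 𝓘(ℝ, ℂ) ∞ φ) : ∃ X Y : Π y : M, TangentSpace (𝓡 n) y,
      IsSmoothField X ∧ IsSmoothField Y ∧ ∀ x, hermForm (magD α φ x) (magD α f x) =
        φ x * starRingEnd ℂ (negMagDiv α f x)
          + ((divergence X x : ℂ) + Complex.I * (divergence Y x : ℂ)) := by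
  have hP := isSmoothField_magGrad_re hα hf
  have hQ := isSmoothField_magGrad_im hα hf
  have hr := isSmoothFun_re (n := n) hφ
  have hi := isSmoothFun_im (n := n) hφ
  refine ⟨_, _, (hP.smul hr).add (hQ.smul hi), (hP.smul hi).sub (hQ.smul hr), fun x ↦ ?_⟩
  rw [divergence_add (hP.smul hr) (hQ.smul hi), divergence_sub (hP.smul hi) (hQ.smul hr),
    divergence_smul hr hP, divergence_smul hi hQ, divergence_smul hi hP, divergence_smul hr hQ,
    hermForm_magD (magD α φ), magD_eq, magD_eq]
  simp only [inner_magGrad_re hφ, inner_magGrad_im hφ]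
  apply Complex.ext
  · simp [negMagDiv, magDivRe, magDivIm]
    ring
  · simp [negMagDiv, magDivRe, magDivIm]
    ring

variable [MeasurableSpace M] [BorelSpace M] [CompactSpace M]

theorem _root_.Continuous.integrable_riemannianVolume {F : Type*} [NormedAddCommGroup F]
    {φ : M → F} (hφ : Continuous φ) : Integrable φ (riemannianVolume n M) :=
  hφ.integrable_of_hasCompactSupport (HasCompactSupport.of_compactSpace _)

variable [T2Space M]

theorem isMagDAdjoint_negMagDiv (hα : SmoothForm α) (hf : ContMDiff (𝓡 n) 𝓘(ℝ, ℂ) ∞ f) :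
    IsMagDAdjoint α (magD α f) (negMagDiv α f) := by
  refine ⟨contMDiff_negMagDiv hα hf, fun φ hφ ↦ ?_⟩
  obtain ⟨X, Y, hX, hY, h⟩ := hermForm_magD_eq_add_divergence hα hf hφ
  have c0 : Integrable (fun x ↦ φ x * starRingEnd ℂ (negMagDiv α f x)) (riemannianVolume n M) :=
    (hφ.continuous.mul (Complex.continuous_conj.comp
      (contMDiff_negMagDiv hα hf).continuous)).integrable_riemannianVolume
  have cX : Integrable (fun x ↦ (divergence X x : ℂ)) (riemannianVolume n M) :=
    (isSmoothFun_divergence hX).continuous.integrable_riemannianVolume.ofReal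
  have cY : Integrable (fun x ↦ Complex.I * (divergence Y x : ℂ)) (riemannianVolume n M) :=
    (isSmoothFun_divergence hY).continuous.integrable_riemannianVolume.ofReal.const_mul _
  have cXY : Integrable (fun x ↦ (divergence X x : ℂ) + Complex.I * (divergence Y x : ℂ))
      (riemannianVolume n M) := cX.add cY
  simp only [h]
  rw [integral_add c0 cXY, integral_add cX cY, integral_const_mul,
    integral_complex_ofReal, integral_complex_ofReal, integral_divergence_eq_zero hX,
      integral_divergence_eq_zero hY]
  simp

theorem isMagDAdjoint_magLaplacian (hα : SmoothForm α) (hf : ContMDiff (𝓡 n) 𝓘(ℝ, ℂ) ∞ f) :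
    IsMagDAdjoint α (magD α f) (magLaplacian α f) :=
  Classical.epsilon_spec ⟨_, isMagDAdjoint_negMagDiv hα hf⟩

theorem integral_herm_magGrad_magLaplacian (hα : SmoothForm α)
    (hf : ContMDiff (𝓡 n) 𝓘(ℝ, ℂ) ∞ f) :
    ∫ x, (herm (magGrad α (magLaplacian α f) x) (magGrad α f x)).re ∂(riemannianVolume n M) =
      ∫ x, (magDivRe α f x ^ 2 + magDivIm α f x ^ 2) ∂(riemannianVolume n M) := by
  obtain ⟨hL, hL'⟩ := isMagDAdjoint_magLaplacian hα hf
  obtain ⟨hD, hD'⟩ := isMagDAdjoint_negMagDiv hα hf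
  have hLc := hL.continuous
  have hDc := hD.continuous
  have hi : ∀ {g h : M → ℂ}, Continuous g → Continuous h →
      Integrable (fun x ↦ g x * starRingEnd ℂ (h x)) (riemannianVolume n M) := fun hg hh ↦
    (hg.mul (Complex.continuous_conj.comp hh)).integrable_riemannianVolume
  -- both `Δ^α f` and `negMagDiv α f` represent the same antilinear form on smooth functions
  have e1 : ∫ x, negMagDiv α f x * starRingEnd ℂ (magLaplacian α f x) ∂(riemannianVolume n M) =
      ∫ x, negMagDiv α f x * starRingEnd ℂ (negMagDiv α f x) ∂(riemannianVolume n M) :=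
    (hL' _ hD).symm.trans (hD' _ hD)
  have key : ∫ x, (magLaplacian α f x * starRingEnd ℂ (negMagDiv α f x)).re
        ∂(riemannianVolume n M) =
      ∫ x, (negMagDiv α f x * starRingEnd ℂ (negMagDiv α f x)).re ∂(riemannianVolume n M) := by
    have h2 := congrArg Complex.re e1
    rw [← RCLike.re_eq_complex_re, ← integral_re (hi hDc hLc), ← integral_re (hi hDc hDc)] at h2
    refine Eq.trans (integral_congr_ae (.of_forall fun x ↦ ?_)) h2
    simp
    ring
  obtain ⟨X, Y, hX, hY, h⟩ := hermForm_magD_eq_add_divergence hα hf hL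
  have hint : Integrable (fun x ↦ hermForm (magD α (magLaplacian α f) x) (magD α f x))
      (riemannianVolume n M) := by
    simp only [h]
    exact (hi hLc hDc).add
      ((isSmoothFun_divergence hX).continuous.integrable_riemannianVolume.ofReal.add
        ((isSmoothFun_divergence hY).continuous.integrable_riemannianVolume.ofReal.const_mul _))
  simp only [herm_magGrad_re]
  calc _ = (∫ x, hermForm (magD α (magLaplacian α f) x) (magD α f x) ∂(riemannianVolume n M)).re :=
        integral_re hint
    _ = (∫ x, magLaplacian α f x * starRingEnd ℂ (negMagDiv α f x) ∂(riemannianVolume n M)).re := by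
        rw [hD' _ hL]
    _ = _ := by
        rw [← RCLike.re_eq_complex_re, ← integral_re (hi hLc hDc)]
        refine key.trans (integral_congr_ae (.of_forall fun x ↦ ?_))
        simp [negMagDiv]
        ring

end Integration

end MagneticLaplacian

end

theorem corollary4p2 (n : ℕ) (M : Type*) [TopologicalSpace M] [T2Space M] [CompactSpace M]
    [ChartedSpace (EuclideanSpace ℝ (Fin n)) M] [IsManifold (𝓡 n) ∞ M]
    [RiemannianBundle (fun x : M ↦ TangentSpace (𝓡 n) x)]
    [IsContMDiffRiemannianBundle (𝓡 n) ∞ (EuclideanSpace ℝ (Fin n))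
      (fun x : M ↦ TangentSpace (𝓡 n) x)]
    [MeasurableSpace M] [BorelSpace M]
    (α : Π x : M, TangentSpace (𝓡 n) x →L[ℝ] ℝ)
    (hα : ContMDiff (𝓡 n) ((𝓡 n).prod 𝓘(ℝ, EuclideanSpace ℝ (Fin n) →L[ℝ] ℝ)) ∞
      (fun x ↦ TotalSpace.mk' (EuclideanSpace ℝ (Fin n) →L[ℝ] ℝ)
        (E := fun x : M ↦ TangentSpace (𝓡 n) x →L[ℝ] ℝ) x (α x)))
    (f : M → ℂ) (hf : ContMDiff (𝓡 n) 𝓘(ℝ, ℂ) ∞ f) :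
    Integrable (fun x ↦ magHessNormSq α f x) (riemannianVolume n M) ∧
    Integrable (fun x ↦ (Cx.sesqExt ricci (magGrad α f x) (magGrad α f x)).re)
      (riemannianVolume n M) ∧
    Integrable (fun x ↦ (herm (magGrad α (magLaplacian α f) x) (magGrad α f x)).re)
      (riemannianVolume n M) ∧
    Integrable (fun x ↦ ‖f x‖ ^ 2 * extDerNormSq α x) (riemannianVolume n M) ∧
    Integrable (fun x ↦ (Complex.I *
      Cx.bilinExt (extDer α) (magGrad α f x) (magGrad α f x).conj).re) (riemannianVolume n M) ∧
    (∫ x, magHessNormSq α f x ∂(riemannianVolume n M))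
      + (∫ x, (Cx.sesqExt ricci (magGrad α f x) (magGrad α f x)).re ∂(riemannianVolume n M))
      - (∫ x, (herm (magGrad α (magLaplacian α f) x) (magGrad α f x)).re
          ∂(riemannianVolume n M))
      - (∫ x, ‖f x‖ ^ 2 * extDerNormSq α x ∂(riemannianVolume n M))
      + (∫ x, (Complex.I *
          Cx.bilinExt (extDer α) (magGrad α f x) (magGrad α f x).conj).re
          ∂(riemannianVolume n M)) = 0 := by
  have cH : Integrable (fun x ↦ magHessNormSq α f x) (riemannianVolume n M) :=
    (continuous_magHessNormSq hα hf).integrable_riemannianVolume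
  have cN : Integrable (fun x ↦ ‖f x‖ ^ 2 * extDerNormSq α x) (riemannianVolume n M) :=
    ((hf.continuous.norm.pow 2).mul (continuous_extDerNormSq hα)).integrable_riemannianVolume
  have hP := isSmoothField_magGrad_re hα hf
  have hQ := isSmoothField_magGrad_im hα hf
  have cE : Integrable (fun x ↦ (Complex.I *
      Cx.bilinExt (extDer α) (magGrad α f x) (magGrad α f x).conj).re) (riemannianVolume n M) := by
    simp only [bilinExt_extDer_magGrad hα]
    exact ((continuous_extDer_apply hα hP hQ).const_mul 2).integrable_riemannianVolume
  have cL : Integrable (fun x ↦ (herm (magGrad α (magLaplacian α f) x) (magGrad α f x)).re)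
      (riemannianVolume n M) := by
    have hL := (isMagDAdjoint_magLaplacian hα hf).1
    simp only [herm_re]
    exact ((continuous_inner_of_isSmoothField (isSmoothField_magGrad_re hα hL) hP).add
      (continuous_inner_of_isSmoothField (isSmoothField_magGrad_im hα hL)
        hQ)).integrable_riemannianVolume
  have cT : Integrable (fun x ↦ magDivRe α f x ^ 2 + magDivIm α f x ^ 2)
      (riemannianVolume n M) :=
    (((isSmoothFun_magDivRe hα hf).continuous.pow 2).add
      ((isSmoothFun_magDivIm hα hf).continuous.pow 2)).integrable_riemannianVolume
  have hX := isSmoothField_bochnerField hα hf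
  have cX := (isSmoothFun_divergence hX).continuous.integrable_riemannianVolume (n := n)
  have hR : ∀ x, (Cx.sesqExt ricci (magGrad α f x) (magGrad α f x)).re =
      divergence (bochnerField α f) x - magHessNormSq α f x + ‖f x‖ ^ 2 * extDerNormSq α x
        + (magDivRe α f x ^ 2 + magDivIm α f x ^ 2)
        - (Complex.I * Cx.bilinExt (extDer α) (magGrad α f x) (magGrad α f x).conj).re := by
    intro x
    rw [sesqExt_ricci_magGrad, bilinExt_extDer_magGrad hα, divergence_bochnerField hα hf]
    ring
  have c1 : Integrable (fun x ↦ divergence (bochnerField α f) x - magHessNormSq α f x)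
      (riemannianVolume n M) := cX.sub cH
  have c2 : Integrable (fun x ↦ divergence (bochnerField α f) x - magHessNormSq α f x
      + ‖f x‖ ^ 2 * extDerNormSq α x) (riemannianVolume n M) := c1.add cN
  have c3 : Integrable (fun x ↦ divergence (bochnerField α f) x - magHessNormSq α f x
      + ‖f x‖ ^ 2 * extDerNormSq α x + (magDivRe α f x ^ 2 + magDivIm α f x ^ 2))
      (riemannianVolume n M) := c2.add cT
  simp only [hR]
  refine ⟨cH, c3.sub cE, cL, cN, cE, ?_⟩
  rw [integral_sub c3 cE, integral_add c2 cT, integral_add c1 cN, integral_sub cX cH,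
    integral_divergence_eq_zero hX, integral_herm_magGrad_magLaplacian hα hf]
  ring
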